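/- Let $\ell,T>0$ and let $\rho,\mu\in L^\infty(0,\ell)$, $r,\kappa\in H^2(0,\ell)$ satisfy $0<\rho_0\le\rho\le\rho_1$, $0\le\mu_0\le\mu\le\mu_1$, $0<r_0\le r\le r_1$, $0<\kappa_0\le\kappa\le\kappa_1$ with constants $\rho_0,\dots,\kappa_1$. Put $V=\{v\in H^2(0,\ell): v(0)=v_x(0)=0\}$ with the norm of $H^2(0,\ell)$, and let $(\cdot,\cdot)$ be the inner product of $L^2(0,\ell)$. For $m\in\{1,3\}$ let $X_m=\{g\in H^m(0,T): g(0)=\dots=g^{(m-1)}(0)=0\}$ with the norm of $H^m(0,T)$, and let $\mathcal G_m=\{g\in X_m:\|g\|_{H^m(0,T)}\le C_m\}$, where $C_m>0$ is arbitrary. **Direct problem.** For $g\in X_1$, a weak solution $u=u(\cdot,\cdot;g)$ of $$\rho u_{tt}+\mu u_t+(ru_{xx})_{xx}+(\kappa u_{xxt})_{xx}=0,\quad u(x,0)=u_t(x,0)=0,\quad u(0,t)=u_x(0,t)=0,$$ $$[ru_{xx}+\kappa u_{xxt}]_{x=\ell}=0,\quad -[(ru_{xx}+\kappa u_{xxt})_x]_{x=\ell}=g(t)$$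 is a function $u\in H^1(0,T;V)$ with $u_{tt}\in L^2(0,T;L^2(0,\ell))$, $u(0)=u_t(0)=0$ and, for every $v\in V$ and a.e. $t$, $(\rho u_{tt},v)+(\mu u_t,v)+(ru_{xx},v_{xx})+(\kappa u_{xxt},v_{xx})=g(t)v(\ell)$. **Adjoint problems.** Both have the equation $\rho\phi_{tt}-\mu\phi_t+(r\phi_{xx})_{xx}-(\kappa\phi_{xxt})_{xx}=0$, the terminal conditions $\phi(x,T)=\phi_t(x,T)=0$ and $[r\phi_{xx}-\kappa\phi_{xxt}]_{x=\ell}=0$. (A) With $\phi(0,t)=\phi_x(0,t)=0$ and $[(-r\phi_{xx}+\kappa\phi_{xxt})_x]_{x=\ell}=\xi(t)$. A weak solution is a function $\phi\in H^1(0,T;V)$ with $\phi_{tt}\in L^2(0,T;L^2(0,\ell))$, $\phi(T)=\phi_t(T)=0$ and, for every $v\in V$ and a.e. $t$, $(\rho\phi_{tt},v)-(\mu\phi_t,v)+(r\phi_{xx},v_{xx})-(\kappa\phi_{xxt},v_{xx})=\xi(t)v(\ell)$. (B) With $\varphi$ in place of $\phi$, and $\varphi(0,t)=0$, $\varphi_x(0,t)=\theta(t)$,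 $[(-r\varphi_{xx}+\kappa\varphi_{xxt})_x]_{x=\ell}=0$. A weak solution is a function $\varphi\in L^2(0,T;H^2(0,\ell))$ with $\varphi(0,t)=0$, $\varphi_x(0,t)=\theta(t)$ for a.e. $t$ and $$\int_0^T\!\!\int_0^\ell\big(\rho\varphi\,\eta_{tt}+\mu\varphi\,\eta_t+r\varphi_{xx}\eta_{xx}+\kappa\varphi_{xx}\eta_{xxt}\big)\,dx\,dt=0$$ for all $\eta\in H^1(0,T;V)$ with $\eta_{tt}\in L^2(0,T;L^2(0,\ell))$ and $\eta(0)=\eta_t(0)=0$. **Theorem.** (i1) For every $g\in X_1$ the direct problem has exactly one weak solution, and $\Phi g:=u(\ell,\cdot;g)\in L^2(0,T)$. Let $\nu\in H^1(0,T)$ and $\mathcal J_1(g)=\frac12\|\Phi g-\nu\|_{L^2(0,T)}^2$. Then for every $g\in\mathcal G_1$ problem (A) with $\xi=u(\ell,\cdot;g)-\nu$ has exactly one weak solution $\phi$, and $\mathcal J_1:X_1\to\mathbb R$ is Fréchet differentiable at $g$ with gradient $\mathcal J_1'(g)(t)=\phi(\ell,t)$; that is, $\phi(\ell,\cdot)\in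 L^2(0,T)$, and the derivative is $h\mapsto\int_0^T\phi(\ell,t)h(t)\,dt$. (i2) Suppose in addition that $r,\kappa\in H^4(0,\ell)$ and $\rho,\mu\in H^2(0,\ell)$. For every $g\in X_3$ the weak solution $u$ of the direct problem is such that $u_{xx}(\cdot,t)$ and $u_{xxt}(\cdot,t)$ have representatives continuous on $[0,\ell]$ for a.e. $t$, and $\Psi g:=-(r(0)u_{xx}(0,\cdot;g)+\kappa(0)u_{xxt}(0,\cdot;g))\in L^2(0,T)$. Let $\omega\in H^2(0,T)$ and $\mathcal J_2(g)=\frac12\|\Psi g-\omega\|_{L^2(0,T)}^2$. Then for every $g\in\mathcal G_3$ the function $\theta=r(0)u_{xx}(0,\cdot;g)+\kappa(0)u_{xxt}(0,\cdot;g)+\omega$ belongs to $H^2(0,T)$, problem (B) with this $\theta$ has exactly one weak solution $\varphi$, and $\mathcal J_2:X_3\to\mathbb R$ is Fréchet differentiable at $g$ with gradient $\mathcal J_2'(g)(t)=\varphi(\ell,t)$, in the same sense as in (i1). If moreover $\theta(T)=\theta'(T)=0$, then $\varphi\in H^1(0,T;H^2(0,\ell))$, $\varphi_{tt}\in L^2(0,T;L^2(0,\ell))$,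 $\varphi(T)=\varphi_t(T)=0$ and, for every $v\in V$ and a.e. $t$, $(\rho\varphi_{tt},v)-(\mu\varphi_t,v)+(r\varphi_{xx},v_{xx})-(\kappa\varphi_{xxt},v_{xx})=0$. -/

import Mathlib

open MeasureTheory Set

noncomputable section

namespace KVBeam

/-! ### Sobolev spaces on an interval, with values in a Banach space -/

/-- Lebesgue measure on the open interval `(a, b)`. -/
abbrev vol (a b : ℝ) : Measure ℝ := volume.restrict (Ioo a b)

/-- `L²(a, b; E)`. -/
abbrev L2 (a b : ℝ) (E : Type*) [NormedAddCommGroup E] : Type _ := Lp E 2 (vol a b)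

/-- Test functions: smooth functions with compact support inside `(a, b)`. -/
def IsTest (a b : ℝ) (η : ℝ → ℝ) : Prop :=
  ContDiff ℝ (⊤ : ℕ∞) η ∧ HasCompactSupport η ∧ tsupport η ⊆ Ioo a b

section Sobolev

variable {E : Type*} [NormedAddCommGroup E]

/-- The class of `f` on `(a, b)` has a representative that is continuous on `[a, b]`, and the value
of this representative at `x` is `c`. -/
def HasValue (a b : ℝ) (f : ℝ → E) (x : ℝ) (c : E) : Prop :=
  ∃ F : ℝ → E, ContinuousOn F (Icc a b) ∧ F =ᵐ[vol a b] f ∧ F x = c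

/-- The value at `x` of the continuous representative (and `0` if there is none). -/
def value (a b : ℝ) (f : ℝ → E) (x : ℝ) : E :=
  open Classical in if h : ∃ c, HasValue a b f x c then h.choose else 0

theorem HasValue.unique {a b : ℝ} (hab : a < b) {f : ℝ → E} {x : ℝ} (hx : x ∈ Icc a b) {c d : E}
    (hc : HasValue a b f x c) (hd : HasValue a b f x d) : c = d := by
  obtain ⟨F, hF, hFf, rfl⟩ := hc
  obtain ⟨G, hG, hGf, rfl⟩ := hd
  have h : F =ᵐ[volume.restrict (Icc a b)] G := by
    rw [← restrict_Ioo_eq_restrict_Icc]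
    exact hFf.trans hGf.symm
  exact Measure.eqOn_Icc_of_ae_eq volume hab.ne h hF hG hx

theorem HasValue.value_eq {a b : ℝ} (hab : a < b) {f : ℝ → E} {x : ℝ} (hx : x ∈ Icc a b) {c : E}
    (hc : HasValue a b f x c) : value a b f x = c := by
  have h : ∃ c, HasValue a b f x c := ⟨c, hc⟩
  rw [value, dif_pos h]
  exact HasValue.unique hab hx h.choose_spec hc

variable [NormedSpace ℝ E]

/-- `f'` is the weak (distributional) derivative of `f` on `(a, b)`. It is used for complete `E` only
(`ℝ`, `L²(0, ℓ)`, `H²(0, ℓ)` and the closed subspace `V` of the latter). -/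
def HasWeakDeriv (a b : ℝ) (f f' : ℝ → E) : Prop :=
  ∀ η : ℝ → ℝ, IsTest a b η →
    ∫ t in Ioo a b, deriv η t • f t = - ∫ t in Ioo a b, η t • f' t

theorem IsTest.integrable_smul {a b : ℝ} {η : ℝ → ℝ} (h : IsTest a b η) (f : L2 a b E) :
    Integrable (fun t => η t • f t) (vol a b) := by
  have hf : Integrable f (vol a b) := (Lp.memLp f).integrable (by norm_num)
  obtain ⟨C, hC⟩ := h.2.1.exists_bound_of_continuous h.1.continuous
  exact hf.bdd_smul C h.1.continuous.aestronglyMeasurable (Filter.Eventually.of_forall hC)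

theorem IsTest.integrable_deriv_smul {a b : ℝ} {η : ℝ → ℝ} (h : IsTest a b η) (f : L2 a b E) :
    Integrable (fun t => deriv η t • f t) (vol a b) := by
  have hf : Integrable f (vol a b) := (Lp.memLp f).integrable (by norm_num)
  have hc : Continuous (deriv η) := h.1.continuous_deriv (by norm_num)
  obtain ⟨C, hC⟩ := h.2.1.deriv.exists_bound_of_continuous hc
  exact hf.bdd_smul C hc.aestronglyMeasurable (Filter.Eventually.of_forall hC)

theorem HasWeakDeriv.zero (a b : ℝ) :
    HasWeakDeriv a b ((0 : L2 a b E) : ℝ → E) ((0 : L2 a b E) : ℝ → E) := by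
  intro η _
  have h : ((0 : L2 a b E) : ℝ → E) =ᵐ[vol a b] 0 := Lp.coeFn_zero _ _ _
  rw [integral_eq_zero_of_ae (h.mono fun t ht => by rw [ht]; simp),
    integral_eq_zero_of_ae (h.mono fun t ht => by rw [ht]; simp), neg_zero]

theorem HasWeakDeriv.add {a b : ℝ} {f f' g g' : L2 a b E} (hf : HasWeakDeriv a b f f')
    (hg : HasWeakDeriv a b g g') :
    HasWeakDeriv a b ((f + g : L2 a b E) : ℝ → E) ((f' + g' : L2 a b E) : ℝ → E) := by
  intro η hη
  have e1 : ∫ t in Ioo a b, deriv η t • ((f + g : L2 a b E) : ℝ → E) t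
      = (∫ t in Ioo a b, deriv η t • f t) + ∫ t in Ioo a b, deriv η t • g t := by
    rw [← integral_add (hη.integrable_deriv_smul _) (hη.integrable_deriv_smul _)]
    exact integral_congr_ae ((Lp.coeFn_add f g).mono fun t ht => by
      beta_reduce; rw [ht, Pi.add_apply, smul_add])
  have e2 : ∫ t in Ioo a b, η t • ((f' + g' : L2 a b E) : ℝ → E) t
      = (∫ t in Ioo a b, η t • f' t) + ∫ t in Ioo a b, η t • g' t := by
    rw [← integral_add (hη.integrable_smul _) (hη.integrable_smul _)]
    exact integral_congr_ae ((Lp.coeFn_add f' g').mono fun t ht => by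
      beta_reduce; rw [ht, Pi.add_apply, smul_add])
  rw [e1, e2, hf η hη, hg η hη, neg_add]

theorem HasWeakDeriv.smul {a b : ℝ} (c : ℝ) {f f' : L2 a b E} (hf : HasWeakDeriv a b f f') :
    HasWeakDeriv a b ((c • f : L2 a b E) : ℝ → E) ((c • f' : L2 a b E) : ℝ → E) := by
  intro η hη
  have e1 : ∫ t in Ioo a b, deriv η t • ((c • f : L2 a b E) : ℝ → E) t
      = c • ∫ t in Ioo a b, deriv η t • f t := by
    rw [← integral_smul]
    exact integral_congr_ae ((Lp.coeFn_smul c f).mono fun t ht => by simp [ht, smul_comm c])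
  have e2 : ∫ t in Ioo a b, η t • ((c • f' : L2 a b E) : ℝ → E) t
      = c • ∫ t in Ioo a b, η t • f' t := by
    rw [← integral_smul]
    exact integral_congr_ae ((Lp.coeFn_smul c f').mono fun t ht => by simp [ht, smul_comm c])
  rw [e1, e2, hf η hη, smul_neg]

variable (E) in
/-- The Sobolev space `H^m(a, b; E)` as a submodule of a product of `L²` spaces, see `Sobolev`. -/
def sobolevSubmodule (m : ℕ) (a b : ℝ) : Submodule ℝ (PiLp 2 (fun _ : Fin (m + 1) => L2 a b E)) where
  carrier := {f | ∀ j : Fin m, HasWeakDeriv a b (f j.castSucc) (f j.succ)}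
  zero_mem' := fun _ => HasWeakDeriv.zero a b
  add_mem' := fun hf hg j => (hf j).add (hg j)
  smul_mem' := fun c _ hf j => (hf j).smul c

variable (E) in
/-- The Sobolev space `H^m(a, b; E)`. An element is the tuple `(f, f', …, f^(m))` of an `L²` function
and its weak derivatives up to order `m`, all in `L²`; the norm is the usual one,
`(‖f‖² + ‖f'‖² + … + ‖f^(m)‖²)^(1/2)` with `L²` norms. -/
abbrev Sobolev (m : ℕ) (a b : ℝ) : Type _ := sobolevSubmodule E m a b

/-- The weak derivative of order `j` of a Sobolev function, as an element of `L²(a, b; E)`. -/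
def Sobolev.comp {m : ℕ} {a b : ℝ} (f : Sobolev E m a b) (j : Fin (m + 1)) : L2 a b E :=
  (f : PiLp 2 (fun _ : Fin (m + 1) => L2 a b E)) j

/-- The weak derivative of order `j` of a Sobolev function, as a function (a representative). -/
def Sobolev.D {m : ℕ} {a b : ℝ} (f : Sobolev E m a b) (j : Fin (m + 1)) : ℝ → E :=
  f.comp j

end Sobolev

/-- The function `f` belongs to `H^m(a, b)`. -/
def MemSobolev (m : ℕ) (a b : ℝ) (f : ℝ → ℝ) : Prop :=
  ∃ F : Sobolev ℝ m a b, F.D 0 =ᵐ[vol a b] f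

/-- The functions in `H^m(a, b)` that vanish at `a` with their derivatives up to order `m - 1`, as a
submodule. -/
def leftSubmodule (m : ℕ) (a b : ℝ) : Submodule ℝ (Sobolev ℝ m a b) where
  carrier := {f : Sobolev ℝ m a b | ∀ j : Fin m, HasValue a b (f.D j.castSucc) a 0}
  zero_mem' := fun _ => ⟨0, continuousOn_const, (Lp.coeFn_zero _ _ _).symm, rfl⟩
  add_mem' := by
    intro f g hf hg j
    obtain ⟨F, hF, hFf, hF0⟩ := hf j
    obtain ⟨G, hG, hGg, hG0⟩ := hg j
    exact ⟨F + G, hF.add hG,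
      (hFf.add hGg).trans (Lp.coeFn_add (f.comp j.castSucc) (g.comp j.castSucc)).symm,
      by simp [hF0, hG0]⟩
  smul_mem' := by
    intro c f hf j
    obtain ⟨F, hF, hFf, hF0⟩ := hf j
    exact ⟨c • F, hF.const_smul c,
      (hFf.const_smul c).trans (Lp.coeFn_smul c (f.comp j.castSucc)).symm, by simp [hF0]⟩

/-- `{f ∈ H^m(a, b) : f(a) = f'(a) = … = f^(m-1)(a) = 0}`, with the norm of `H^m(a, b)`. -/
abbrev SobolevLeft (m : ℕ) (a b : ℝ) : Type := leftSubmodule m a b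

/-- The derivatives (as functions) of an element of `SobolevLeft`. -/
def SobolevLeft.D {m : ℕ} {a b : ℝ} (f : SobolevLeft m a b) (j : Fin (m + 1)) : ℝ → ℝ :=
  (f : Sobolev ℝ m a b).D j

/-- `H²(0, ℓ)`. -/
abbrev H2 (ℓ : ℝ) : Type := Sobolev ℝ 2 0 ℓ

/-- The energy space `V = {v ∈ H²(0, ℓ) : v(0) = v_x(0) = 0}`, with the norm of `H²(0, ℓ)`. -/
abbrev V (ℓ : ℝ) : Type := SobolevLeft 2 0 ℓ

/-- The embedding `V → L²(0, ℓ)`. -/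
def V.toL2 {ℓ : ℝ} (v : V ℓ) : L2 0 ℓ ℝ := (v : H2 ℓ).comp 0

/-- The value `v(ℓ)` at the right end, for `v ∈ H²(0, ℓ)`. -/
def tip {ℓ : ℝ} (v : H2 ℓ) : ℝ := value 0 ℓ (v.D 0) ℓ

/-! ### The beam and its problems -/

/-- A beam of length `ℓ` observed during the time `T`, with density `ρ`, external damping `μ`,
flexural rigidity `r` and Kelvin-Voigt damping `κ`. The coefficients matter on `[0, ℓ]` only. -/
structure Beam where
  ℓ : ℝ
  T : ℝ
  ρ : ℝ → ℝ
  μ : ℝ → ℝ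
  r : ℝ → ℝ
  κ : ℝ → ℝ

namespace Beam

/-- The standing assumptions on the coefficients: `ρ, μ ∈ L^∞(0, ℓ)`, `r, κ ∈ H²(0, ℓ)`, with
`0 < ρ₀ ≤ ρ ≤ ρ₁`, `0 ≤ μ₀ ≤ μ ≤ μ₁`, `0 < r₀ ≤ r ≤ r₁`, `0 < κ₀ ≤ κ ≤ κ₁`. The functions `r, κ` are
the continuous representatives, so that `r(0)` and `κ(0)` make sense. -/
structure Basic (B : Beam) : Prop where
  length_pos : 0 < B.ℓ
  time_pos : 0 < B.T
  meas_ρ : AEStronglyMeasurable B.ρ (vol 0 B.ℓ)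
  meas_μ : AEStronglyMeasurable B.μ (vol 0 B.ℓ)
  cont_r : ContinuousOn B.r (Icc 0 B.ℓ)
  cont_κ : ContinuousOn B.κ (Icc 0 B.ℓ)
  sobolev_r : MemSobolev 2 0 B.ℓ B.r
  sobolev_κ : MemSobolev 2 0 B.ℓ B.κ
  bound_ρ : ∃ ρ₀ ρ₁ : ℝ, 0 < ρ₀ ∧ ∀ᵐ x ∂vol 0 B.ℓ, ρ₀ ≤ B.ρ x ∧ B.ρ x ≤ ρ₁
  bound_μ : ∃ μ₀ μ₁ : ℝ, 0 ≤ μ₀ ∧ ∀ᵐ x ∂vol 0 B.ℓ, μ₀ ≤ B.μ x ∧ B.μ x ≤ μ₁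
  bound_r : ∃ r₀ r₁ : ℝ, 0 < r₀ ∧ ∀ x ∈ Icc 0 B.ℓ, r₀ ≤ B.r x ∧ B.r x ≤ r₁
  bound_κ : ∃ κ₀ κ₁ : ℝ, 0 < κ₀ ∧ ∀ x ∈ Icc 0 B.ℓ, κ₀ ≤ B.κ x ∧ B.κ x ≤ κ₁

/-- The additional regularity of the coefficients: `r, κ ∈ H⁴(0, ℓ)` and `ρ, μ ∈ H²(0, ℓ)`. -/
structure Regular (B : Beam) : Prop where
  sobolev_r : MemSobolev 4 0 B.ℓ B.r
  sobolev_κ : MemSobolev 4 0 B.ℓ B.κ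
  sobolev_ρ : MemSobolev 2 0 B.ℓ B.ρ
  sobolev_μ : MemSobolev 2 0 B.ℓ B.μ

variable (B : Beam)

/-- `u ∈ H¹(0, T; V)` with `u_tt ∈ L²(0, T; L²(0, ℓ))` is the weak solution of the direct problem
`ρ u_tt + μ u_t + (r u_xx)_xx + (κ u_xxt)_xx = 0`, `u(x, 0) = u_t(x, 0) = 0`,
`u(0, t) = u_x(0, t) = 0`, `[r u_xx + κ u_xxt](ℓ, t) = 0`, `-[(r u_xx + κ u_xxt)_x](ℓ, t) = g(t)`. -/
def IsDirectSolution (g : ℝ → ℝ) (u : Sobolev (V B.ℓ) 1 0 B.T) : Prop :=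
  ∃ utt : L2 0 B.T (L2 0 B.ℓ ℝ),
    HasWeakDeriv 0 B.T (fun t => (u.D 1 t).toL2) utt ∧
    (∀ v : V B.ℓ, ∀ᵐ t ∂vol 0 B.T,
      ∫ x in Ioo 0 B.ℓ, (B.ρ x * utt t x * v.D 0 x + B.μ x * (u.D 1 t).D 0 x * v.D 0 x
        + B.r x * (u.D 0 t).D 2 x * v.D 2 x + B.κ x * (u.D 1 t).D 2 x * v.D 2 x)
      = g t * tip v.1) ∧
    HasValue 0 B.T (u.D 0) 0 0 ∧
    HasValue 0 B.T (fun t => (u.D 1 t).toL2) 0 0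

/-- The weak solution `u(·, ·; g)` of the direct problem (and `0` if there is none). -/
def sol (g : ℝ → ℝ) : Sobolev (V B.ℓ) 1 0 B.T :=
  open Classical in if h : ∃ u, B.IsDirectSolution g u then h.choose else 0

/-- The output operator `(Φ g)(t) = u(ℓ, t; g)`. -/
def Φ (g : ℝ → ℝ) (t : ℝ) : ℝ := tip ((B.sol g).D 0 t).1

/-- The output operator `(Ψ g)(t) = -(r(0) u_xx(0, t; g) + κ(0) u_xxt(0, t; g))`. -/
def Ψ (g : ℝ → ℝ) (t : ℝ) : ℝ :=
  -(B.r 0 * value 0 B.ℓ (((B.sol g).D 0 t).D 2) 0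
    + B.κ 0 * value 0 B.ℓ (((B.sol g).D 1 t).D 2) 0)

/-- The set of admissible inputs
`{g ∈ H^m(0, T) : g(0) = … = g^(m-1)(0) = 0, ‖g‖ ≤ C}`, for `m = 1` and `m = 3`. -/
def Admissible (m : ℕ) (C : ℝ) : Set (SobolevLeft m 0 B.T) := {g | ‖g‖ ≤ C}

/-- The Tikhonov functional `J₁(g) = ½ ‖Φ g - ν‖²`, with the norm of `L²(0, T)`. -/
def J₁ (ν : ℝ → ℝ) (g : SobolevLeft 1 0 B.T) : ℝ :=
  1 / 2 * ∫ t in Ioo 0 B.T, (B.Φ (g.D 0) t - ν t) ^ 2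

/-- The Tikhonov functional `J₂(g) = ½ ‖Ψ g - ω‖²`, with the norm of `L²(0, T)`. -/
def J₂ (ω : ℝ → ℝ) (g : SobolevLeft 3 0 B.T) : ℝ :=
  1 / 2 * ∫ t in Ioo 0 B.T, (B.Ψ (g.D 0) t - ω t) ^ 2

/-- `φ ∈ H¹(0, T; V)` with `φ_tt ∈ L²(0, T; L²(0, ℓ))` is the weak solution of the adjoint problem
`ρ φ_tt - μ φ_t + (r φ_xx)_xx - (κ φ_xxt)_xx = 0`, `φ(x, T) = φ_t(x, T) = 0`,
`φ(0, t) = φ_x(0, t) = 0`, `[r φ_xx - κ φ_xxt](ℓ, t) = 0`, `[(-r φ_xx + κ φ_xxt)_x](ℓ, t) = ξ(t)`. -/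
def IsNeumannAdjoint (ξ : ℝ → ℝ) (φ : Sobolev (V B.ℓ) 1 0 B.T) : Prop :=
  ∃ φtt : L2 0 B.T (L2 0 B.ℓ ℝ),
    HasWeakDeriv 0 B.T (fun t => (φ.D 1 t).toL2) φtt ∧
    (∀ v : V B.ℓ, ∀ᵐ t ∂vol 0 B.T,
      ∫ x in Ioo 0 B.ℓ, (B.ρ x * φtt t x * v.D 0 x - B.μ x * (φ.D 1 t).D 0 x * v.D 0 x
        + B.r x * (φ.D 0 t).D 2 x * v.D 2 x - B.κ x * (φ.D 1 t).D 2 x * v.D 2 x)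
      = ξ t * tip v.1) ∧
    HasValue 0 B.T (φ.D 0) B.T 0 ∧
    HasValue 0 B.T (fun t => (φ.D 1 t).toL2) B.T 0

/-- `φ ∈ L²(0, T; H²(0, ℓ))` is the weak solution of the adjoint problem
`ρ φ_tt - μ φ_t + (r φ_xx)_xx - (κ φ_xxt)_xx = 0`, `φ(x, T) = φ_t(x, T) = 0`,
`φ(0, t) = 0`, `φ_x(0, t) = θ(t)`, `[r φ_xx - κ φ_xxt](ℓ, t) = 0`, `[(-r φ_xx + κ φ_xxt)_x](ℓ, t) = 0`.
The time derivatives are moved to the test functions `η`, which vanish with `η_t` at `t = 0`; the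
terminal conditions are contained in the identity. Such a solution makes sense also if `θ` is not
compatible with the terminal conditions, that is, if `θ(T) ≠ 0` or `θ'(T) ≠ 0`. -/
def IsDirichletAdjoint (θ : ℝ → ℝ) (φ : L2 0 B.T (H2 B.ℓ)) : Prop :=
  (∀ᵐ t ∂vol 0 B.T,
    HasValue 0 B.ℓ ((φ t).D 0) 0 0 ∧ HasValue 0 B.ℓ ((φ t).D 1) 0 (θ t)) ∧
  ∀ (η : Sobolev (V B.ℓ) 1 0 B.T) (ηtt : L2 0 B.T (L2 0 B.ℓ ℝ)),
    HasWeakDeriv 0 B.T (fun t => (η.D 1 t).toL2) ηtt →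
    HasValue 0 B.T (η.D 0) 0 0 →
    HasValue 0 B.T (fun t => (η.D 1 t).toL2) 0 0 →
    ∫ t in Ioo 0 B.T, ∫ x in Ioo 0 B.ℓ,
      (B.ρ x * (φ t).D 0 x * ηtt t x + B.μ x * (φ t).D 0 x * (η.D 1 t).D 0 x
        + B.r x * (φ t).D 2 x * (η.D 0 t).D 2 x + B.κ x * (φ t).D 2 x * (η.D 1 t).D 2 x) = 0

/-- The same adjoint problem, in the sense that is used for the direct problem:
`φ ∈ H¹(0, T; H²(0, ℓ))`, `φ_tt ∈ L²(0, T; L²(0, ℓ))`, the identity holds at almost every time, and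
the terminal values are attained. -/
def IsRegularDirichletAdjoint (θ : ℝ → ℝ) (φ : Sobolev (H2 B.ℓ) 1 0 B.T) : Prop :=
  ∃ φtt : L2 0 B.T (L2 0 B.ℓ ℝ),
    HasWeakDeriv 0 B.T (fun t => (φ.D 1 t).comp 0) φtt ∧
    (∀ᵐ t ∂vol 0 B.T,
      HasValue 0 B.ℓ ((φ.D 0 t).D 0) 0 0 ∧ HasValue 0 B.ℓ ((φ.D 0 t).D 1) 0 (θ t)) ∧
    (∀ v : V B.ℓ, ∀ᵐ t ∂vol 0 B.T,
      ∫ x in Ioo 0 B.ℓ, (B.ρ x * φtt t x * v.D 0 x - B.μ x * (φ.D 1 t).D 0 x * v.D 0 x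
        + B.r x * (φ.D 0 t).D 2 x * v.D 2 x - B.κ x * (φ.D 1 t).D 2 x * v.D 2 x) = 0) ∧
    HasValue 0 B.T (φ.D 0) B.T 0 ∧
    HasValue 0 B.T (fun t => (φ.D 1 t).comp 0) B.T 0

/-- `J` is Fréchet differentiable at `g` (in the Sobolev norm of order `m`), and its gradient is the
function `γ ∈ L²(0, T)`: the derivative is `h ↦ ∫₀ᵀ γ(t) h(t) dt`. -/
def HasGradient {m : ℕ} (J : SobolevLeft m 0 B.T → ℝ) (g : SobolevLeft m 0 B.T) (γ : ℝ → ℝ) : Prop :=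
  MemLp γ 2 (vol 0 B.T) ∧
  ∃ L : SobolevLeft m 0 B.T →L[ℝ] ℝ,
    (∀ h, L h = ∫ t in Ioo 0 B.T, γ t * h.D 0 t) ∧ HasFDerivAt J L g

end Beam

end KVBeam

end

/-! Two substitutions turn all the problems into one equation between square integrable functions.
In space, an element of `V` is determined by its second derivative, so `V` is replaced by `L²(0, ℓ)`
and its embedding into `L²` by the double integral `dbl`. In time, a function with zero data at one
end is determined by its derivative. The unknowns are therefore `p`, the second space derivative of
the velocity, and the acceleration `q`, tied by `ι p = prim d q`; the equation is `op d q p = R`.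
The flag `d` is the direction of time: `prim true` integrates from the initial time, `prim false` up
to the final time, and each is the adjoint of the other (`inner_prim_right`). Backward problems are
thus treated together with forward ones, the unknown being minus the velocity.

Pairing the equation with `p` gives the energy estimate (`energy_le`), hence uniqueness and
continuous dependence. Existence (`exists_solution`) is a Lions-type projection argument: the test
functions `w + λ prim d w` make the form coercive (`coercive`), and they are rich enough to recover
the equation (`eq_zero_of_inner_test`). It applies to loads that are `H¹` in time or take values in
`L²`.

Both gradients come from duality. For the tip deflection, `duality` exchanges the forward operator
with the backward one, and the load functional is the adjoint of the tip value. For the reaction at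
the clamped end, two integrations of the equation in space express the bending moment at `x = 0` as
`ℓ g` minus the moment of the inertial and damping forces (`lift_tot_bending`). This needs no trace
estimate, except that the traces of `u_xx` and `u_xxt` must exist separately; they do because `u_xx`
solves a linear ordinary differential equation in time with values in continuous functions of `x`
(`exists_trace`).

The adjoint with slope `θ` is written `φ = θ x + ψ` with `ψ` in `V`. Its very weak form says that
pairing the second derivative of `ψ` with `op true q p` is a prescribed functional, bounded by the
energy estimate once `θ` has one time derivative (`exists_transposed`). The same identity, tested
with the forward solution, is the gradient formula (`inner_outMoment`). If `θ` is compatible at `T`,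
a backward solution with an `L²` force satisfies the identity, so uniqueness identifies the two
solutions. -/

noncomputable section

set_option linter.unusedSectionVars false

namespace KVBeam

open scoped InnerProductSpace BoundedContinuousFunction

/-! ### Primitives of square integrable functions -/

section Primitive

variable {E : Type*} [NormedAddCommGroup E] [NormedSpace ℝ E]
variable {F : Type*} [NormedAddCommGroup F] [NormedSpace ℝ F]
variable {a b : ℝ}

instance vol_finite : IsFiniteMeasure (vol a b) := by unfold vol; infer_instance

theorem L2.integrable {E : Type*} [NormedAddCommGroup E] (f : L2 a b E) :
    Integrable f (vol a b) := (Lp.memLp f).integrable (by norm_num)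

/-- The primitive of `f : L²(a, b; E)` that vanishes at `a`. -/
def primFun (a b : ℝ) (f : ℝ → E) (t : ℝ) : E := ∫ s in Iic t, f s ∂vol a b

theorem primFun_congr {f g : ℝ → E} (h : f =ᵐ[vol a b] g) (t : ℝ) :
    primFun a b f t = primFun a b g t :=
  integral_congr_ae (ae_restrict_of_ae h)

theorem norm_primFun_le {f : ℝ → E} (hf : Integrable f (vol a b)) (t : ℝ) :
    ‖primFun a b f t‖ ≤ ∫ s, ‖f s‖ ∂vol a b :=
  (norm_integral_le_integral_norm _).trans
    (setIntegral_le_integral hf.norm (Filter.Eventually.of_forall fun _ => norm_nonneg _))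

theorem continuous_primFun {f : ℝ → E} (hf : Integrable f (vol a b)) :
    Continuous (primFun a b f) := by
  have h : primFun a b f = fun t => primFun a b f a + ∫ x in a..t, f x ∂vol a b := by
    funext t
    rw [← intervalIntegral.integral_Iic_sub_Iic hf.integrableOn hf.integrableOn]
    simp [primFun]
  rw [h]
  exact continuous_const.add (hf.continuous_primitive a)

theorem primFun_left (f : ℝ → E) : primFun a b f a = 0 := by
  rw [primFun, vol, Measure.restrict_restrict measurableSet_Iic]
  have : Iic a ∩ Ioo a b = ∅ := by ext x; simp +contextual
  simp [this]

theorem primFun_right (f : ℝ → E) : primFun a b f b = ∫ s, f s ∂vol a b := by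
  rw [primFun, vol, Measure.restrict_restrict measurableSet_Iic]
  congr 2
  ext x; simp +contextual [le_of_lt]

theorem norm_integral_le_norm (f : L2 a b E) :
    ∫ s, ‖f s‖ ∂vol a b ≤ (vol a b).real univ ^ (1 / 2 : ℝ) * ‖f‖ := by
  have h1 : eLpNorm f 1 (vol a b) ≤ eLpNorm f 2 (vol a b) *
      (vol a b) univ ^ (1 / (1 : ENNReal).toReal - 1 / (2 : ENNReal).toReal) :=
    eLpNorm_le_eLpNorm_mul_rpow_measure_univ (by norm_num) (Lp.aestronglyMeasurable f)
  have h2 := ENNReal.toReal_mono (ENNReal.mul_ne_top (Lp.eLpNorm_ne_top f)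
    (ENNReal.rpow_ne_top_of_nonneg (by norm_num) (measure_ne_top _ _))) h1
  rw [ENNReal.toReal_mul, ← ENNReal.toReal_rpow, ← Lp.norm_def] at h2
  rw [integral_norm_eq_lintegral_enorm (Lp.aestronglyMeasurable f),
    ← eLpNorm_one_eq_lintegral_enorm]
  refine h2.trans (le_of_eq ?_)
  rw [mul_comm, measureReal_def]
  norm_num

/-- The primitive that vanishes at `a`, as a bounded continuous function. -/
def primC : L2 a b E →L[ℝ] (ℝ →ᵇ E) :=
  LinearMap.mkContinuous
    { toFun := fun f => BoundedContinuousFunction.ofNormedAddCommGroup (primFun a b f)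
        (continuous_primFun f.integrable) _ (norm_primFun_le f.integrable)
      map_add' := fun f g => by
        ext t
        simp only [BoundedContinuousFunction.coe_ofNormedAddCommGroup,
          BoundedContinuousFunction.coe_add, Pi.add_apply]
        rw [primFun_congr (Lp.coeFn_add f g)]
        exact integral_add f.integrable.integrableOn g.integrable.integrableOn
      map_smul' := fun c f => by
        ext t
        simp only [BoundedContinuousFunction.coe_ofNormedAddCommGroup, RingHom.id_apply,
          BoundedContinuousFunction.coe_smul]
        rw [primFun_congr (Lp.coeFn_smul c f)]
        exact integral_smul c _ }
    ((vol a b).real univ ^ (1 / 2 : ℝ))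
    (fun f => by
      refine (BoundedContinuousFunction.norm_le (by positivity)).2 fun t => ?_
      exact (norm_primFun_le f.integrable t).trans (norm_integral_le_norm f))

@[simp] theorem primC_apply (f : L2 a b E) (t : ℝ) : primC f t = primFun a b f t := rfl

/-- The integral over `(a, b)`. -/
def tot : L2 a b E →L[ℝ] E :=
  (BoundedContinuousFunction.evalCLM ℝ b).comp primC

theorem tot_apply (f : L2 a b E) : tot f = ∫ s, f s ∂vol a b := primFun_right f

/-- Constant functions. -/
def cst : E →L[ℝ] L2 a b E := Lp.constL 2 (vol a b) ℝ

theorem coeFn_cst (c : E) : (cst c : L2 a b E) =ᵐ[vol a b] fun _ => c :=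
  Lp.coeFn_const (p := 2) (μ := vol a b) c

/-- The primitive that vanishes at `a` (for `true`), and the negative of the primitive that vanishes
at `b` (for `false`). -/
def prim (d : Bool) : L2 a b E →L[ℝ] L2 a b E :=
  bif d then (BoundedContinuousFunction.toLp 2 (vol a b) ℝ).comp primC
    else cst.comp tot - (BoundedContinuousFunction.toLp 2 (vol a b) ℝ).comp primC

theorem coeFn_prim_true (f : L2 a b E) : prim true f =ᵐ[vol a b] primFun a b f :=
  BoundedContinuousFunction.coeFn_toLp 2 (vol a b) ℝ (primC f)

theorem prim_false (f : L2 a b E) : prim false f = cst (tot f) - prim true f := rfl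

theorem coeFn_prim_false (f : L2 a b E) :
    prim false f =ᵐ[vol a b] fun t => tot f - primFun a b f t := by
  rw [prim_false]
  filter_upwards [Lp.coeFn_sub (cst (tot f)) (prim true f), coeFn_cst (a := a) (b := b) (tot f),
    coeFn_prim_true f] with t h1 h2 h3
  rw [h1, Pi.sub_apply, h2, h3]

/-- A bounded operator, applied pointwise. -/
def lift (S : E →L[ℝ] F) : L2 a b E →L[ℝ] L2 a b F := S.compLpL 2 (vol a b)

theorem coeFn_lift (S : E →L[ℝ] F) (f : L2 a b E) :
    lift S f =ᵐ[vol a b] fun t => S (f t) := S.coeFn_compLpL f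

theorem lift_comp {G : Type*} [NormedAddCommGroup G] [NormedSpace ℝ G] (S : F →L[ℝ] G)
    (R : E →L[ℝ] F) (f : L2 a b E) : lift S (lift R f) = lift (S.comp R) f := by
  ext1
  filter_upwards [coeFn_lift S (lift R f), coeFn_lift R f, coeFn_lift (S.comp R) f] with t h1 h2 h3
  rw [h1, h2, h3]; rfl

theorem lift_id (f : L2 a b E) : lift (ContinuousLinearMap.id ℝ E) f = f := by
  ext1
  filter_upwards [coeFn_lift (ContinuousLinearMap.id ℝ E) f] with t h1
  rw [h1]; rfl

theorem lift_smul (c : ℝ) (S : E →L[ℝ] F) (f : L2 a b E) : lift (c • S) f = c • lift S f := by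
  simp [lift, ContinuousLinearMap.smul_compLpL]

theorem norm_lift_le (S : E →L[ℝ] F) (f : L2 a b E) : ‖lift S f‖ ≤ ‖S‖ * ‖f‖ :=
  S.norm_compLp_le f

variable [CompleteSpace E] [CompleteSpace F]

theorem primFun_lift (S : E →L[ℝ] F) (f : L2 a b E) (t : ℝ) :
    primFun a b (lift S f) t = S (primFun a b f t) := by
  rw [primFun_congr (coeFn_lift S f)]
  exact S.integral_comp_comm f.integrable.integrableOn

theorem tot_lift (S : E →L[ℝ] F) (f : L2 a b E) : tot (lift S f) = S (tot f) :=
  primFun_lift S f b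

theorem lift_cst (S : E →L[ℝ] F) (c : E) : lift S (cst c) = (cst (S c) : L2 a b F) := by
  ext1
  filter_upwards [coeFn_lift S (cst c : L2 a b E), coeFn_cst (a := a) (b := b) c,
    coeFn_cst (a := a) (b := b) (S c)] with t h1 h2 h3
  rw [h1, h2, h3]

/-- Operators that do not depend on time pass through the time integral. All coefficients of the
beam are of this kind. -/
theorem prim_lift (d : Bool) (S : E →L[ℝ] F) (f : L2 a b E) :
    prim d (lift S f) = lift S (prim d f) := by
  have h : prim true (lift S f) = lift S (prim true f) := by
    ext1
    filter_upwards [coeFn_prim_true (lift S f), coeFn_lift S (prim true f), coeFn_prim_true f]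
      with t h1 h2 h3
    rw [h1, h2, h3, primFun_lift]
  cases d
  · rw [prim_false, prim_false, h, map_sub, tot_lift, lift_cst]
  · exact h

end Primitive

/-! ### Integration by parts in time. -/

section Hilbert

variable {E : Type*} [NormedAddCommGroup E] [InnerProductSpace ℝ E] [CompleteSpace E]
variable {F : Type*} [NormedAddCommGroup F] [InnerProductSpace ℝ F] [CompleteSpace F]
variable {a b : ℝ}

/-- Fubini on the square: the two terms on the left are the integrals of `⟪f s, g t⟫` over the two
triangles into which the diagonal cuts it. -/
theorem integral_inner_primFun {f g : ℝ → E} (hf : Integrable f (vol a b))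
    (hg : Integrable g (vol a b)) :
    ∫ t, ⟪f t, primFun a b g t⟫_ℝ ∂vol a b + ∫ t, ⟪primFun a b f t, g t⟫_ℝ ∂vol a b
      = ⟪∫ t, f t ∂vol a b, ∫ t, g t ∂vol a b⟫_ℝ := by
  set ν := vol a b
  have hF : Integrable (fun z : ℝ × ℝ => ⟪f z.1, g z.2⟫_ℝ) (ν.prod ν) :=
    hf.op_fst_snd (op := fun x y : E => ⟪x, y⟫_ℝ) (by fun_prop)
      ⟨1, fun x y => by simpa using norm_inner_le_norm (𝕜 := ℝ) x y⟩ hg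
  have hs : MeasurableSet {z : ℝ × ℝ | z.2 ≤ z.1} := measurableSet_le measurable_snd measurable_fst
  have e1 : ∫ t, ⟪f t, primFun a b g t⟫_ℝ ∂ν
      = ∫ z in {z : ℝ × ℝ | z.2 ≤ z.1}, ⟪f z.1, g z.2⟫_ℝ ∂(ν.prod ν) := by
    rw [← integral_indicator hs, integral_prod _ (hF.indicator hs)]
    refine integral_congr_ae (Filter.Eventually.of_forall fun t => ?_)
    beta_reduce
    rw [primFun, ← integral_indicator measurableSet_Iic, ← innerSL_apply_apply ℝ,
      ← (innerSL ℝ (f t)).integral_comp_comm (hg.indicator measurableSet_Iic)]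
    refine integral_congr_ae (Filter.Eventually.of_forall fun s => ?_)
    by_cases h : s ≤ t <;> simp [indicator, h]
  have e2 : ∫ t, ⟪primFun a b f t, g t⟫_ℝ ∂ν
      = ∫ z in {z : ℝ × ℝ | z.2 ≤ z.1}ᶜ, ⟪f z.1, g z.2⟫_ℝ ∂(ν.prod ν) := by
    rw [← integral_indicator hs.compl, integral_prod_symm _ (hF.indicator hs.compl)]
    refine integral_congr_ae (Filter.Eventually.of_forall fun t => ?_)
    beta_reduce
    -- The diagonal already belongs to the first triangle, so the strict inequality is needed here;
    -- Lebesgue measure has no atoms.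
    rw [primFun, integral_Iic_eq_integral_Iio, ← integral_indicator measurableSet_Iio,
      real_inner_comm, ← innerSL_apply_apply ℝ,
      ← (innerSL ℝ (g t)).integral_comp_comm (hf.indicator measurableSet_Iio)]
    refine integral_congr_ae (Filter.Eventually.of_forall fun s => ?_)
    by_cases h : s < t
    · simp [indicator, h, real_inner_comm]
    · simp [indicator, h]
  rw [e1, e2, integral_add_compl hs hF, integral_prod _ hF]
  have e3 : ∀ t, ∫ s, ⟪f t, g s⟫_ℝ ∂ν = ⟪f t, ∫ s, g s ∂ν⟫_ℝ := fun t =>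
    (innerSL ℝ (f t)).integral_comp_comm hg
  simp only [e3]
  simp_rw [real_inner_comm (∫ s, g s ∂ν)]
  exact (innerSL ℝ (∫ s, g s ∂ν)).integral_comp_comm hf

theorem inner_cst (c : E) (f : L2 a b E) : ⟪(cst c : L2 a b E), f⟫_ℝ = ⟪c, tot f⟫_ℝ := by
  rw [L2.inner_def, tot_apply, ← innerSL_apply_apply ℝ c,
    ← (innerSL ℝ c).integral_comp_comm f.integrable]
  refine integral_congr_ae ?_
  filter_upwards [coeFn_cst (a := a) (b := b) c] with t h
  rw [h]; rfl

theorem inner_prim_add (d : Bool) (f g : L2 a b E) :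
    ⟪f, prim d g⟫_ℝ + ⟪prim d f, g⟫_ℝ = ⟪tot f, tot g⟫_ℝ := by
  have h : ⟪f, prim true g⟫_ℝ + ⟪prim true f, g⟫_ℝ = ⟪tot f, tot g⟫_ℝ := by
    rw [L2.inner_def, L2.inner_def, tot_apply, tot_apply,
      ← integral_inner_primFun f.integrable g.integrable]
    congr 1
    · refine integral_congr_ae ?_
      filter_upwards [coeFn_prim_true g] with t h
      rw [h]
    · refine integral_congr_ae ?_
      filter_upwards [coeFn_prim_true f] with t h
      rw [h]
  cases d
  · rw [prim_false, prim_false, inner_sub_left, inner_sub_right, inner_cst,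
      real_inner_comm, inner_cst]
    rw [real_inner_comm] at h
    have := real_inner_comm (tot f) (tot g)
    have := real_inner_comm (prim true f) g
    have := real_inner_comm (prim true g) f
    linarith
  · exact h

/-- The boundary term of the integration by parts is exactly the constant by which the two
primitives differ. -/
theorem inner_prim_right (d : Bool) (f g : L2 a b E) :
    ⟪f, prim d g⟫_ℝ = ⟪prim (!d) f, g⟫_ℝ := by
  have h := inner_prim_add true f g
  have h' := inner_prim_add false f g
  cases d
  · simp only [Bool.not_false]
    rw [prim_false f, inner_sub_left, inner_cst] at h'
    linarith
  · simp only [Bool.not_true]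
    rw [prim_false f, inner_sub_left, inner_cst]
    linarith

theorem inner_lift_left (S : E →L[ℝ] F) (f : L2 a b E) (g : L2 a b F) :
    ⟪lift S f, g⟫_ℝ = ⟪f, lift (ContinuousLinearMap.adjoint S) g⟫_ℝ := by
  rw [L2.inner_def, L2.inner_def]
  refine integral_congr_ae ?_
  filter_upwards [coeFn_lift S f, coeFn_lift (ContinuousLinearMap.adjoint S) g] with t h1 h2
  rw [h1, h2, ContinuousLinearMap.adjoint_inner_right]

theorem inner_lift_right (S : E →L[ℝ] F) (f : L2 a b F) (g : L2 a b E) :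
    ⟪f, lift S g⟫_ℝ = ⟪lift (ContinuousLinearMap.adjoint S) f, g⟫_ℝ := by
  rw [real_inner_comm, inner_lift_left, real_inner_comm]

theorem inner_lift_symm {S : E →L[ℝ] E} (hS : ∀ x y, ⟪S x, y⟫_ℝ = ⟪x, S y⟫_ℝ) (f g : L2 a b E) :
    ⟪lift S f, g⟫_ℝ = ⟪f, lift S g⟫_ℝ := by
  rw [L2.inner_def, L2.inner_def]
  refine integral_congr_ae ?_
  filter_upwards [coeFn_lift S f, coeFn_lift S g] with t h1 h2
  rw [h1, h2, hS]

/-- The integrand is, up to sign, the derivative of half the quadratic form of `S` at `prim d f`.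
The result is positive in both directions of time because `prim false` carries the opposite sign of
a primitive. -/
theorem inner_lift_prim_self (d : Bool) {S : E →L[ℝ] E} (hS : ∀ x y, ⟪S x, y⟫_ℝ = ⟪x, S y⟫_ℝ)
    (f : L2 a b E) : ⟪lift S f, prim d f⟫_ℝ = 1 / 2 * ⟪S (tot f), tot f⟫_ℝ := by
  have h := inner_prim_add d (lift S f) f
  rw [prim_lift, inner_lift_symm hS (prim d f), real_inner_comm (lift S f) (prim d f),
    tot_lift] at h
  linarith

theorem inner_prim_self (d : Bool) (f : L2 a b E) :
    ⟪f, prim d f⟫_ℝ = 1 / 2 * ⟪tot f, tot f⟫_ℝ := by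
  have := inner_lift_prim_self d (S := ContinuousLinearMap.id ℝ E) (fun _ _ => rfl) f
  rwa [lift_id] at this

theorem inner_lift_self_ge {S : E →L[ℝ] E} {c : ℝ} (hS : ∀ x, c * ‖x‖ ^ 2 ≤ ⟪S x, x⟫_ℝ)
    (f : L2 a b E) : c * ‖f‖ ^ 2 ≤ ⟪lift S f, f⟫_ℝ := by
  rw [← real_inner_self_eq_norm_sq, L2.inner_def, L2.inner_def, ← integral_const_mul]
  refine integral_mono_ae ((L2.integrable_inner f f).const_mul c)
    (L2.integrable_inner (𝕜 := ℝ) (lift S f) f) ?_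
  filter_upwards [coeFn_lift S f] with t h
  rw [h]
  rw [real_inner_self_eq_norm_sq]
  exact hS _

theorem lift_injective {S : E →L[ℝ] F} (hS : Function.Injective S) {f : L2 a b E}
    (h : lift S f = 0) : f = 0 := by
  rw [Lp.eq_zero_iff_ae_eq_zero] at h ⊢
  filter_upwards [h, coeFn_lift S f] with t h1 h2
  rw [h1] at h2
  exact hS (by simpa using h2.symm)

end Hilbert

/-! ### Weak derivatives and primitives -/

theorem IsTest.deriv {a b : ℝ} {η : ℝ → ℝ} (h : IsTest a b η) : IsTest a b (deriv η) :=
  ⟨(contDiff_infty_iff_deriv.1 h.1).2, h.2.1.deriv, (tsupport_deriv_subset).trans h.2.2⟩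

theorem IsTest.eq_zero {a b : ℝ} {η : ℝ → ℝ} (h : IsTest a b η) {t : ℝ} (ht : t ∉ Ioo a b) :
    η t = 0 := image_eq_zero_of_notMem_tsupport fun h' => ht (h.2.2 h')

theorem IsTest.integrable {a b : ℝ} {η : ℝ → ℝ} (h : IsTest a b η) : Integrable η (vol a b) :=
  (h.1.continuous.integrable_of_hasCompactSupport h.2.1).integrableOn

theorem IsTest.primFun_deriv {a b : ℝ} {η : ℝ → ℝ} (h : IsTest a b η) {t : ℝ} (ht : t ∈ Icc a b) :
    primFun a b (_root_.deriv η) t = η t := by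
  rw [primFun, vol, Measure.restrict_restrict measurableSet_Iic]
  have e : (Iic t ∩ Ioo a b : Set ℝ) =ᵐ[volume] (Ioc a t : Set ℝ) := by
    rcases eq_or_lt_of_le ht.2 with rfl | h'
    · have : Iic t ∩ Ioo a t = Ioo a t := by ext x; simp +contextual [le_of_lt]
      rw [this]; exact Ioo_ae_eq_Ioc
    · have : Iic t ∩ Ioo a b = Ioc a t := by
        ext x
        simp only [mem_inter_iff, mem_Iic, mem_Ioo, mem_Ioc]
        exact ⟨fun h => ⟨h.2.1, h.1⟩, fun h => ⟨h.2, h.1, h.2.trans_lt h'⟩⟩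
      exact Filter.EventuallyEq.of_eq this
  rw [setIntegral_congr_set e, ← intervalIntegral.integral_of_le ht.1,
    intervalIntegral.integral_eq_sub_of_hasDerivAt
      (fun x _ => (h.1.differentiable (by norm_num) x).hasDerivAt)
      (h.deriv.1.continuous.intervalIntegrable _ _),
    h.eq_zero (t := a) (by simp), sub_zero]

/-- A test function with vanishing integral is the derivative of a test function. -/
theorem IsTest.exists_deriv_eq {a b : ℝ} (hab : a < b) {ζ : ℝ → ℝ} (h : IsTest a b ζ)
    (h0 : ∫ t, ζ t = 0) : ∃ η, IsTest a b η ∧ _root_.deriv η = ζ := by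
  obtain ⟨α, β, hα, hαβ, hβ, hK⟩ : ∃ α β, a < α ∧ α ≤ β ∧ β < b ∧ tsupport ζ ⊆ Icc α β := by
    rcases (tsupport ζ).eq_empty_or_nonempty with he | hne
    · exact ⟨(a + b) / 2, (a + b) / 2, by linarith, le_rfl, by linarith, by simp [he]⟩
    · obtain ⟨α, hα⟩ := h.2.1.isCompact.exists_isLeast hne
      obtain ⟨β, hβ⟩ := h.2.1.isCompact.exists_isGreatest hne
      exact ⟨α, β, (h.2.2 hα.1).1, hα.2 hβ.1, (h.2.2 hβ.1).2, fun x hx => ⟨hα.2 hx, hβ.2 hx⟩⟩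
  have hz : ∀ x, x ∉ Icc α β → ζ x = 0 := fun x hx =>
    image_eq_zero_of_notMem_tsupport fun h' => hx (hK h')
  have hc := h.1.continuous
  set η : ℝ → ℝ := fun t => ∫ s in a..t, ζ s
  have hd : ∀ t, HasDerivAt η (ζ t) t := fun t =>
    intervalIntegral.integral_hasDerivAt_right (hc.intervalIntegrable _ _)
      (hc.stronglyMeasurableAtFilter _ _) hc.continuousAt
  have hderiv : _root_.deriv η = ζ := funext fun t => (hd t).deriv
  have hsupp : Function.support η ⊆ Icc α β := by
    intro t ht
    by_contra hn
    apply ht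
    rcases not_and_or.1 hn with hlt | hgt
    · refine intervalIntegral.integral_zero_ae (Filter.Eventually.of_forall fun s hs => hz s ?_)
      intro hs'
      rcases le_total a t with hat | hat
      · rw [uIoc_of_le hat] at hs; exact hlt (hs'.1.trans hs.2)
      · rw [uIoc_of_ge hat] at hs; linarith [hs'.1, hs.2]
    · have hsub : Function.support ζ ⊆ Ioc a t := fun x hx => by
        have := hK (subset_tsupport _ hx)
        exact ⟨hα.trans_le this.1, this.2.trans (not_le.1 hgt).le⟩
      have := intervalIntegral.integral_eq_integral_of_support_subset (μ := volume) hsub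
      change ∫ s in a..t, ζ s = 0
      rw [this, h0]
  have hts : tsupport η ⊆ Icc α β := closure_minimal hsupp isClosed_Icc
  refine ⟨η, ⟨contDiff_infty_iff_deriv.2 ⟨fun t => (hd t).differentiableAt, ?_⟩, ?_, ?_⟩, hderiv⟩
  · rw [hderiv]; exact h.1
  · exact HasCompactSupport.of_support_subset_isCompact isCompact_Icc hsupp
  · exact hts.trans (Icc_subset_Ioo hα hβ)

theorem exists_isTest_integral_eq_one {a b : ℝ} (hab : a < b) :
    ∃ ζ, IsTest a b ζ ∧ ∫ t, ζ t = 1 := by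
  let f : ContDiffBump ((a + b) / 2) :=
    ⟨(b - a) / 8, (b - a) / 4, by linarith, by linarith⟩
  refine ⟨f.normed volume, ⟨f.contDiff_normed, f.hasCompactSupport_normed, ?_⟩, f.integral_normed⟩
  rw [f.tsupport_normed_eq, Real.closedBall_eq_Icc]
  exact Icc_subset_Ioo (by dsimp [f]; linarith) (by dsimp [f]; linarith)

section

variable {E : Type*} [NormedAddCommGroup E] [InnerProductSpace ℝ E] [CompleteSpace E]
variable {a b : ℝ}

theorem HasWeakDeriv.congr {f f' g g' : ℝ → E} (h : HasWeakDeriv a b f f')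
    (hf : f =ᵐ[vol a b] g) (hf' : f' =ᵐ[vol a b] g') : HasWeakDeriv a b g g' := by
  intro η hη
  have e1 : ∫ t in Ioo a b, _root_.deriv η t • g t = ∫ t in Ioo a b, _root_.deriv η t • f t :=
    integral_congr_ae (hf.mono fun t ht => by beta_reduce; rw [ht])
  have e2 : ∫ t in Ioo a b, η t • g' t = ∫ t in Ioo a b, η t • f' t :=
    integral_congr_ae (hf'.mono fun t ht => by beta_reduce; rw [ht])
  rw [e1, e2, h η hη]

theorem HasValue.congr {f g : ℝ → E} {x : ℝ} {c : E} (h : HasValue a b f x c)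
    (hf : f =ᵐ[vol a b] g) : HasValue a b g x c := by
  obtain ⟨F, h1, h2, h3⟩ := h
  exact ⟨F, h1, h2.trans hf, h3⟩

/-- Paired with a fixed vector `e`, the claim is integration by parts for `η' e` and `f`: a test
function is the primitive of its derivative and vanishes at both ends. -/
theorem hasWeakDeriv_cst_add_prim (c : E) (f : L2 a b E) :
    HasWeakDeriv a b ((cst c + prim true f : L2 a b E) : ℝ → E) f := by
  intro η hη
  have hm : ∀ t ∈ Ioo a b, t ∈ Icc a b := fun t ht => Ioo_subset_Icc_self ht
  rw [eq_neg_iff_add_eq_zero]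
  have i1 := hη.integrable_deriv_smul (cst c + prim true f)
  have i2 := hη.integrable_smul f
  refine ext_inner_left ℝ fun e => ?_
  rw [inner_zero_right, inner_add_right, ← innerSL_apply_apply ℝ, ← innerSL_apply_apply ℝ e,
    ← (innerSL ℝ e).integral_comp_comm i1, ← (innerSL ℝ e).integral_comp_comm i2]
  have hi : Integrable (fun t => _root_.deriv η t • e) (vol a b) := hη.deriv.integrable.smul_const e
  have key := integral_inner_primFun hi f.integrable
  have hp : ∀ t ∈ Icc a b, primFun a b (fun t => _root_.deriv η t • e) t = η t • e := by
    intro t ht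
    rw [← hη.primFun_deriv ht, primFun, primFun, integral_smul_const]
  rcases lt_or_ge a b with hab | hab
  swap
  · simp [vol, Ioo_eq_empty (not_lt.2 hab)]
  have h0 : ∫ t, _root_.deriv η t • e ∂vol a b = 0 := by
    rw [← primFun_right, hp b (right_mem_Icc.2 hab.le), hη.eq_zero (by simp), zero_smul]
  rw [h0, inner_zero_left] at key
  have e1 : ∫ t, (innerSL ℝ e) (_root_.deriv η t • (cst c + prim true f : L2 a b E) t) ∂vol a b
      = ∫ t, ⟪_root_.deriv η t • e, primFun a b f t⟫_ℝ ∂vol a b := by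
    have : ∫ t, ⟪_root_.deriv η t • e, primFun a b f t⟫_ℝ ∂vol a b
      = ∫ t, ⟪_root_.deriv η t • e, c⟫_ℝ ∂vol a b
        + ∫ t, ⟪_root_.deriv η t • e, primFun a b f t⟫_ℝ ∂vol a b := by
      have : ∫ t, ⟪_root_.deriv η t • e, c⟫_ℝ ∂vol a b = 0 := by
        simp_rw [real_inner_comm c]
        have := (innerSL ℝ c).integral_comp_comm hi
        simp only [innerSL_apply_apply] at this
        rw [this, h0, inner_zero_right]
      rw [this, zero_add]
    rw [this, ← integral_add]
    · refine integral_congr_ae ?_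
      filter_upwards [Lp.coeFn_add (cst c) (prim true f), coeFn_cst (a := a) (b := b) c,
        coeFn_prim_true f] with t h1 h2 h3
      rw [h1, Pi.add_apply, h2, h3]
      simp only [innerSL_apply_apply, inner_smul_left, inner_smul_right, inner_add_right]
      simp; ring
    · simp_rw [real_inner_comm c]
      exact (innerSL ℝ c).integrable_comp hi
    · have := (innerSL ℝ e).integrable_comp (hη.integrable_deriv_smul (prim true f))
      refine this.congr ?_
      filter_upwards [coeFn_prim_true f] with t h3
      rw [h3]
      simp [inner_smul_left]
  have e2 : ∫ t, (innerSL ℝ e) (η t • f t) ∂vol a b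
      = ∫ t, ⟪primFun a b (fun t => _root_.deriv η t • e) t, f t⟫_ℝ ∂vol a b := by
    refine setIntegral_congr_fun measurableSet_Ioo fun t ht => ?_
    rw [hp t (hm t ht)]
    simp [inner_smul_left]
  rw [e1, e2]
  exact key

/-- The du Bois-Reymond lemma. Subtracting from a test function the multiple of a fixed bump `ζ`
with the same integral leaves the derivative of a test function, so `h` acts on test functions like
the constant `∫ ζ h`. -/
theorem exists_eq_cst_of_weakDeriv_zero (hab : a < b) {h : L2 a b E}
    (hh : ∀ η, IsTest a b η → ∫ t in Ioo a b, _root_.deriv η t • h t = 0) :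
    ∃ c : E, h = cst c := by
  obtain ⟨ζ, hζ, hζ1⟩ := exists_isTest_integral_eq_one hab
  have hint : ∀ g, IsTest a b g → ∫ t in Ioo a b, g t = ∫ t, g t := fun g hg =>
    setIntegral_eq_integral_of_forall_compl_eq_zero fun t ht => hg.eq_zero ht
  set c := ∫ t in Ioo a b, ζ t • h t
  refine ⟨c, ?_⟩
  ext1
  have key : ∀ᵐ t, t ∈ Ioo a b → h t - c = 0 := by
    refine isOpen_Ioo.ae_eq_zero_of_integral_contDiff_smul_eq_zero ?_ ?_
    · exact IntegrableOn.locallyIntegrableOn (h.integrable.sub (integrable_const c))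
    · intro g hg1 hg2 hg3
      have hg : IsTest a b g := ⟨hg1, hg2, hg3⟩
      set m := ∫ t, g t
      have hk : IsTest a b (fun t => g t - m * ζ t) := by
        refine ⟨hg.1.sub (contDiff_const.mul hζ.1), hg.2.1.sub hζ.2.1.mul_left, ?_⟩
        refine (tsupport_sub g (fun t => m * ζ t)).trans (union_subset hg.2.2 ?_)
        exact (tsupport_mul_subset_right).trans hζ.2.2
      obtain ⟨η, hη, hηk⟩ := hk.exists_deriv_eq hab (by
        rw [integral_sub (hg.1.continuous.integrable_of_hasCompactSupport hg.2.1)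
          ((hζ.1.continuous.integrable_of_hasCompactSupport hζ.2.1).const_mul m),
          integral_const_mul, hζ1]
        simp [m])
      have h0 := hh η hη
      rw [hηk] at h0
      have e1 : ∫ t in Ioo a b, (g t - m * ζ t) • h t
          = (∫ t in Ioo a b, g t • h t) - m • c := by
        simp only [c]
        rw [← integral_smul, ← integral_sub (hg.integrable_smul h)
          ((hζ.integrable_smul h).fun_smul m)]
        simp only [sub_smul, mul_smul]
      rw [e1] at h0
      have e2 : ∫ t, g t • (h t - c) = ∫ t in Ioo a b, g t • (h t - c) :=
        (setIntegral_eq_integral_of_forall_compl_eq_zero fun t ht => by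
          rw [hg.eq_zero ht, zero_smul]).symm
      rw [e2]
      simp only [smul_sub]
      rw [integral_sub (hg.integrable_smul h) (hg.integrable.smul_const c),
        integral_smul_const, hint g hg]
      exact h0
  filter_upwards [coeFn_cst (a := a) (b := b) c, (ae_restrict_iff' measurableSet_Ioo).2 key]
    with t h1 h2
  rw [h1]
  exact sub_eq_zero.1 h2

/-- The bridge from weak derivatives to the operators `cst` and `prim`, in which everything below is
computed. -/
theorem hasWeakDeriv_iff (hab : a < b) {f f' : L2 a b E} :
    HasWeakDeriv a b f f' ↔ ∃ c, f = cst c + prim true f' := by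
  constructor
  · intro h
    obtain ⟨c, hc⟩ := exists_eq_cst_of_weakDeriv_zero hab (h := f - prim true f') (by
      intro η hη
      have h1 := h η hη
      have h2 := hasWeakDeriv_cst_add_prim 0 f' η hη
      rw [map_zero, zero_add] at h2
      have : ∫ t in Ioo a b, _root_.deriv η t • (f - prim true f' : L2 a b E) t
          = (∫ t in Ioo a b, _root_.deriv η t • f t)
            - ∫ t in Ioo a b, _root_.deriv η t • (prim true f' : L2 a b E) t := by
        rw [← integral_sub (hη.integrable_deriv_smul f) (hη.integrable_deriv_smul _)]
        refine integral_congr_ae ?_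
        filter_upwards [Lp.coeFn_sub f (prim true f')] with t ht
        rw [ht, Pi.sub_apply, smul_sub]
      rw [this, h1, h2, sub_self])
    exact ⟨c, by rw [← hc]; abel⟩
  · rintro ⟨c, rfl⟩
    exact hasWeakDeriv_cst_add_prim c f'

/-- A function is the weak derivative of its primitive, and the weak derivative of `0` is `0`. -/
theorem prim_true_injective :
    Function.Injective (prim true : L2 a b E →L[ℝ] L2 a b E) := by
  rw [injective_iff_map_eq_zero]
  intro f hf
  have h := hasWeakDeriv_cst_add_prim 0 f
  rw [hf, map_zero, zero_add] at h
  rw [Lp.eq_zero_iff_ae_eq_zero]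
  have key : ∀ᵐ t, t ∈ Ioo a b → f t = 0 := by
    refine isOpen_Ioo.ae_eq_zero_of_integral_contDiff_smul_eq_zero
      (IntegrableOn.locallyIntegrableOn f.integrable) ?_
    intro g hg1 hg2 hg3
    have hg : IsTest a b g := ⟨hg1, hg2, hg3⟩
    have h0 := h g hg
    rw [← setIntegral_eq_integral_of_forall_compl_eq_zero (s := Ioo a b) fun t ht => by
      rw [hg.eq_zero ht, zero_smul]]
    rw [← neg_eq_zero, ← h0]
    refine integral_eq_zero_of_ae ?_
    filter_upwards [Lp.coeFn_zero E 2 (vol a b)] with t ht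
    rw [ht]; simp
  exact (ae_restrict_iff' measurableSet_Ioo).2 key

theorem coeFn_cst_add_prim (c : E) (f : L2 a b E) :
    (cst c + prim true f : L2 a b E) =ᵐ[vol a b] fun t => c + primFun a b f t := by
  filter_upwards [Lp.coeFn_add (cst c) (prim true f), coeFn_cst (a := a) (b := b) c,
    coeFn_prim_true f] with t h1 h2 h3
  rw [h1, Pi.add_apply, h2, h3]

theorem hasValue_cst_add_prim (c : E) (f : L2 a b E) (x : ℝ) :
    HasValue a b ((cst c + prim true f : L2 a b E) : ℝ → E) x (c + primFun a b f x) :=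
  ⟨fun t => c + primFun a b f t,
    (continuous_const.add (continuous_primFun f.integrable)).continuousOn,
    (coeFn_cst_add_prim c f).symm, rfl⟩

theorem hasValue_left_cst_add_prim (c : E) (f : L2 a b E) :
    HasValue a b ((cst c + prim true f : L2 a b E) : ℝ → E) a c := by
  simpa [primFun_left] using hasValue_cst_add_prim c f a

theorem cst_sub_prim_false (c : E) (f : L2 a b E) :
    cst c - prim false f = cst (c - tot f) + prim true f := by
  rw [prim_false, map_sub]; abel

theorem hasValue_right_cst_sub_prim (c : E) (f : L2 a b E) :
    HasValue a b ((cst c - prim false f : L2 a b E) : ℝ → E) b c := by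
  rw [cst_sub_prim_false]
  have h := hasValue_cst_add_prim (c - tot f) f b
  rwa [primFun_right, ← tot_apply, sub_add_cancel] at h

/-- The value at the end point fixes the constant of integration, so an initial condition and a weak
derivative together become one identity in `L²`. -/
theorem hasWeakDeriv_and_hasValue_left_iff (hab : a < b) {f f' : L2 a b E} {c : E} :
    HasWeakDeriv a b f f' ∧ HasValue a b f a c ↔ f = cst c + prim true f' := by
  constructor
  · rintro ⟨h1, h2⟩
    obtain ⟨d, rfl⟩ := (hasWeakDeriv_iff hab).1 h1
    rw [HasValue.unique hab (left_mem_Icc.2 hab.le) h2 (hasValue_left_cst_add_prim d f')]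
  · rintro rfl
    exact ⟨hasWeakDeriv_cst_add_prim c f', hasValue_left_cst_add_prim c f'⟩

theorem hasWeakDeriv_and_hasValue_right_iff (hab : a < b) {f f' : L2 a b E} {c : E} :
    HasWeakDeriv a b f f' ∧ HasValue a b f b c ↔ f = cst c - prim false f' := by
  constructor
  · rintro ⟨h1, h2⟩
    obtain ⟨d, rfl⟩ := (hasWeakDeriv_iff hab).1 h1
    have h3 := hasValue_cst_add_prim d f' b
    rw [primFun_right, ← tot_apply] at h3
    rw [HasValue.unique hab (right_mem_Icc.2 hab.le) h2 h3, cst_sub_prim_false, add_sub_cancel_right]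
  · rintro rfl
    exact ⟨by rw [cst_sub_prim_false]; exact hasWeakDeriv_cst_add_prim _ f',
      hasValue_right_cst_sub_prim c f'⟩

end

/-! ### Strongly damped evolution equations of second order -/

/-- A linear functional that is bounded in terms of a linear map into a Hilbert space is represented
by an element of the Hilbert space. -/
theorem exists_inner_eq_of_abs_le {E W : Type*} [NormedAddCommGroup E] [InnerProductSpace ℝ E]
    [CompleteSpace E] [AddCommGroup W] [Module ℝ W] (B : W →ₗ[ℝ] E) (L : W →ₗ[ℝ] ℝ) (C : ℝ)
    (h : ∀ w, |L w| ≤ C * ‖B w‖) : ∃ p : E, ∀ w, ⟪p, B w⟫_ℝ = L w := by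
  have hker : LinearMap.ker B ≤ LinearMap.ker L := fun w hw => by
    have := h w
    rw [LinearMap.mem_ker.1 hw, norm_zero, mul_zero] at this
    exact abs_nonpos_iff.1 this
  let f₀ : LinearMap.range B →ₗ[ℝ] ℝ :=
    ((LinearMap.ker B).liftQ L hker).comp B.quotKerEquivRange.symm.toLinearMap
  have hf₀ : ∀ w, f₀ ⟨B w, LinearMap.mem_range_self B w⟩ = L w := fun w => by
    have : B.quotKerEquivRange.symm ⟨B w, LinearMap.mem_range_self B w⟩
        = (LinearMap.ker B).mkQ w := by
      rw [LinearEquiv.symm_apply_eq]; rfl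
    simp only [f₀, LinearMap.comp_apply, LinearEquiv.coe_coe, this]
    simp
  let f : StrongDual ℝ (LinearMap.range B) := f₀.mkContinuous C fun x => by
    obtain ⟨_, w, rfl⟩ := x
    rw [hf₀]; exact h w
  obtain ⟨g, hg, -⟩ := exists_extension_norm_eq (LinearMap.range B) f
  refine ⟨(InnerProductSpace.toDual ℝ E).symm g, fun w => ?_⟩
  rw [InnerProductSpace.toDual_symm_apply]
  exact (hg ⟨B w, LinearMap.mem_range_self B w⟩).trans (hf₀ w)

theorem exists_apply_eq_of_abs_le {E W : Type*} [NormedAddCommGroup E] [InnerProductSpace ℝ E]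
    [CompleteSpace E] [AddCommGroup W] [Module ℝ W] (B : W →ₗ[ℝ] StrongDual ℝ E) (L : W →ₗ[ℝ] ℝ)
    (C : ℝ) (h : ∀ w, |L w| ≤ C * ‖B w‖) : ∃ p : E, ∀ w, B w p = L w := by
  obtain ⟨p, hp⟩ := exists_inner_eq_of_abs_le
    ((InnerProductSpace.toDual ℝ E).symm.toLinearEquiv.toLinearMap.comp B) L C
    (fun w => by simpa using h w)
  refine ⟨p, fun w => ?_⟩
  rw [← hp w, real_inner_comm]
  simp

/-- The data of the equation `ρ u'' + μ u' + r u + κ u' = f` for functions of time with values in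
`V`, where `V` is embedded into `H` by `ι`, the operators `ρ, μ` act in `H`, and `r, κ` in `V`. -/
structure Evolution (V H : Type*) [NormedAddCommGroup V] [InnerProductSpace ℝ V]
    [NormedAddCommGroup H] [InnerProductSpace ℝ H] where
  ι : V →L[ℝ] H
  ρ : H →L[ℝ] H
  μ : H →L[ℝ] H
  r : V →L[ℝ] V
  κ : V →L[ℝ] V
  ρ₀ : ℝ
  κ₀ : ℝ
  ι_injective : Function.Injective ι
  ρ_symm : ∀ x y, ⟪ρ x, y⟫_ℝ = ⟪x, ρ y⟫_ℝ
  μ_symm : ∀ x y, ⟪μ x, y⟫_ℝ = ⟪x, μ y⟫_ℝ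
  r_symm : ∀ x y, ⟪r x, y⟫_ℝ = ⟪x, r y⟫_ℝ
  κ_symm : ∀ x y, ⟪κ x, y⟫_ℝ = ⟪x, κ y⟫_ℝ
  ρ₀_pos : 0 < ρ₀
  κ₀_pos : 0 < κ₀
  ρ_ge : ∀ x, ρ₀ * ‖x‖ ^ 2 ≤ ⟪ρ x, x⟫_ℝ
  μ_nonneg : ∀ x, 0 ≤ ⟪μ x, x⟫_ℝ
  r_nonneg : ∀ x, 0 ≤ ⟪r x, x⟫_ℝ
  κ_ge : ∀ x, κ₀ * ‖x‖ ^ 2 ≤ ⟪κ x, x⟫_ℝ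

namespace Evolution

variable {V H : Type*} [NormedAddCommGroup V] [InnerProductSpace ℝ V] [CompleteSpace V]
  [NormedAddCommGroup H] [InnerProductSpace ℝ H] [CompleteSpace H] {a b : ℝ}
variable (D : Evolution V H)

/-- The adjoint of the embedding `V → H`. -/
def ιadj : H →L[ℝ] V := ContinuousLinearMap.adjoint D.ι

/-- The operator `ρ` as an operator from `H` to the dual of `V`. -/
def mass : H →L[ℝ] V := D.ιadj.comp D.ρ

/-- The operator `μ` as an operator from `V` to the dual of `V`. -/
def damp : V →L[ℝ] V := D.ιadj.comp (D.μ.comp D.ι)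

/-- The left hand side of the equation, in terms of `q = u''` and `p = u'`, forwards in time for
`d = true` and backwards for `d = false`. -/
def op (d : Bool) (q : L2 a b H) (p : L2 a b V) : L2 a b V :=
  lift D.mass q + lift D.damp p + lift D.r (prim d p) + lift D.κ p

theorem inner_ιadj (f : L2 a b H) (w : L2 a b V) :
    ⟪lift D.ιadj f, w⟫_ℝ = ⟪f, lift D.ι w⟫_ℝ := (inner_lift_right D.ι f w).symm

theorem inner_mass (q : L2 a b H) (w : L2 a b V) :
    ⟪lift D.mass q, w⟫_ℝ = ⟪lift D.ρ q, lift D.ι w⟫_ℝ := by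
  rw [mass, ← lift_comp, inner_ιadj]

theorem damp_symm (x y : V) : ⟪D.damp x, y⟫_ℝ = ⟪x, D.damp y⟫_ℝ := by
  simp only [damp, ιadj, ContinuousLinearMap.comp_apply, ContinuousLinearMap.adjoint_inner_left,
    ContinuousLinearMap.adjoint_inner_right, D.μ_symm]

theorem damp_nonneg (x : V) : 0 ≤ ⟪D.damp x, x⟫_ℝ := by
  simp only [damp, ιadj, ContinuousLinearMap.comp_apply, ContinuousLinearMap.adjoint_inner_left]
  exact D.μ_nonneg _

theorem ρ_nonneg (x : H) : 0 ≤ ⟪D.ρ x, x⟫_ℝ :=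
  (by have := D.ρ₀_pos; positivity : 0 ≤ D.ρ₀ * ‖x‖ ^ 2).trans (D.ρ_ge x)

theorem inner_lift_self_nonneg {E : Type*} [NormedAddCommGroup E] [InnerProductSpace ℝ E]
    [CompleteSpace E] {S : E →L[ℝ] E} (hS : ∀ x, 0 ≤ ⟪S x, x⟫_ℝ) (f : L2 a b E) :
    0 ≤ ⟪lift S f, f⟫_ℝ := by
  simpa using inner_lift_self_ge (c := 0) (by simpa using hS) f

/-- The energy identity obtained by testing with the velocity. By `inner_lift_prim_self` the
inertial and elastic terms are half the quadratic forms of `ρ` and `r` at `tot q` and `tot p`; the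
latter and the external damping are nonnegative and dropped. -/
theorem energy_le (d : Bool) {q : L2 a b H} {p : L2 a b V} (h : lift D.ι p = prim d q) :
    D.κ₀ * ‖p‖ ^ 2 + 1 / 2 * ⟪D.ρ (tot q), tot q⟫_ℝ ≤ ⟪D.op d q p, p⟫_ℝ := by
  have h1 := inner_lift_self_nonneg D.damp_nonneg p
  have h2 := inner_lift_self_ge D.κ_ge p
  have h3 := inner_lift_prim_self d D.r_symm p
  have h4 := inner_lift_prim_self d D.ρ_symm q
  have h5 := D.r_nonneg (tot p)
  rw [inner_lift_symm D.r_symm, real_inner_comm] at h3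
  rw [op, inner_add_left, inner_add_left, inner_add_left, inner_mass, h, h4]
  have h6 : ⟪lift D.r (prim d p), p⟫_ℝ = 1 / 2 * ⟪D.r (tot p), tot p⟫_ℝ := h3
  rw [h6]
  linarith

theorem norm_le_of_op (d : Bool) {q : L2 a b H} {p : L2 a b V} (h : lift D.ι p = prim d q) :
    D.κ₀ * ‖p‖ ≤ ‖D.op d q p‖ := by
  have h1 := D.energy_le d h
  have h2 := D.ρ_nonneg (tot q)
  have h3 := real_inner_le_norm (D.op d q p) p
  rcases eq_or_lt_of_le (norm_nonneg p) with h0 | h0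
  · rw [← h0, mul_zero]; exact norm_nonneg _
  · refine le_of_mul_le_mul_right ?_ h0
    nlinarith

/-- Green's formula in time. No boundary terms appear, since one solution starts from rest and the
other ends at rest; the mass terms on both sides reduce to `⟪ρ ι p, ι p'⟫`. -/
theorem duality (d : Bool) {q q' : L2 a b H} {p p' : L2 a b V} (h : lift D.ι p = prim d q)
    (h' : lift D.ι p' = prim (!d) q') :
    ⟪D.op d q p, prim (!d) p'⟫_ℝ = ⟪prim d p, D.op (!d) q' p'⟫_ℝ := by
  have hd : ∀ S : V →L[ℝ] V, (∀ x y, ⟪S x, y⟫_ℝ = ⟪x, S y⟫_ℝ) →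
      ⟪lift S p, prim (!d) p'⟫_ℝ = ⟪prim d p, lift S p'⟫_ℝ := fun S hS => by
    rw [inner_prim_right, Bool.not_not, prim_lift, inner_lift_symm hS]
  have h1 : ⟪lift D.mass q, prim (!d) p'⟫_ℝ = ⟪lift D.ρ (lift D.ι p), lift D.ι p'⟫_ℝ := by
    rw [inner_mass, ← prim_lift, inner_prim_right, Bool.not_not, prim_lift, ← h]
  have h2 : ⟪prim d p, lift D.mass q'⟫_ℝ = ⟪lift D.ρ (lift D.ι p), lift D.ι p'⟫_ℝ := by
    rw [real_inner_comm, inner_mass, ← prim_lift, inner_prim_right, prim_lift, ← h',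
      real_inner_comm, inner_lift_symm D.ρ_symm]
  simp only [op, inner_add_left, inner_add_right]
  rw [h1, h2, hd _ D.damp_symm, hd _ D.κ_symm, inner_lift_symm D.r_symm]

/-- The weight of `u'` in the test function `u'' + λ u'`. -/
def weight : ℝ := 2 * ‖D.r‖ / D.κ₀ + 1

theorem weight_pos : 0 < D.weight := by
  have := D.κ₀_pos
  unfold weight; positivity

theorem weight_mul : 2 * ‖D.r‖ ≤ D.weight * D.κ₀ := by
  have h := D.κ₀_pos
  have : D.weight * D.κ₀ = 2 * ‖D.r‖ + D.κ₀ := by unfold weight; field_simp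
  linarith

theorem r_le (x : V) : ⟪D.r x, x⟫_ℝ ≤ ‖D.r‖ * ‖x‖ ^ 2 := by
  refine (real_inner_le_norm _ _).trans ?_
  have := mul_le_mul_of_nonneg_right (D.r.le_opNorm x) (norm_nonneg x)
  linarith

/-- Here `u'' = w` and `u' = prim d w`. The test with `w` controls `ι w` and `tot w`, but its
elastic term contributes `-⟪r u', u'⟫`, which is absorbed by `λ` times the Kelvin-Voigt term. This
is what determines the size of `weight`. -/
theorem coercive (d : Bool) (w : L2 a b V) :
    D.ρ₀ * ‖lift D.ι w‖ ^ 2 + D.κ₀ / 4 * ‖tot w‖ ^ 2 +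
        D.weight * D.κ₀ / 2 * ‖prim d w‖ ^ 2
      ≤ ⟪D.op d (lift D.ι w) (prim d w), w + D.weight • prim d w⟫_ℝ := by
  set l := D.weight
  have hl : 0 < l := D.weight_pos
  set p := prim d w
  have c1 : D.ρ₀ * ‖lift D.ι w‖ ^ 2 ≤ ⟪lift D.mass (lift D.ι w), w⟫_ℝ := by
    rw [inner_mass]; exact inner_lift_self_ge D.ρ_ge _
  have c2 : 0 ≤ ⟪lift D.mass (lift D.ι w), p⟫_ℝ := by
    rw [inner_mass, ← prim_lift, inner_lift_prim_self d D.ρ_symm]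
    have := D.ρ_nonneg (tot (lift D.ι w)); positivity
  have hself : ∀ S : V →L[ℝ] V, (∀ x y, ⟪S x, y⟫_ℝ = ⟪x, S y⟫_ℝ) → ∀ f : L2 a b V,
      ⟪lift S (prim d f), f⟫_ℝ = 1 / 2 * ⟪S (tot f), tot f⟫_ℝ := fun S hS f => by
    rw [inner_lift_symm hS, real_inner_comm, inner_lift_prim_self d hS]
  have c3 : 0 ≤ ⟪lift D.damp p, w⟫_ℝ := by
    rw [hself _ D.damp_symm]
    have := D.damp_nonneg (tot w); positivity
  have c4 := inner_lift_self_nonneg D.damp_nonneg p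
  have c5 : D.κ₀ / 2 * ‖tot w‖ ^ 2 ≤ ⟪lift D.κ p, w⟫_ℝ := by
    rw [hself _ D.κ_symm]
    have := D.κ_ge (tot w); linarith
  have c6 := inner_lift_self_ge D.κ_ge p
  -- The only term without a sign: one integration by parts leaves a product of end values and a
  -- negative quadratic term.
  have c7 : ⟪lift D.r (prim d p), w⟫_ℝ = ⟪D.r (tot p), tot w⟫_ℝ - ⟪lift D.r p, p⟫_ℝ := by
    have := inner_prim_add d (lift D.r p) w
    rw [prim_lift, tot_lift] at this
    linarith
  have c8 := hself _ D.r_symm p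
  have c9 : ⟪lift D.r p, p⟫_ℝ ≤ ‖D.r‖ * ‖p‖ ^ 2 := by
    refine (real_inner_le_norm _ _).trans ?_
    have := mul_le_mul_of_nonneg_right (norm_lift_le D.r p) (norm_nonneg p)
    linarith
  -- Half of the quadratic form of `r` at `l • tot p + tot w`. Completing this square costs `1 / (2
  -- l) ⟪r (tot w), tot w⟫`, at most `κ₀ / 4 ‖tot w‖²` by the choice of the weight.
  have c10 : 0 ≤ l * (l / 2 * ⟪D.r (tot p), tot p⟫_ℝ + ⟪D.r (tot p), tot w⟫_ℝ)
      + 1 / 2 * ⟪D.r (tot w), tot w⟫_ℝ := by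
    have := D.r_nonneg (l • tot p + tot w)
    simp only [map_add, map_smul, inner_add_left, inner_add_right, inner_smul_left,
      inner_smul_right, RCLike.conj_to_real] at this
    have hs : ⟪D.r (tot w), tot p⟫_ℝ = ⟪D.r (tot p), tot w⟫_ℝ := by
      rw [D.r_symm, real_inner_comm]
    rw [hs] at this
    linarith
  have c11 := D.r_le (tot w)
  have c12 := D.weight_mul
  have c13 : -(D.κ₀ / 4 * ‖tot w‖ ^ 2) ≤
      l / 2 * ⟪D.r (tot p), tot p⟫_ℝ + ⟪D.r (tot p), tot w⟫_ℝ := by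
    refine le_of_mul_le_mul_left ?_ hl
    have : 2 * ‖D.r‖ * ‖tot w‖ ^ 2 ≤ l * D.κ₀ * ‖tot w‖ ^ 2 :=
      mul_le_mul_of_nonneg_right c12 (sq_nonneg _)
    linarith
  have c14 : 2 * ‖D.r‖ * ‖p‖ ^ 2 ≤ l * D.κ₀ * ‖p‖ ^ 2 :=
    mul_le_mul_of_nonneg_right c12 (sq_nonneg _)
  simp only [op, inner_add_left, inner_add_right, inner_smul_right]
  rw [c7, c8]
  have m2 := mul_nonneg hl.le c2
  have m4 := mul_nonneg hl.le c4
  have m6 := mul_le_mul_of_nonneg_left c6 hl.le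
  linarith

/-- Test functions of the form `w + λ prim d w` have no nonzero element orthogonal to all of them,
so an equation tested against them holds in `L²`. -/
theorem eq_zero_of_inner_test (d : Bool) {l : ℝ} (hl : 0 < l) {G : L2 a b V}
    (h : ∀ w, ⟪G, w + l • prim d w⟫_ℝ = 0) : G = 0 := by
  -- This choice gives `½ ‖tot G‖² + λ ‖prim (!d) G‖² = 0`; then `w = G` finishes.
  have h1 := h (prim (!d) G)
  rw [inner_add_right, inner_smul_right, inner_prim_self, inner_prim_right d] at h1
  have h0 : prim (!d) G = 0 := by
    have p1 := real_inner_self_nonneg (x := tot G)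
    have p2 := real_inner_self_nonneg (x := prim (!d) G)
    rw [← inner_self_eq_zero (𝕜 := ℝ)]
    nlinarith
  have h2 := h G
  rw [inner_add_right, inner_smul_right, inner_prim_right d, h0, inner_zero_left, mul_zero,
    add_zero] at h2
  exact inner_self_eq_zero.1 h2

/-- The coercivity bound controls `ι w`, `tot w` and `prim d w`, but not `w` itself. The three parts
of the right hand side are those whose pairing with `w` moves onto these three quantities; a general
element of `L²(a, b; V)` would not do. -/
theorem exists_solution (d : Bool) (f : L2 a b H) (c : V) (G : L2 a b V) :
    ∃ (q : L2 a b H) (p : L2 a b V), lift D.ι p = prim d q ∧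
      D.op d q p = lift D.ιadj f + cst c + prim (!d) G := by
  set R : L2 a b V := lift D.ιadj f + cst c + prim (!d) G with hR
  set l := D.weight
  have hl : 0 < l := D.weight_pos
  let e := WithLp.prodContinuousLinearEquiv 2 ℝ (L2 a b H) (L2 a b V)
  let P₁ : WithLp 2 (L2 a b H × L2 a b V) →L[ℝ] L2 a b H :=
    (ContinuousLinearMap.fst ℝ _ _).comp e.toContinuousLinearMap
  let P₂ : WithLp 2 (L2 a b H × L2 a b V) →L[ℝ] L2 a b V :=
    (ContinuousLinearMap.snd ℝ _ _).comp e.toContinuousLinearMap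
  -- The solution is sought among pairs `(q, p)` that already satisfy the constraint, a closed
  -- subspace and hence a Hilbert space.
  let K : Submodule ℝ (WithLp 2 (L2 a b H × L2 a b V)) :=
    ((lift D.ι).comp P₂ - (prim d).comp P₁).ker
  have hK : IsClosed (K : Set (WithLp 2 (L2 a b H × L2 a b V))) :=
    ((lift D.ι).comp P₂ - (prim d).comp P₁).isClosed_ker
  have : CompleteSpace K := hK.completeSpace_coe
  let A : WithLp 2 (L2 a b H × L2 a b V) →L[ℝ] L2 a b V :=
    (lift D.mass).comp P₁ + (lift D.damp).comp P₂ + (lift D.r).comp ((prim d).comp P₂)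
      + (lift D.κ).comp P₂
  let B : L2 a b V →ₗ[ℝ] StrongDual ℝ K :=
    { toFun := fun w => (innerSL ℝ (w + l • prim d w)).comp (A.comp K.subtypeL)
      map_add' := fun w w' => by
        ext z
        simp only [ContinuousLinearMap.comp_apply, innerSL_apply_apply,
          _root_.add_apply, ← inner_add_left, map_add, smul_add]
        congr 1; abel
      map_smul' := fun c w => by
        ext z
        simp only [ContinuousLinearMap.comp_apply, innerSL_apply_apply,
          _root_.smul_apply, RingHom.id_apply, smul_eq_mul, ← real_inner_smul_left,
          map_smul, smul_add, smul_comm c l] }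
  let L : L2 a b V →ₗ[ℝ] ℝ :=
    { toFun := fun w => ⟪R, w + l • prim d w⟫_ℝ
      map_add' := fun w w' => by
        rw [← inner_add_right, map_add, smul_add]
        congr 1; abel
      map_smul' := fun c w => by
        rw [RingHom.id_apply, smul_eq_mul, ← real_inner_smul_right, map_smul, smul_add,
          smul_comm c l] }
  have hB : ∀ w z, B w z = ⟪w + l • prim d w, D.op d z.1.fst z.1.snd⟫_ℝ := fun w z => rfl
  have hL : ∀ w, L w = ⟪R, w + l • prim d w⟫_ℝ := fun w => rfl
  set α := min D.ρ₀ (min (D.κ₀ / 4) (l * D.κ₀ / 2))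
  have hκ := D.κ₀_pos
  have hα : 0 < α := lt_min D.ρ₀_pos (lt_min (by positivity) (by positivity))
  set C := ‖f‖ + ‖c‖ + ‖G‖ + l * ‖R‖
  have hC : 0 ≤ C := by positivity
  obtain ⟨z, hz⟩ := exists_apply_eq_of_abs_le B L (C / α) (by
    intro w
    -- The bound proved is `|L w| ≤ C n` together with `α n ≤ ‖B w‖`. The term `tot w` enters `n`
    -- only to control the constant part `c` of the data.
    set n := √(‖lift D.ι w‖ ^ 2 + ‖tot w‖ ^ 2 + ‖prim d w‖ ^ 2)
    have hn0 : 0 ≤ n := Real.sqrt_nonneg _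
    have hn : n ^ 2 = ‖lift D.ι w‖ ^ 2 + ‖tot w‖ ^ 2 + ‖prim d w‖ ^ 2 :=
      Real.sq_sqrt (by positivity)
    have n1 : ‖lift D.ι w‖ ≤ n := 
      Real.le_sqrt_of_sq_le (by nlinarith [sq_nonneg ‖tot w‖, sq_nonneg ‖prim d w‖])
    have n2 : ‖tot w‖ ≤ n :=
      Real.le_sqrt_of_sq_le (by nlinarith [sq_nonneg ‖lift D.ι w‖, sq_nonneg ‖prim d w‖])
    have n3 : ‖prim d w‖ ≤ n :=
      Real.le_sqrt_of_sq_le (by nlinarith [sq_nonneg ‖lift D.ι w‖, sq_nonneg ‖tot w‖])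
    have hLw : |L w| ≤ C * n := by
      rw [hL, inner_add_right, inner_smul_right]
      have e1 : ⟪R, w⟫_ℝ = ⟪f, lift D.ι w⟫_ℝ + ⟪c, tot w⟫_ℝ + ⟪G, prim d w⟫_ℝ := by
        rw [hR, inner_add_left, inner_add_left, inner_ιadj, inner_cst, ← inner_prim_right]
      rw [e1]
      have b1 := (abs_real_inner_le_norm f (lift D.ι w)).trans
        (mul_le_mul_of_nonneg_left n1 (norm_nonneg _))
      have b2 := (abs_real_inner_le_norm c (tot w)).trans
        (mul_le_mul_of_nonneg_left n2 (norm_nonneg _))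
      have b3 := (abs_real_inner_le_norm G (prim d w)).trans
        (mul_le_mul_of_nonneg_left n3 (norm_nonneg _))
      have b4 := (abs_real_inner_le_norm R (prim d w)).trans
        (mul_le_mul_of_nonneg_left n3 (norm_nonneg _))
      have b5 : |l * ⟪R, prim d w⟫_ℝ| ≤ l * (‖R‖ * n) := by
        rw [abs_mul, abs_of_pos hl]
        exact mul_le_mul_of_nonneg_left b4 hl.le
      calc _ ≤ |⟪f, lift D.ι w⟫_ℝ| + |⟪c, tot w⟫_ℝ| + |⟪G, prim d w⟫_ℝ|
            + |l * ⟪R, prim d w⟫_ℝ| :=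
            (abs_add_le _ _).trans (add_le_add_left ((abs_add_le _ _).trans
              (add_le_add_left (abs_add_le _ _) _)) _)
        _ ≤ _ := by simp only [C]; linarith
    -- The trial pair that realizes the coercivity: it lies in `K` since `ι` commutes with time
    -- integration, and its norm is at most `n`.
    have hjw : WithLp.toLp 2 (lift D.ι w, prim d w) ∈ K := by
      change lift D.ι (prim d w) - prim d (lift D.ι w) = 0
      rw [prim_lift, sub_self]
    have hBn : α * n ^ 2 ≤ ‖B w‖ * n := by
      have k1 := D.coercive d w
      have k2 : B w ⟨_, hjw⟩ ≤ ‖B w‖ * n := by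
        refine (le_abs_self _).trans (((B w).le_opNorm _).trans ?_)
        refine mul_le_mul_of_nonneg_left ?_ (B w).opNorm_nonneg
        refine Real.le_sqrt_of_sq_le ?_
        change ‖WithLp.toLp 2 (lift D.ι w, prim d w)‖ ^ 2 ≤ _
        rw [WithLp.prod_norm_sq_eq_of_L2]
        change ‖lift D.ι w‖ ^ 2 + ‖prim d w‖ ^ 2 ≤ _
        have := sq_nonneg ‖tot w‖
        linarith
      rw [hB, real_inner_comm] at k2
      refine le_trans ?_ (k1.trans k2)
      rw [hn]
      have a1 : α ≤ D.ρ₀ := min_le_left _ _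
      have a2 : α ≤ D.κ₀ / 4 := (min_le_right _ _).trans (min_le_left _ _)
      have a3 : α ≤ l * D.κ₀ / 2 := (min_le_right _ _).trans (min_le_right _ _)
      have := mul_le_mul_of_nonneg_right a1 (sq_nonneg ‖lift D.ι w‖)
      have := mul_le_mul_of_nonneg_right a2 (sq_nonneg ‖tot w‖)
      have := mul_le_mul_of_nonneg_right a3 (sq_nonneg ‖prim d w‖)
      linarith
    have hn' : α * n ≤ ‖B w‖ := by
      rcases eq_or_lt_of_le hn0 with h0 | h0
      · rw [← h0, mul_zero]; exact (B w).opNorm_nonneg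
      · refine le_of_mul_le_mul_right ?_ h0
        linarith
    refine hLw.trans ?_
    rw [div_mul_eq_mul_div, le_div_iff₀ hα, mul_assoc, mul_comm n]
    exact mul_le_mul_of_nonneg_left hn' hC)
  refine ⟨z.1.fst, z.1.snd, sub_eq_zero.1 z.2, ?_⟩
  rw [← sub_eq_zero]
  refine eq_zero_of_inner_test d hl fun w => ?_
  have := hz w
  rw [hB, hL, real_inner_comm] at this
  rw [inner_sub_left, this, sub_self]

end Evolution

/-! ### Sobolev spaces in terms of the highest derivative -/

section Complete

variable {E : Type*} [NormedAddCommGroup E] [InnerProductSpace ℝ E] [CompleteSpace E]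
variable {a b : ℝ}

/-- The weak derivative of order `j`, as a bounded operator. -/
def compL {m : ℕ} (j : Fin (m + 1)) : Sobolev E m a b →L[ℝ] L2 a b E :=
  (PiLp.proj 2 (fun _ : Fin (m + 1) => L2 a b E) j).comp (sobolevSubmodule E m a b).subtypeL

theorem Sobolev.ext {m : ℕ} {f g : Sobolev E m a b} (h : ∀ j, f.comp j = g.comp j) : f = g :=
  Subtype.ext (PiLp.ext h)

theorem tot_cst (hab : a ≤ b) (c : E) : tot (cst c : L2 a b E) = (b - a) • c := by
  rw [tot_apply, integral_congr_ae (coeFn_cst c), integral_const]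
  simp [measureReal_def, hab]

/-- The constant of integration must be the mean value. With it explicit, the condition is an
equation between continuous maps, hence closed, which gives completeness of the Sobolev spaces. -/
theorem hasWeakDeriv_iff_eq (hab : a < b) {f f' : L2 a b E} :
    HasWeakDeriv a b f f' ↔
      f - prim true f' = cst ((b - a)⁻¹ • tot (f - prim true f')) := by
  rw [hasWeakDeriv_iff hab]
  constructor
  · rintro ⟨c, rfl⟩
    rw [add_sub_cancel_right, tot_cst hab.le, smul_smul, inv_mul_cancel₀ (sub_pos.2 hab).ne',
      one_smul]
  · intro h
    exact ⟨_, sub_eq_iff_eq_add.1 h⟩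

theorem isClosed_sobolevSubmodule (hab : a < b) (m : ℕ) :
    IsClosed (sobolevSubmodule E m a b : Set (PiLp 2 (fun _ : Fin (m + 1) => L2 a b E))) := by
  have : (sobolevSubmodule E m a b : Set (PiLp 2 (fun _ : Fin (m + 1) => L2 a b E)))
      = ⋂ j : Fin m, {f | f j.castSucc - prim true (f j.succ)
          = cst ((b - a)⁻¹ • tot (f j.castSucc - prim true (f j.succ)))} := by
    ext f
    simp only [mem_iInter, mem_ofPred_eq]
    exact forall_congr' fun j => hasWeakDeriv_iff_eq hab
  rw [this]
  exact isClosed_iInter fun j => isClosed_eq (by fun_prop) (by fun_prop)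

theorem completeSpace_sobolev (hab : a < b) (m : ℕ) : CompleteSpace (Sobolev E m a b) :=
  (isClosed_sobolevSubmodule hab m).completeSpace_coe

end Complete

local instance {E : Type*} [NormedAddCommGroup E] [NormedSpace ℝ E] {m : ℕ} {a b : ℝ} :
    NormedAddCommGroup (Sobolev E m a b) :=
  Submodule.normedAddCommGroup (sobolevSubmodule E m a b)

local instance {m : ℕ} {a b : ℝ} : NormedAddCommGroup (SobolevLeft m a b) :=
  Submodule.normedAddCommGroup (leftSubmodule m a b)

local instance {m : ℕ} {a b : ℝ} : InnerProductSpace ℝ (SobolevLeft m a b) :=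
  Submodule.innerProductSpace (leftSubmodule m a b)

instance {a b : ℝ} : SecondCountableTopology (L2 a b ℝ) :=
  haveI : Fact ((2 : ENNReal) ≠ ⊤) := ⟨by norm_num⟩
  inferInstance

/-! ### Elements of `H²` and `V` in terms of their second derivative. -/

variable {ℓ : ℝ}

/-- The embedding of `V`, in terms of second derivatives. -/
def dbl (ℓ : ℝ) : L2 0 ℓ ℝ →L[ℝ] L2 0 ℓ ℝ := (prim true).comp (prim true)

theorem Sobolev.hasWeakDeriv_zero (h : H2 ℓ) : HasWeakDeriv 0 ℓ (h.comp 0) (h.comp 1) := h.2 0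

theorem Sobolev.hasWeakDeriv_one (h : H2 ℓ) : HasWeakDeriv 0 ℓ (h.comp 1) (h.comp 2) := h.2 1

/-- The function in `H²` with given first derivatives. -/
def mkH2 (f₀ f₁ f₂ : L2 0 ℓ ℝ) (h₀ : HasWeakDeriv 0 ℓ f₀ f₁) (h₁ : HasWeakDeriv 0 ℓ f₁ f₂) :
    H2 ℓ :=
  ⟨WithLp.toLp 2 ![f₀, f₁, f₂], fun j => by fin_cases j; exacts [h₀, h₁]⟩

theorem hasWeakDeriv_prim {E : Type*} [NormedAddCommGroup E] [InnerProductSpace ℝ E]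
    [CompleteSpace E] {a b : ℝ} (f : L2 a b E) :
    HasWeakDeriv a b (prim true f) f := by
  simpa using hasWeakDeriv_cst_add_prim 0 f

theorem hasValue_prim {E : Type*} [NormedAddCommGroup E] [InnerProductSpace ℝ E]
    [CompleteSpace E] {a b : ℝ} (f : L2 a b E) :
    HasValue a b (prim true f) a 0 := by
  simpa using hasValue_left_cst_add_prim 0 f

/-- The function `x` in `H²`. -/
def linFun (ℓ : ℝ) : H2 ℓ :=
  mkH2 (prim true (cst 1)) (cst 1) 0 (hasWeakDeriv_prim _)
    (by simpa using hasWeakDeriv_cst_add_prim (a := 0) (b := ℓ) (1 : ℝ) 0)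

/-- The element of `V` with given second derivative. -/
def ofCurv : L2 0 ℓ ℝ →L[ℝ] V ℓ :=
  ((((PiLp.continuousLinearEquiv 2 ℝ (fun _ : Fin 3 => L2 0 ℓ ℝ)).symm.toContinuousLinearMap.comp
    (ContinuousLinearMap.pi ![dbl ℓ, prim true, ContinuousLinearMap.id ℝ _])).codRestrict
      (sobolevSubmodule ℝ 2 0 ℓ) (fun w j => by
        fin_cases j
        · exact hasWeakDeriv_prim (prim true w)
        · exact hasWeakDeriv_prim w))).codRestrict (leftSubmodule 2 0 ℓ) (fun w j => by
        fin_cases j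
        · exact hasValue_prim (prim true w)
        · exact hasValue_prim w)

/-- The second derivative. -/
def curv : V ℓ →L[ℝ] L2 0 ℓ ℝ := (compL 2).comp (leftSubmodule 2 0 ℓ).subtypeL

theorem curv_ofCurv (w : L2 0 ℓ ℝ) : curv (ofCurv w) = w := rfl

/-- Two integrations from `0`: the slope `c` produces the multiple of `x`, the second derivative the
part in `V`. -/
theorem Sobolev.values_iff (hℓ : 0 < ℓ) (h : H2 ℓ) (c : ℝ) :
    (HasValue 0 ℓ (h.D 0) 0 0 ∧ HasValue 0 ℓ (h.D 1) 0 c) ↔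
      h = c • linFun ℓ + (ofCurv (h.comp 2)).1 := by
  have e : h = c • linFun ℓ + (ofCurv (h.comp 2)).1 ↔
      h.comp 0 = prim true (h.comp 1) ∧ h.comp 1 = cst c + prim true (h.comp 2) := by
    have e1 : (c • linFun ℓ + (ofCurv (h.comp 2)).1).comp 1 = cst c + prim true (h.comp 2) := by
      change c • cst 1 + prim true (h.comp 2) = _
      rw [← map_smul, smul_eq_mul, mul_one]
    have e0 : (c • linFun ℓ + (ofCurv (h.comp 2)).1).comp 0
        = prim true (cst c + prim true (h.comp 2)) := by
      change c • prim true (cst 1) + prim true (prim true (h.comp 2)) = _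
      rw [map_add, ← map_smul, ← map_smul, smul_eq_mul, mul_one]
    have e2 : (c • linFun ℓ + (ofCurv (h.comp 2)).1).comp 2 = h.comp 2 := by
      change c • (0 : L2 0 ℓ ℝ) + h.comp 2 = _
      simp
    constructor
    · intro hh
      have h1 := congrArg (fun f : H2 ℓ => f.comp 1) hh
      have h0 := congrArg (fun f : H2 ℓ => f.comp 0) hh
      simp only [e1] at h1
      simp only [e0] at h0
      exact ⟨by rw [h0, h1], h1⟩
    · rintro ⟨h0, h1⟩
      refine Sobolev.ext fun j => ?_
      fin_cases j
      · change h.comp 0 = Sobolev.comp _ 0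
        rw [e0, h0, ← h1]
      · change h.comp 1 = Sobolev.comp _ 1
        rw [e1, ← h1]
      · exact e2.symm
  rw [e]
  have h0 := hasWeakDeriv_and_hasValue_left_iff hℓ (f := h.comp 0) (f' := h.comp 1) (c := 0)
  have h1 := hasWeakDeriv_and_hasValue_left_iff hℓ (f := h.comp 1) (f' := h.comp 2) (c := c)
  rw [map_zero, zero_add] at h0
  rw [← h0, ← h1]
  exact ⟨fun ⟨a, b⟩ => ⟨⟨h.hasWeakDeriv_zero, a⟩, ⟨h.hasWeakDeriv_one, b⟩⟩,
    fun ⟨a, b⟩ => ⟨a.2, b.2⟩⟩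

theorem ofCurv_curv (hℓ : 0 < ℓ) (v : V ℓ) : ofCurv (curv v) = v := by
  have h := (Sobolev.values_iff hℓ v.1 0).1 ⟨v.2 0, v.2 1⟩
  rw [zero_smul, zero_add] at h
  exact Subtype.ext h.symm

theorem V.comp_zero (hℓ : 0 < ℓ) (v : V ℓ) : v.1.comp 0 = dbl ℓ (curv v) := by
  conv_lhs => rw [← ofCurv_curv hℓ v]
  rfl

theorem completeSpace_V (hℓ : 0 < ℓ) : CompleteSpace (V ℓ) := by
  let e : V ℓ ≃L[ℝ] L2 0 ℓ ℝ := ContinuousLinearEquiv.equivOfInverse curv ofCurv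
    (ofCurv_curv hℓ) curv_ofCurv
  exact (completeSpace_congr (e := e.toEquiv) e.isUniformEmbedding).2 inferInstance

instance [hℓ : Fact (0 < ℓ)] : CompleteSpace (V ℓ) := completeSpace_V hℓ.1

instance [hℓ : Fact (0 < ℓ)] : CompleteSpace (H2 ℓ) := completeSpace_sobolev hℓ.1 2

/-- The second derivative of the functional `v ↦ v(ℓ)`. -/
def tipFun (ℓ : ℝ) : L2 0 ℓ ℝ := prim false (cst 1)

/-- `tipFun` is the function `ℓ - x`, the kernel of double integration evaluated at `ℓ`. -/
theorem inner_tipFun (w : L2 0 ℓ ℝ) : ⟪tipFun ℓ, w⟫_ℝ = tot (prim true w) := by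
  rw [tipFun, ← Bool.not_true, ← inner_prim_right, inner_cst]
  simp

theorem tip_eq (hℓ : 0 < ℓ) (c : ℝ) (w : L2 0 ℓ ℝ) :
    tip (c • linFun ℓ + (ofCurv w).1) = c * ℓ + ⟪tipFun ℓ, w⟫_ℝ := by
  refine HasValue.value_eq hℓ (right_mem_Icc.2 hℓ.le) ?_
  have h : (c • linFun ℓ + (ofCurv w).1).comp 0 = cst 0 + prim true (cst c + prim true w) := by
    change c • prim true (cst 1) + prim true (prim true w) = _
    rw [map_zero, zero_add, map_add, ← map_smul, ← map_smul, smul_eq_mul, mul_one]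
  have h2 := hasValue_cst_add_prim (0 : ℝ) (cst c + prim true w) ℓ
  rw [← h, primFun_right, ← tot_apply, map_add, tot_cst hℓ.le, ← inner_tipFun] at h2
  rwa [zero_add, sub_zero, smul_eq_mul, mul_comm ℓ] at h2

theorem tip_V (hℓ : 0 < ℓ) (v : V ℓ) : tip v.1 = ⟪tipFun ℓ, curv v⟫_ℝ := by
  have := tip_eq hℓ 0 (curv v)
  rwa [zero_smul, zero_add, zero_mul, zero_add, ofCurv_curv hℓ] at this

/-! ### Multiplication operators -/

theorem exists_mulOp {a b : ℝ} {m : ℝ → ℝ} (hm : AEStronglyMeasurable m (vol a b)) {C : ℝ}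
    (hC : ∀ᵐ x ∂vol a b, |m x| ≤ C) :
    ∃ S : L2 a b ℝ →L[ℝ] L2 a b ℝ, ∀ f, S f =ᵐ[vol a b] fun x => m x * f x := by
  have hmem : ∀ f : L2 a b ℝ, MemLp (fun x => m x * f x) 2 (vol a b) := fun f =>
    (Lp.memLp f).of_le_mul (hm.mul (Lp.aestronglyMeasurable f)) (c := C) (by
      filter_upwards [hC] with x hx
      rw [norm_mul]
      exact mul_le_mul_of_nonneg_right hx (norm_nonneg _))
  refine ⟨LinearMap.mkContinuous
    { toFun := fun f => (hmem f).toLp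
      map_add' := fun f g => by
        ext1
        filter_upwards [(hmem (f + g)).coeFn_toLp, (hmem f).coeFn_toLp, (hmem g).coeFn_toLp,
          Lp.coeFn_add (hmem f).toLp (hmem g).toLp, Lp.coeFn_add f g] with x h1 h2 h3 h4 h5
        rw [h1, h4, Pi.add_apply, h2, h3, h5, Pi.add_apply, mul_add]
      map_smul' := fun c f => by
        ext1
        filter_upwards [(hmem (c • f)).coeFn_toLp, (hmem f).coeFn_toLp,
          Lp.coeFn_smul c (hmem f).toLp, Lp.coeFn_smul c f] with x h1 h2 h3 h4
        rw [h1, RingHom.id_apply, h3, Pi.smul_apply, h2, h4, Pi.smul_apply, smul_eq_mul,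
          smul_eq_mul]
        ring } C (fun f => by
      refine Lp.norm_le_mul_norm_of_ae_le_mul ?_
      filter_upwards [(hmem f).coeFn_toLp, hC] with x h1 hx
      change ‖(hmem f).toLp _ x‖ ≤ _
      rw [h1, norm_mul]
      exact mul_le_mul_of_nonneg_right hx (norm_nonneg _)),
    fun f => (hmem f).coeFn_toLp⟩

theorem inner_mulOp_left {a b : ℝ} {m : ℝ → ℝ} {S : L2 a b ℝ →L[ℝ] L2 a b ℝ}
    (hS : ∀ f, S f =ᵐ[vol a b] fun x => m x * f x) (f g : L2 a b ℝ) :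
    ⟪S f, g⟫_ℝ = ∫ x, m x * f x * g x ∂vol a b := by
  rw [L2.inner_def]
  refine integral_congr_ae ?_
  filter_upwards [hS f] with x h1
  rw [h1]
  simp [mul_comm]

theorem mulOp_symm {a b : ℝ} {m : ℝ → ℝ} {S : L2 a b ℝ →L[ℝ] L2 a b ℝ}
    (hS : ∀ f, S f =ᵐ[vol a b] fun x => m x * f x) (f g : L2 a b ℝ) :
    ⟪S f, g⟫_ℝ = ⟪f, S g⟫_ℝ := by
  rw [real_inner_comm (S g), inner_mulOp_left hS, inner_mulOp_left hS]
  congr 1; ext x; ring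

theorem integrable_mulOp_mul {a b : ℝ} {m : ℝ → ℝ} {S : L2 a b ℝ →L[ℝ] L2 a b ℝ}
    (hS : ∀ f, S f =ᵐ[vol a b] fun x => m x * f x) (f g : L2 a b ℝ) :
    Integrable (fun x => m x * f x * g x) (vol a b) := by
  refine (L2.integrable_inner (𝕜 := ℝ) (S f) g).congr ?_
  filter_upwards [hS f] with x h1
  rw [h1]
  simp [mul_comm]

theorem mulOp_ge {a b : ℝ} {m : ℝ → ℝ} {S : L2 a b ℝ →L[ℝ] L2 a b ℝ}
    (hS : ∀ f, S f =ᵐ[vol a b] fun x => m x * f x) {c : ℝ} (hc : ∀ᵐ x ∂vol a b, c ≤ m x)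
    (f : L2 a b ℝ) : c * ‖f‖ ^ 2 ≤ ⟪S f, f⟫_ℝ := by
  rw [inner_mulOp_left hS, ← real_inner_self_eq_norm_sq, L2.inner_def, ← integral_const_mul]
  refine integral_mono_ae ((L2.integrable_inner f f).const_mul c) (integrable_mulOp_mul hS f f) ?_
  filter_upwards [hc] with x hx
  simp only [RCLike.inner_apply, RCLike.conj_to_real]
  nlinarith [mul_self_nonneg (f x)]

/-! ### The beam as an evolution equation for the second derivative in space -/

/-- The operators of the evolution equation that belongs to a beam. -/
structure Model (B : Beam) where
  D : Evolution (L2 0 B.ℓ ℝ) (L2 0 B.ℓ ℝ)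
  ι_eq : D.ι = dbl B.ℓ
  ρ_spec : ∀ f, D.ρ f =ᵐ[vol 0 B.ℓ] fun x => B.ρ x * f x
  μ_spec : ∀ f, D.μ f =ᵐ[vol 0 B.ℓ] fun x => B.μ x * f x
  r_spec : ∀ f, D.r f =ᵐ[vol 0 B.ℓ] fun x => B.r x * f x
  κ_spec : ∀ f, D.κ f =ᵐ[vol 0 B.ℓ] fun x => B.κ x * f x

theorem Beam.Basic.exists_model {B : Beam} (hB : B.Basic) : Nonempty (Model B) := by
  obtain ⟨ρ₀, ρ₁, hρ₀, hρ⟩ := hB.bound_ρ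
  obtain ⟨μ₀, μ₁, hμ₀, hμ⟩ := hB.bound_μ
  obtain ⟨r₀, r₁, hr₀, hr⟩ := hB.bound_r
  obtain ⟨κ₀, κ₁, hκ₀, hκ⟩ := hB.bound_κ
  have hr' : ∀ᵐ x ∂vol 0 B.ℓ, r₀ ≤ B.r x ∧ B.r x ≤ r₁ :=
    (ae_restrict_iff' measurableSet_Ioo).2
      (Filter.Eventually.of_forall fun x hx => hr x (Ioo_subset_Icc_self hx))
  have hκ' : ∀ᵐ x ∂vol 0 B.ℓ, κ₀ ≤ B.κ x ∧ B.κ x ≤ κ₁ :=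
    (ae_restrict_iff' measurableSet_Ioo).2
      (Filter.Eventually.of_forall fun x hx => hκ x (Ioo_subset_Icc_self hx))
  have mr : AEStronglyMeasurable B.r (vol 0 B.ℓ) :=
    (hB.cont_r.mono Ioo_subset_Icc_self).aestronglyMeasurable measurableSet_Ioo
  have mκ : AEStronglyMeasurable B.κ (vol 0 B.ℓ) :=
    (hB.cont_κ.mono Ioo_subset_Icc_self).aestronglyMeasurable measurableSet_Ioo
  obtain ⟨ρ, ρs⟩ := exists_mulOp hB.meas_ρ (C := ρ₁)
    (hρ.mono fun x h => abs_le.2 ⟨by linarith [h.1, h.2], h.2⟩)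
  obtain ⟨μ, μs⟩ := exists_mulOp hB.meas_μ (C := μ₁)
    (hμ.mono fun x h => abs_le.2 ⟨by linarith [h.1, h.2], h.2⟩)
  obtain ⟨r, rs⟩ := exists_mulOp mr (C := r₁)
    (hr'.mono fun x h => abs_le.2 ⟨by linarith [h.1, h.2], h.2⟩)
  obtain ⟨κ, κs⟩ := exists_mulOp mκ (C := κ₁)
    (hκ'.mono fun x h => abs_le.2 ⟨by linarith [h.1, h.2], h.2⟩)
  exact ⟨{
    D :=
      { ι := dbl B.ℓ, ρ := ρ, μ := μ, r := r, κ := κ, ρ₀ := ρ₀, κ₀ := κ₀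
        ι_injective := prim_true_injective.comp prim_true_injective
        ρ_symm := mulOp_symm ρs, μ_symm := mulOp_symm μs, r_symm := mulOp_symm rs
        κ_symm := mulOp_symm κs, ρ₀_pos := hρ₀, κ₀_pos := hκ₀
        ρ_ge := mulOp_ge ρs (hρ.mono fun _ h => h.1)
        μ_nonneg := fun x => (mul_nonneg hμ₀ (sq_nonneg _)).trans
          (mulOp_ge μs (hμ.mono fun _ h => h.1) x)
        r_nonneg := fun x => (mul_nonneg hr₀.le (sq_nonneg _)).trans
          (mulOp_ge rs (hr'.mono fun _ h => h.1) x)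
        κ_ge := mulOp_ge κs (hκ'.mono fun _ h => h.1) }
    ι_eq := rfl, ρ_spec := ρs, μ_spec := μs, r_spec := rs, κ_spec := κs }⟩

namespace Model

variable {B : Beam} (M : Model B)

/-- The sign `s` is `1` for the direct problem and `-1` for the adjoint ones, where the terms with a
first time derivative change sign. -/
theorem integral_eq (s : ℝ) (f₁ f₂ f₃ f₄ w : L2 0 B.ℓ ℝ) :
    ∫ x in Ioo 0 B.ℓ, (B.ρ x * f₁ x * dbl B.ℓ w x + s * (B.μ x * f₂ x * dbl B.ℓ w x)
        + B.r x * f₃ x * w x + s * (B.κ x * f₄ x * w x))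
      = ⟪M.D.mass f₁ + s • M.D.ιadj (M.D.μ f₂) + M.D.r f₃ + s • M.D.κ f₄, w⟫_ℝ := by
  have i1 := integrable_mulOp_mul M.ρ_spec f₁ (dbl B.ℓ w)
  have i2 := (integrable_mulOp_mul M.μ_spec f₂ (dbl B.ℓ w)).const_mul s
  have i3 := integrable_mulOp_mul M.r_spec f₃ w
  have i4 := (integrable_mulOp_mul M.κ_spec f₄ w).const_mul s
  rw [integral_add ((i1.fun_add i2).fun_add i3) i4, integral_add (i1.fun_add i2) i3, integral_add i1 i2,
    integral_const_mul, integral_const_mul, ← inner_mulOp_left M.ρ_spec,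
    ← inner_mulOp_left M.μ_spec, ← inner_mulOp_left M.r_spec, ← inner_mulOp_left M.κ_spec,
    ← M.ι_eq]
  simp only [inner_add_left, Evolution.mass, Evolution.ιadj, ContinuousLinearMap.comp_apply,
    ContinuousLinearMap.adjoint_inner_left, real_inner_smul_left]

end Model

/-! ### Weak solutions in terms of the evolution equation -/

section Abstract

variable {E : Type*} [NormedAddCommGroup E] [InnerProductSpace ℝ E] [CompleteSpace E] {a b : ℝ}

/-- The function in `H¹` with given first derivative. -/
def mkH1 (f₀ f₁ : L2 a b E) (h : HasWeakDeriv a b f₀ f₁) : Sobolev E 1 a b :=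
  ⟨WithLp.toLp 2 ![f₀, f₁], fun j => by fin_cases j; exact h⟩

@[simp] theorem mkH1_comp_zero (f₀ f₁ : L2 a b E) (h : HasWeakDeriv a b f₀ f₁) :
    (mkH1 f₀ f₁ h).comp 0 = f₀ := rfl

theorem hasWeakDeriv_and_hasValue_left_zero_iff (hab : a < b) {f : ℝ → E} {F f' : L2 a b E}
    (hf : f =ᵐ[vol a b] F) :
    (HasWeakDeriv a b f f' ∧ HasValue a b f a 0) ↔ F = prim true f' := by
  have h := hasWeakDeriv_and_hasValue_left_iff hab (f := F) (f' := f') (c := 0)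
  rw [map_zero, zero_add] at h
  rw [← h]
  exact ⟨fun ⟨h1, h2⟩ => ⟨h1.congr hf (ae_eq_refl _), h2.congr hf⟩,
    fun ⟨h1, h2⟩ => ⟨h1.congr hf.symm (ae_eq_refl _), h2.congr hf.symm⟩⟩

theorem hasWeakDeriv_and_hasValue_right_zero_iff (hab : a < b) {f : ℝ → E} {F f' : L2 a b E}
    (hf : f =ᵐ[vol a b] F) :
    (HasWeakDeriv a b f f' ∧ HasValue a b f b 0) ↔ F = - prim false f' := by
  have h := hasWeakDeriv_and_hasValue_right_iff hab (f := F) (f' := f') (c := 0)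
  rw [map_zero, zero_sub] at h
  rw [← h]
  exact ⟨fun ⟨h1, h2⟩ => ⟨h1.congr hf (ae_eq_refl _), h2.congr hf⟩,
    fun ⟨h1, h2⟩ => ⟨h1.congr hf.symm (ae_eq_refl _), h2.congr hf.symm⟩⟩

theorem prim_true_eq (f : L2 a b E) : prim true f = cst (tot f) - prim false f := by
  rw [prim_false]; abel

namespace Evolution

variable {V H : Type*} [NormedAddCommGroup V] [InnerProductSpace ℝ V] [CompleteSpace V]
  [NormedAddCommGroup H] [InnerProductSpace ℝ H] [CompleteSpace H]
variable (D : Evolution V H)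

theorem op_add (d : Bool) (q q' : L2 a b H) (p p' : L2 a b V) :
    D.op d (q + q') (p + p') = D.op d q p + D.op d q' p' := by
  simp only [op, map_add]; abel

theorem op_smul (d : Bool) (c : ℝ) (q : L2 a b H) (p : L2 a b V) :
    D.op d (c • q) (c • p) = c • D.op d q p := by
  simp only [op, map_smul, smul_add]

theorem op_prim (d d' : Bool) (q : L2 a b H) (p : L2 a b V) (hdd : d = d') :
    D.op d (prim d' q) (prim d' p) = prim d' (D.op d q p) := by
  subst hdd
  simp only [op, map_add, prim_lift]

theorem unique (d : Bool) {q q' : L2 a b H} {p p' : L2 a b V} (h : lift D.ι p = prim d q)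
    (h' : lift D.ι p' = prim d q') (he : D.op d q p = D.op d q' p') : p = p' := by
  have h1 := D.norm_le_of_op d (q := q + (-1 : ℝ) • q') (p := p + (-1 : ℝ) • p')
    (by simp only [map_add, map_smul, h, h'])
  rw [op_add, op_smul, he] at h1
  have h2 : D.op d q' p' + (-1 : ℝ) • D.op d q' p' = 0 := by simp
  rw [h2, norm_zero] at h1
  have h3 : ‖p + (-1 : ℝ) • p'‖ = 0 := by
    have := D.κ₀_pos
    have := norm_nonneg (p + (-1 : ℝ) • p')
    nlinarith
  rw [norm_eq_zero] at h3
  simpa [add_neg_eq_zero] using h3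

/-- Solutions depend linearly and continuously on the right hand side. -/
theorem exists_solutionMap (d : Bool) {X : Type*} [NormedAddCommGroup X] [NormedSpace ℝ X]
    (A : X →L[ℝ] L2 a b V)
    (hA : ∀ x, ∃ (q : L2 a b H) (p : L2 a b V), lift D.ι p = prim d q ∧ D.op d q p = A x) :
    ∃ S : X →L[ℝ] L2 a b V, ∀ x, ∃ q : L2 a b H, lift D.ι (S x) = prim d q ∧
      D.op d q (S x) = A x := by
  choose q p h1 h2 using hA
  have hκ := D.κ₀_pos
  refine ⟨LinearMap.mkContinuous
    { toFun := p
      map_add' := fun x y => D.unique d (q := q (x + y)) (q' := q x + q y) (h1 _)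
        (by rw [map_add, map_add, h1, h1]) (by rw [op_add, h2, h2, h2, map_add])
      map_smul' := fun c x => D.unique d (q := q (c • x)) (q' := c • q x) (h1 _)
        (by rw [RingHom.id_apply, map_smul, map_smul, h1])
        (by rw [RingHom.id_apply, op_smul, h2, h2, map_smul]) } (D.κ₀⁻¹ * ‖A‖) (fun x => ?_),
    fun x => ⟨q x, h1 x, h2 x⟩⟩
  have h3 := (D.norm_le_of_op d (h1 x)).trans (le_of_eq (congrArg norm (h2 x)))
  have h4 := h3.trans (A.le_opNorm x)
  change ‖p x‖ ≤ _
  rw [mul_assoc, inv_mul_eq_div, le_div_iff₀ hκ, mul_comm]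
  exact h4

end Evolution

end Abstract

theorem inner_lift_toSpanSingleton {E : Type*} [NormedAddCommGroup E] [InnerProductSpace ℝ E]
    {a b : ℝ} (x : E) (f : L2 a b E) (h : L2 a b ℝ) :
    ⟪lift (ContinuousLinearMap.toSpanSingleton ℝ x) h, f⟫_ℝ = ⟪h, lift (innerSL ℝ x) f⟫_ℝ := by
  rw [L2.inner_def, L2.inner_def]
  refine integral_congr_ae ?_
  filter_upwards [coeFn_lift (ContinuousLinearMap.toSpanSingleton ℝ x) h,
    coeFn_lift (innerSL ℝ x) f] with t h1 h2
  rw [h1, h2]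
  simp [real_inner_smul_left, mul_comm]

theorem norm_sq_eq_integral {a b : ℝ} {f : L2 a b ℝ} {F : ℝ → ℝ} (h : F =ᵐ[vol a b] f) :
    ‖f‖ ^ 2 = ∫ t, F t ^ 2 ∂vol a b := by
  rw [← real_inner_self_eq_norm_sq, L2.inner_def]
  refine integral_congr_ae ?_
  filter_upwards [h] with t ht
  rw [ht]
  simp [sq]

theorem Beam.hasGradient_of_norm_sq (B : Beam) {m : ℕ} {J : SobolevLeft m 0 B.T → ℝ}
    (A : SobolevLeft m 0 B.T →L[ℝ] L2 0 B.T ℝ) (n : L2 0 B.T ℝ)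
    (hJ : ∀ g, J g = 1 / 2 * ‖A g - n‖ ^ 2) (g : SobolevLeft m 0 B.T) (γ : L2 0 B.T ℝ)
    {Γ : ℝ → ℝ} (hΓ : Γ =ᵐ[vol 0 B.T] γ)
    (h : ∀ h : SobolevLeft m 0 B.T, ⟪A g - n, A h⟫_ℝ = ⟪γ, h.1.comp 0⟫_ℝ) :
    B.HasGradient J g Γ := by
  refine ⟨(memLp_congr_ae hΓ).2 (Lp.memLp γ), (innerSL ℝ (A g - n)).comp A, fun k => ?_, ?_⟩
  · rw [ContinuousLinearMap.comp_apply, innerSL_apply_apply, h k, L2.inner_def]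
    refine integral_congr_ae ?_
    filter_upwards [hΓ] with t ht
    rw [ht]
    simp only [RCLike.inner_apply, RCLike.conj_to_real]
    exact mul_comm _ _
  · have hJ' : J = fun g => 1 / 2 * ‖A g - n‖ ^ 2 := funext hJ
    rw [hJ']
    have h1 : HasFDerivAt (fun g => A g - n) A g := A.hasFDerivAt.sub_const n
    have h2 := (h1.norm_sq).const_mul (1 / 2 : ℝ)
    refine h2.congr_fderiv ?_
    ext k
    simp

namespace Model

variable {B : Beam} (M : Model B)

/-- The right hand side that belongs to a force at the tip. -/
def load (B : Beam) : ℝ →L[ℝ] L2 0 B.ℓ ℝ := ContinuousLinearMap.toSpanSingleton ℝ (tipFun B.ℓ)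

/-- The deflection of the tip, in terms of the second derivative. -/
def tipL (B : Beam) : L2 0 B.ℓ ℝ →L[ℝ] ℝ := innerSL ℝ (tipFun B.ℓ)

theorem inner_load (f : L2 0 B.T (L2 0 B.ℓ ℝ)) (h : L2 0 B.T ℝ) :
    ⟪lift (load B) h, f⟫_ℝ = ⟪h, lift (tipL B) f⟫_ℝ := inner_lift_toSpanSingleton _ _ _

theorem weak_form_iff (s : ℝ) {g : ℝ → ℝ} {ξ : L2 0 B.T ℝ} (hg : g =ᵐ[vol 0 B.T] ξ)
    (q U P : L2 0 B.T (L2 0 B.ℓ ℝ)) :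
    (∀ w : L2 0 B.ℓ ℝ, ∀ᵐ t ∂vol 0 B.T, ⟪M.D.mass (q t) + s • M.D.damp (P t) + M.D.r (U t)
        + s • M.D.κ (P t), w⟫_ℝ = g t * ⟪tipFun B.ℓ, w⟫_ℝ) ↔
      lift M.D.mass q + s • lift M.D.damp P + lift M.D.r U + s • lift M.D.κ P
        = lift (load B) ξ := by
  set G := lift M.D.mass q + s • lift M.D.damp P + lift M.D.r U + s • lift M.D.κ P
    - lift (load B) ξ with hG
  have hGt : ∀ᵐ t ∂vol 0 B.T, ∀ w, ⟪w, G t⟫_ℝ = ⟪M.D.mass (q t) + s • M.D.damp (P t)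
      + M.D.r (U t) + s • M.D.κ (P t), w⟫_ℝ - g t * ⟪tipFun B.ℓ, w⟫_ℝ := by
    filter_upwards [hg, coeFn_lift M.D.mass q, coeFn_lift M.D.damp P, coeFn_lift M.D.r U,
      coeFn_lift M.D.κ P, coeFn_lift (load B) ξ,
      Lp.coeFn_sub (lift M.D.mass q + s • lift M.D.damp P + lift M.D.r U + s • lift M.D.κ P)
        (lift (load B) ξ),
      Lp.coeFn_add (lift M.D.mass q + s • lift M.D.damp P + lift M.D.r U) (s • lift M.D.κ P),
      Lp.coeFn_add (lift M.D.mass q + s • lift M.D.damp P) (lift M.D.r U),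
      Lp.coeFn_add (lift M.D.mass q) (s • lift M.D.damp P),
      Lp.coeFn_smul s (lift M.D.damp P), Lp.coeFn_smul s (lift M.D.κ P)]
      with t h0 h1 h2 h3 h4 h5 h6 h7 h8 h9 h10 h11 w
    rw [real_inner_comm, hG, h6, Pi.sub_apply, h7, Pi.add_apply, h8, Pi.add_apply, h9, Pi.add_apply,
      h10, h11, Pi.smul_apply, Pi.smul_apply, h1, h2, h3, h4, h5, h0, inner_sub_left, load,
      ContinuousLinearMap.toSpanSingleton_apply, real_inner_smul_left]
  rw [← sub_eq_zero, ← hG, Lp.eq_zero_iff_ae_eq_zero]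
  constructor
  · intro h
    -- The null set of times may depend on the test function; separability of `L²(0, ℓ)` allows one
    -- null set for all of them.
    refine ae_eq_zero_of_forall_inner (𝕜 := ℝ) fun w => ?_
    filter_upwards [hGt, h w] with t h1 h2
    rw [h1 w, h2, sub_self, Pi.zero_apply]
  · intro h w
    filter_upwards [hGt, h] with t h1 h2
    rw [← sub_eq_zero, ← h1 w, h2]
    exact inner_zero_right _

/-- The second derivative in space of a function of time with values in `V`. -/
def liftCurv {a b ℓ : ℝ} : L2 a b (V ℓ) →L[ℝ] L2 a b (L2 0 ℓ ℝ) := lift (curv (ℓ := ℓ))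

/-- The function of time with values in `V` that has a given second derivative in space. -/
def liftOfCurv {a b ℓ : ℝ} : L2 a b (L2 0 ℓ ℝ) →L[ℝ] L2 a b (V ℓ) := lift (ofCurv (ℓ := ℓ))

theorem coeFn_liftCurv {a b ℓ : ℝ} (u : L2 a b (V ℓ)) :
    liftCurv u =ᵐ[vol a b] fun t => curv (u t) := coeFn_lift (curv (ℓ := ℓ)) u

theorem coeFn_liftOfCurv {a b ℓ : ℝ} (p : L2 a b (L2 0 ℓ ℝ)) :
    liftOfCurv p =ᵐ[vol a b] fun t => ofCurv (p t) := coeFn_lift (ofCurv (ℓ := ℓ)) p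

theorem prim_liftCurv {a b ℓ : ℝ} [Fact (0 < ℓ)] (d : Bool) (u : L2 a b (V ℓ)) :
    prim d (liftCurv u) = liftCurv (prim d u) := prim_lift d (curv (ℓ := ℓ)) u

theorem prim_liftOfCurv {a b ℓ : ℝ} [Fact (0 < ℓ)] (d : Bool) (p : L2 a b (L2 0 ℓ ℝ)) :
    prim d (liftOfCurv p) = liftOfCurv (prim d p) := prim_lift d (ofCurv (ℓ := ℓ)) p

theorem liftCurv_liftOfCurv {a b ℓ : ℝ} (p : L2 a b (L2 0 ℓ ℝ)) : liftCurv (liftOfCurv p) = p := by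
  ext1
  filter_upwards [coeFn_liftCurv (liftOfCurv p), coeFn_liftOfCurv p] with t h1 h2
  rw [h1, h2, curv_ofCurv]

theorem liftOfCurv_liftCurv {a b ℓ : ℝ} (hℓ : 0 < ℓ) (u : L2 a b (V ℓ)) :
    liftOfCurv (liftCurv u) = u := by
  ext1
  filter_upwards [coeFn_liftOfCurv (liftCurv u), coeFn_liftCurv u] with t h1 h2
  rw [h1, h2, ofCurv_curv hℓ]

/-- The second derivative in space of the function `u_t`. -/
def vel (u : Sobolev (V B.ℓ) 1 0 B.T) : L2 0 B.T (L2 0 B.ℓ ℝ) := liftCurv (u.comp 1)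

/-- The function in `H¹(0, T; V)` that vanishes at `0` and has the velocity `p`. -/
def ofVel [Fact (0 < B.ℓ)] (p : L2 0 B.T (L2 0 B.ℓ ℝ)) : Sobolev (V B.ℓ) 1 0 B.T :=
  mkH1 (prim true (liftOfCurv p)) (liftOfCurv p) (hasWeakDeriv_prim _)

/-- The function in `H¹(0, T; V)` that vanishes at `T` and has the velocity `-p`. -/
def ofVelBack [Fact (0 < B.ℓ)] (p : L2 0 B.T (L2 0 B.ℓ ℝ)) : Sobolev (V B.ℓ) 1 0 B.T :=
  mkH1 (prim false (liftOfCurv p)) (- liftOfCurv p) (by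
    have h := hasWeakDeriv_cst_add_prim (tot (liftOfCurv p)) (-(liftOfCurv p))
    rwa [map_neg, ← sub_eq_add_neg, ← prim_false] at h)

theorem toL2_ae (hℓ : 0 < B.ℓ) (u : L2 0 B.T (V B.ℓ)) :
    (fun t => (u t).toL2) =ᵐ[vol 0 B.T] lift M.D.ι (liftCurv u) := by
  filter_upwards [coeFn_lift M.D.ι (liftCurv u), coeFn_liftCurv u] with t h1 h2
  rw [h1, h2, M.ι_eq]
  exact V.comp_zero hℓ _

theorem weak_form_V_iff (hℓ : 0 < B.ℓ) (s : ℝ) {g : ℝ → ℝ} {ξ : L2 0 B.T ℝ}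
    (hg : g =ᵐ[vol 0 B.T] ξ) (u : Sobolev (V B.ℓ) 1 0 B.T) (q : L2 0 B.T (L2 0 B.ℓ ℝ)) :
    (∀ v : V B.ℓ, ∀ᵐ t ∂vol 0 B.T,
      ∫ x in Ioo 0 B.ℓ, (B.ρ x * q t x * v.D 0 x + s * (B.μ x * (u.D 1 t).D 0 x * v.D 0 x)
        + B.r x * (u.D 0 t).D 2 x * v.D 2 x + s * (B.κ x * (u.D 1 t).D 2 x * v.D 2 x))
      = g t * tip v.1) ↔
    lift M.D.mass q + s • lift M.D.damp (vel u) + lift M.D.r (liftCurv (u.comp 0))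
      + s • lift M.D.κ (vel u) = lift (load B) ξ := by
  rw [← M.weak_form_iff s hg]
  have key : ∀ᵐ t ∂vol 0 B.T, ∀ v : V B.ℓ,
      ∫ x in Ioo 0 B.ℓ, (B.ρ x * q t x * v.D 0 x + s * (B.μ x * (u.D 1 t).D 0 x * v.D 0 x)
        + B.r x * (u.D 0 t).D 2 x * v.D 2 x + s * (B.κ x * (u.D 1 t).D 2 x * v.D 2 x))
      = ⟪M.D.mass (q t) + s • M.D.damp (vel u t) + M.D.r (liftCurv (u.comp 0) t)
        + s • M.D.κ (vel u t), curv v⟫_ℝ := by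
    filter_upwards [coeFn_liftCurv (u.comp 0), coeFn_liftCurv (u.comp 1)] with t h0 h1 v
    rw [vel, h0, h1]
    have e := M.integral_eq s (q t) ((u.D 1 t).1.comp 0) ((u.D 0 t).1.comp 2)
      ((u.D 1 t).1.comp 2) (curv v)
    have e2 : M.D.damp (curv (u.comp 1 t)) = M.D.ιadj (M.D.μ ((u.D 1 t).1.comp 0)) := by
      have := V.comp_zero hℓ (u.D 1 t)
      rw [this, ← M.ι_eq]; rfl
    rw [e2, ← M.ι_eq] at *
    rw [M.ι_eq, ← V.comp_zero hℓ v] at e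
    exact e
  constructor
  · intro h w
    filter_upwards [key, h (ofCurv w)] with t h1 h2
    have := h1 (ofCurv w)
    rw [curv_ofCurv] at this
    rw [← this, h2, tip_V hℓ, curv_ofCurv]
  · intro h v
    filter_upwards [key, h (curv v)] with t h1 h2
    rw [h1 v, h2, tip_V hℓ]

theorem isDirectSolution_iff [hℓ : Fact (0 < B.ℓ)] (hT : 0 < B.T) {g : ℝ → ℝ} {ξ : L2 0 B.T ℝ}
    (hg : g =ᵐ[vol 0 B.T] ξ) (u : Sobolev (V B.ℓ) 1 0 B.T) :
    B.IsDirectSolution g u ↔ ∃ q, u.comp 0 = prim true (u.comp 1) ∧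
      lift M.D.ι (vel u) = prim true q ∧ M.D.op true q (vel u) = lift (load B) ξ := by
  have e0 : HasValue 0 B.T (u.D 0) 0 0 ↔ u.comp 0 = prim true (u.comp 1) := by
    rw [← hasWeakDeriv_and_hasValue_left_zero_iff hT (ae_eq_refl (u.comp 0))]
    exact ⟨fun h => ⟨u.2 0, h⟩, fun h => h.2⟩
  refine exists_congr fun q => ?_
  rw [e0]
  have e1 := hasWeakDeriv_and_hasValue_left_zero_iff hT (f' := q) (M.toL2_ae hℓ.1 (u.comp 1))
  have e2 := M.weak_form_V_iff hℓ.1 1 hg u q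
  simp only [one_mul, one_smul] at e2
  rw [e2]
  have e3 : u.comp 0 = prim true (u.comp 1) →
      liftCurv (u.comp 0) = prim true (vel u) := fun h => by rw [h, vel, prim_liftCurv]
  constructor
  · rintro ⟨h1, h2, h3, h4⟩
    refine ⟨h3, e1.1 ⟨h1, h4⟩, ?_⟩
    rw [← h2, Evolution.op, e3 h3]
  · rintro ⟨h3, h1, h2⟩
    have h5 := e1.2 h1
    refine ⟨h5.1, ?_, h3, h5.2⟩
    rw [← h2, Evolution.op, e3 h3]

/-- With `p = -φ_t` one has `φ = prim false p` and `-φ_t = prim false φ_tt`, so the reversed signs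
of the damping terms disappear and the equation is `op false`. -/
theorem isNeumannAdjoint_iff [hℓ : Fact (0 < B.ℓ)] (hT : 0 < B.T) {g : ℝ → ℝ} {ξ : L2 0 B.T ℝ}
    (hg : g =ᵐ[vol 0 B.T] ξ) (u : Sobolev (V B.ℓ) 1 0 B.T) :
    B.IsNeumannAdjoint g u ↔ ∃ q, u.comp 0 = - prim false (u.comp 1) ∧
      lift M.D.ι (- vel u) = prim false q ∧ M.D.op false q (- vel u) = lift (load B) ξ := by
  have e0 : HasValue 0 B.T (u.D 0) B.T 0 ↔ u.comp 0 = - prim false (u.comp 1) := by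
    rw [← hasWeakDeriv_and_hasValue_right_zero_iff hT (ae_eq_refl (u.comp 0))]
    exact ⟨fun h => ⟨u.2 0, h⟩, fun h => h.2⟩
  refine exists_congr fun q => ?_
  rw [e0]
  have e1 := hasWeakDeriv_and_hasValue_right_zero_iff hT (f' := q) (M.toL2_ae hℓ.1 (u.comp 1))
  have e2 := M.weak_form_V_iff hℓ.1 (-1) hg u q
  simp only [neg_one_mul, ← sub_eq_add_neg, neg_one_smul] at e2
  rw [e2]
  have e3 : u.comp 0 = - prim false (u.comp 1) →
      liftCurv (u.comp 0) = - prim false (vel u) := fun h => by rw [h, vel, prim_liftCurv, map_neg]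
  have e4 : u.comp 0 = - prim false (u.comp 1) → M.D.op false q (- vel u) =
      lift M.D.mass q - lift M.D.damp (vel u) + lift M.D.r (liftCurv (u.comp 0))
        - lift M.D.κ (vel u) := fun h => by
    rw [e3 h, Evolution.op]
    simp only [map_neg]
    abel
  constructor
  · rintro ⟨h1, h2, h3, h4⟩
    refine ⟨h3, ?_, by rw [← h2, e4 h3]⟩
    rw [map_neg, neg_eq_iff_eq_neg]
    exact e1.1 ⟨h1, h4⟩
  · rintro ⟨h3, h1, h2⟩
    rw [map_neg, neg_eq_iff_eq_neg] at h1
    have h5 := e1.2 h1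
    refine ⟨h5.1, ?_, h3, h5.2⟩
    rw [← h2, e4 h3]

/-! ### Solution operators of the direct problem and of the first adjoint problem. -/

/-- An input with `g(0) = 0` equals `g(T)` minus the integral of its derivative from `t` to `T`,
which is the shape of load required by `exists_solution` forwards in time. -/
theorem exists_forward (g : L2 0 B.T ℝ) : ∃ q p, lift M.D.ι p = prim true q ∧
    M.D.op true q p = lift (load B) (prim true g) := by
  obtain ⟨q, p, h1, h2⟩ := M.D.exists_solution true 0 (load B (tot g)) (lift (load B) (-g))
  refine ⟨q, p, h1, ?_⟩
  rw [h2, map_zero, zero_add, prim_true_eq, map_sub, lift_cst, map_neg, map_neg, ← sub_eq_add_neg,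
    Bool.not_true, prim_lift]

theorem exists_forwardMap : ∃ S : L2 0 B.T ℝ →L[ℝ] L2 0 B.T (L2 0 B.ℓ ℝ), ∀ g, ∃ q,
    lift M.D.ι (S g) = prim true q ∧ M.D.op true q (S g) = lift (load B) (prim true g) :=
  M.D.exists_solutionMap true ((lift (load B)).comp (prim true)) M.exists_forward

/-- The velocity of the solution of the direct problem, as a function of the derivative of the
input. -/
def fwd : L2 0 B.T ℝ →L[ℝ] L2 0 B.T (L2 0 B.ℓ ℝ) := M.exists_forwardMap.choose

theorem fwd_spec (g : L2 0 B.T ℝ) : ∃ q, lift M.D.ι (M.fwd g) = prim true q ∧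
    M.D.op true q (M.fwd g) = lift (load B) (prim true g) := M.exists_forwardMap.choose_spec g

theorem vel_ofVel [Fact (0 < B.ℓ)] (p : L2 0 B.T (L2 0 B.ℓ ℝ)) : vel (ofVel p) = p :=
  liftCurv_liftOfCurv p

theorem isDirectSolution_iff_eq [hℓ : Fact (0 < B.ℓ)] (hT : 0 < B.T) {g : ℝ → ℝ}
    {g' : L2 0 B.T ℝ} (hg : g =ᵐ[vol 0 B.T] prim true g') (u : Sobolev (V B.ℓ) 1 0 B.T) :
    B.IsDirectSolution g u ↔ u = ofVel (M.fwd g') := by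
  rw [M.isDirectSolution_iff hT hg]
  obtain ⟨q', h1', h2'⟩ := M.fwd_spec g'
  constructor
  · rintro ⟨q, h0, h1, h2⟩
    have hv : vel u = M.fwd g' := M.D.unique true h1 h1' (h2.trans h2'.symm)
    have hc : u.comp 1 = liftOfCurv (M.fwd g') := by
      rw [← hv, vel, liftOfCurv_liftCurv hℓ.1]
    refine Sobolev.ext fun j => ?_
    fin_cases j
    · change u.comp 0 = prim true _
      rw [h0, hc]
    · exact hc
  · rintro rfl
    exact ⟨q', rfl, by rw [vel_ofVel, h1'], by rw [vel_ofVel, h2']⟩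

theorem sol_eq [hℓ : Fact (0 < B.ℓ)] (hT : 0 < B.T) {g : ℝ → ℝ}
    {g' : L2 0 B.T ℝ} (hg : g =ᵐ[vol 0 B.T] prim true g') : B.sol g = ofVel (M.fwd g') := by
  have h : ∃ u, B.IsDirectSolution g u := ⟨_, (M.isDirectSolution_iff_eq hT hg _).2 rfl⟩
  rw [Beam.sol, dif_pos h]
  exact (M.isDirectSolution_iff_eq hT hg _).1 h.choose_spec

/-- The output operator `Φ`, as a function of the derivative of the input. -/
def outTip : L2 0 B.T ℝ →L[ℝ] L2 0 B.T ℝ := (lift (tipL B)).comp ((prim true).comp M.fwd)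

theorem tip_ae (hℓ : 0 < B.ℓ) (p : L2 0 B.T (L2 0 B.ℓ ℝ)) :
    (fun t => tip ((liftOfCurv p) t).1) =ᵐ[vol 0 B.T] lift (tipL B) p := by
  filter_upwards [coeFn_lift (tipL B) p, coeFn_liftOfCurv p] with t h1 h2
  rw [h1, h2, tip_V hℓ, curv_ofCurv]
  rfl

theorem Φ_ae [hℓ : Fact (0 < B.ℓ)] (hT : 0 < B.T) {g : ℝ → ℝ}
    {g' : L2 0 B.T ℝ} (hg : g =ᵐ[vol 0 B.T] prim true g') :
    B.Φ g =ᵐ[vol 0 B.T] M.outTip g' := by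
  have h := tip_ae hℓ.1 (prim true (M.fwd g'))
  rw [← prim_liftOfCurv] at h
  refine Filter.EventuallyEq.trans (Filter.EventuallyEq.of_eq ?_) h
  funext t
  rw [Beam.Φ, M.sol_eq hT hg]
  rfl

/-- Backwards in time the load must be a constant plus an integral from `0`, which covers every
function in `H¹(0, T)`, with no condition at `T`. -/
theorem exists_backward_tip (ξ' : L2 0 B.T ℝ) (c : ℝ) : ∃ q p, lift M.D.ι p = prim false q ∧
    M.D.op false q p = lift (load B) (cst c + prim true ξ') := by
  obtain ⟨q, p, h1, h2⟩ := M.D.exists_solution false 0 (load B c) (lift (load B) ξ')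
  refine ⟨q, p, h1, ?_⟩
  rw [h2, map_zero, zero_add, map_add, lift_cst, Bool.not_false, prim_lift]

theorem vel_ofVelBack [Fact (0 < B.ℓ)] (p : L2 0 B.T (L2 0 B.ℓ ℝ)) : vel (ofVelBack p) = -p := by
  change liftCurv (- liftOfCurv p) = _
  rw [map_neg, liftCurv_liftOfCurv]

theorem isNeumannAdjoint_iff_eq [hℓ : Fact (0 < B.ℓ)] (hT : 0 < B.T) {g : ℝ → ℝ}
    {ξ : L2 0 B.T ℝ} (hg : g =ᵐ[vol 0 B.T] ξ) {q p : L2 0 B.T (L2 0 B.ℓ ℝ)}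
    (h1' : lift M.D.ι p = prim false q) (h2' : M.D.op false q p = lift (load B) ξ)
    (u : Sobolev (V B.ℓ) 1 0 B.T) : B.IsNeumannAdjoint g u ↔ u = ofVelBack p := by
  rw [M.isNeumannAdjoint_iff hT hg]
  constructor
  · rintro ⟨q, h0, h1, h2⟩
    have hv : - vel u = p := M.D.unique false h1 h1' (h2.trans h2'.symm)
    have hc : u.comp 1 = - liftOfCurv p := by
      rw [← hv, vel, map_neg, neg_neg, liftOfCurv_liftCurv hℓ.1]
    refine Sobolev.ext fun j => ?_
    fin_cases j
    · change u.comp 0 = prim false _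
      rw [h0, hc, map_neg, neg_neg]
    · exact hc
  · rintro rfl
    refine ⟨q, ?_, by rw [vel_ofVelBack, neg_neg, h1'], by rw [vel_ofVelBack, neg_neg, h2']⟩
    change prim false _ = - prim false (- liftOfCurv p)
    rw [map_neg, neg_neg]

theorem left_comp {m : ℕ} {T : ℝ} (hT : 0 < T) (g : SobolevLeft m 0 T) (j : Fin m) :
    g.1.comp j.castSucc = prim true (g.1.comp j.succ) :=
  (hasWeakDeriv_and_hasValue_left_zero_iff hT (ae_eq_refl _)).1 ⟨g.1.2 j, g.2 j⟩

/-! ### The gradient of the tip deflection functional. -/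

theorem firstFunctional {B : Beam} (M : Model B) [hℓ : Fact (0 < B.ℓ)] (hT : 0 < B.T) :
    (∀ g : SobolevLeft 1 0 B.T,
        (∃! u, B.IsDirectSolution (g.D 0) u) ∧ MemLp (B.Φ (g.D 0)) 2 (vol 0 B.T)) ∧
      ∀ (ν : Sobolev ℝ 1 0 B.T) (g : SobolevLeft 1 0 B.T),
        ∃ φ : Sobolev (V B.ℓ) 1 0 B.T,
          (∀ φ' : Sobolev (V B.ℓ) 1 0 B.T,
            B.IsNeumannAdjoint (fun t => B.Φ (g.D 0) t - ν.D 0 t) φ' ↔ φ' = φ) ∧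
          B.HasGradient (B.J₁ (ν.D 0)) g (fun t => tip (φ.D 0 t).1) := by
  have hg : ∀ g : SobolevLeft 1 0 B.T, g.D 0 =ᵐ[vol 0 B.T] prim true (g.1.comp 1) := fun g =>
    Filter.EventuallyEq.of_eq
      (congrArg (fun f : L2 0 B.T ℝ => (f : ℝ → ℝ)) (left_comp hT g 0))
  refine ⟨fun g => ⟨⟨_, (M.isDirectSolution_iff_eq hT (hg g) _).2 rfl, fun u hu =>
    (M.isDirectSolution_iff_eq hT (hg g) _).1 hu⟩,
    (memLp_congr_ae (M.Φ_ae hT (hg g))).2 (Lp.memLp _)⟩, fun ν g => ?_⟩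
  obtain ⟨c, hc⟩ := (hasWeakDeriv_iff hT).1 (ν.2 0)
  change ν.comp 0 = cst c + prim true (ν.comp 1) at hc
  set ξ := M.outTip (g.1.comp 1) - ν.comp 0 with hξ
  -- The residual is in `H¹(0, T)`: the tip deflection is the time integral of the tip velocity, and
  -- `ν` is in `H¹` by assumption.
  have hξ' : ξ = cst (-c) + prim true (lift (tipL B) (M.fwd (g.1.comp 1)) - ν.comp 1) := by
    rw [hξ, hc, outTip]
    simp only [ContinuousLinearMap.comp_apply, map_sub, map_neg, prim_lift]
    abel
  have hae : ∀ g : SobolevLeft 1 0 B.T, (fun t => B.Φ (g.D 0) t - ν.D 0 t) =ᵐ[vol 0 B.T]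
      (M.outTip (g.1.comp 1) - ν.comp 0 : L2 0 B.T ℝ) := fun g => by
    filter_upwards [M.Φ_ae hT (hg g), Lp.coeFn_sub (M.outTip (g.1.comp 1)) (ν.comp 0)] with t h1 h2
    rw [h1, h2]; rfl
  obtain ⟨q', p', h1', h2'⟩ := M.exists_backward_tip
    (lift (tipL B) (M.fwd (g.1.comp 1)) - ν.comp 1) (-c)
  rw [← hξ'] at h2'
  refine ⟨ofVelBack p', M.isNeumannAdjoint_iff_eq hT (hae g) h1' h2', ?_⟩
  refine B.hasGradient_of_norm_sq
    (M.outTip.comp ((compL 1).comp (leftSubmodule 1 0 B.T).subtypeL)) (ν.comp 0) (fun k => ?_) g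
    (lift (tipL B) (prim false p')) ?_ (fun k => ?_)
  · rw [Beam.J₁, ← norm_sq_eq_integral (hae k)]; rfl
  · have h := tip_ae hℓ.1 (prim false p')
    rwa [← prim_liftOfCurv] at h
  · change ⟪ξ, M.outTip (k.1.comp 1)⟫_ℝ = _
    obtain ⟨q, h1, h2⟩ := M.fwd_spec (k.1.comp 1)
    have hk : k.1.comp 0 = prim true (k.1.comp 1) := left_comp hT k 0
    rw [hk, outTip, ContinuousLinearMap.comp_apply, ContinuousLinearMap.comp_apply,
      ← inner_load, ← h2', real_inner_comm, real_inner_comm (prim true (k.1.comp 1)),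
      ← inner_load, ← h2]
    exact (M.D.duality true h1 h1').symm

end Model

/-! ### The traces of the second derivatives at the clamped end -/

/-- The solution of `Y' + N Y = m`, `Y(0) = 0` in a commutative Banach algebra. -/
theorem exists_hasDerivAt_linear {A : Type*} [NormedCommRing A] [NormedAlgebra ℝ A]
    [CompleteSpace A] (N : A) {m : ℝ → A} (hm : Continuous m) :
    ∃ Y : ℝ → A, Y 0 = 0 ∧ ∀ t, HasDerivAt Y (m t - N * Y t) t := by
  let _ : NormedAlgebra ℚ A := NormedAlgebra.restrictScalars ℚ ℝ A
  have he : ∀ M : A, ∀ t : ℝ, HasDerivAt (fun s : ℝ => NormedSpace.exp (s • M))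
      (NormedSpace.exp (t • M) * M) t := fun M t => hasDerivAt_exp_smul_const M t
  have hc : Continuous fun s : ℝ => NormedSpace.exp (s • N) * m s :=
    (continuous_iff_continuousAt.2 fun t => (he N t).continuousAt).mul hm
  refine ⟨fun t => NormedSpace.exp (t • (-N)) * ∫ s in (0 : ℝ)..t, NormedSpace.exp (s • N) * m s,
    by simp, fun t => ?_⟩
  have h1 := (he (-N) t).mul (hc.integral_hasStrictDerivAt 0 t).hasDerivAt
  have h2 : NormedSpace.exp (t • (-N)) * NormedSpace.exp (t • N) = 1 := by
    rw [← NormedSpace.exp_add, smul_neg, neg_add_cancel, NormedSpace.exp_zero]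
  refine h1.congr_deriv ?_
  rw [← mul_assoc, h2, one_mul]
  ring

theorem exists_boundedContinuous_eqOn {a b : ℝ} (hab : a ≤ b) {f : ℝ → ℝ}
    (hf : ContinuousOn f (Icc a b)) : ∃ F : ℝ →ᵇ ℝ, EqOn F f (Icc a b) := by
  obtain ⟨C, hC⟩ := isCompact_Icc.exists_bound_of_continuousOn hf
  refine ⟨BoundedContinuousFunction.ofNormedAddCommGroup (fun x => f (projIcc a b hab x))
    ((hf.domRestrict).comp continuous_projIcc) C fun x => hC _ (projIcc a b hab x).2, fun x hx => ?_⟩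
  change f (projIcc a b hab x) = f x
  rw [projIcc_of_mem hab hx]

/-- The continuous representative of the primitive that vanishes at `b`. -/
def primEnd (a b : ℝ) : L2 a b ℝ →L[ℝ] (ℝ →ᵇ ℝ) :=
  (ContinuousLinearMap.toSpanSingleton ℝ (1 : ℝ →ᵇ ℝ)).comp tot - primC

theorem primEnd_apply {a b : ℝ} (f : L2 a b ℝ) (x : ℝ) :
    primEnd a b f x = tot f - primFun a b f x := by
  simp [primEnd]

theorem prim_true_eq_of_hasDerivAt {E : Type*} [NormedAddCommGroup E] [InnerProductSpace ℝ E]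
    [CompleteSpace E] {T : ℝ} {Y Y' : ℝ → E} (hY : ∀ t, HasDerivAt Y (Y' t) t)
    (hY' : Continuous Y') (hY0 : Y 0 = 0) {W : L2 0 T E} (hW : W =ᵐ[vol 0 T] Y') :
    prim true W =ᵐ[vol 0 T] Y := by
  filter_upwards [coeFn_prim_true W, ae_restrict_mem measurableSet_Ioo] with t h1 ht
  rw [h1, primFun_congr hW, primFun, vol, Measure.restrict_restrict measurableSet_Iic]
  have : Iic t ∩ Ioo 0 T = Ioc 0 t := by
    ext s
    simp only [mem_inter_iff, mem_Iic, mem_Ioo, mem_Ioc]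
    exact ⟨fun h => ⟨h.2.1, h.1⟩, fun h => ⟨h.2, h.1, h.2.trans_lt ht.2⟩⟩
  rw [this, ← intervalIntegral.integral_of_le ht.1.le,
    intervalIntegral.integral_eq_sub_of_hasDerivAt (fun s _ => hY s)
      (hY'.intervalIntegrable _ _), hY0, sub_zero]

theorem exists_toLp_of_continuous {E : Type*} [NormedAddCommGroup E]
    [SecondCountableTopology E] (a b : ℝ) {F : ℝ → E} (hF : Continuous F) :
    ∃ f : L2 a b E, f =ᵐ[vol a b] F := by
  obtain ⟨C, hC⟩ := isCompact_Icc.exists_bound_of_continuousOn (hF.continuousOn (s := Icc a b))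
  have h : MemLp F 2 (vol a b) := MemLp.of_bound hF.aestronglyMeasurable C
    ((ae_restrict_iff' measurableSet_Ioo).2
      (Filter.Eventually.of_forall fun x hx => hC x (Ioo_subset_Icc_self hx)))
  exact ⟨h.toLp F, h.coeFn_toLp⟩

namespace Model

variable {B : Beam} (M : Model B)

/-- For each `x` the equation `κ U' + r U = Z` is an ordinary differential equation in time. If `Z`
is continuous in time with values in the continuous functions of `x`, it can be solved in that
Banach algebra, and uniqueness in `L²` shows that this solution is `U`. -/
theorem exists_trace (hB : B.Basic) {U P z₁ : L2 0 B.T (L2 0 B.ℓ ℝ)} (hU : U = prim true P)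
    (h : lift M.D.r U + lift M.D.κ P = lift (prim false) (prim true z₁)) :
    ∀ᵐ t ∂vol 0 B.T, ∃ c d, HasValue 0 B.ℓ (U t) 0 c ∧ HasValue 0 B.ℓ (P t) 0 d ∧
      B.r 0 * c + B.κ 0 * d = tot (prim true z₁ t) := by
  have hℓ := hB.length_pos
  obtain ⟨κ₀, _, hκ₀, hκ⟩ := hB.bound_κ
  have hκ0 : ∀ x ∈ Icc 0 B.ℓ, B.κ x ≠ 0 := fun x hx => (hκ₀.trans_le (hκ x hx).1).ne'
  obtain ⟨N, hN⟩ := exists_boundedContinuous_eqOn hℓ.le (hB.cont_r.div hB.cont_κ hκ0)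
  obtain ⟨K, hK⟩ := exists_boundedContinuous_eqOn hℓ.le (hB.cont_κ.inv₀ hκ0)
  -- Here the hypothesis that the bending moment is a time integral of `z₁`, integrated once in `x`,
  -- is used: one integration gives continuity in `t`, the other in `x`.
  let Z : ℝ → (ℝ →ᵇ ℝ) := fun t => primEnd 0 B.ℓ (primFun 0 B.T z₁ t)
  have hZ : Continuous Z := (primEnd 0 B.ℓ).continuous.comp (continuous_primFun z₁.integrable)
  obtain ⟨Y, hY0, hY⟩ := exists_hasDerivAt_linear N (m := fun t => K * Z t)
    (continuous_const.mul hZ)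
  have hYc : Continuous Y := continuous_iff_continuousAt.2 fun t => (hY t).continuousAt
  let e : (ℝ →ᵇ ℝ) →L[ℝ] L2 0 B.ℓ ℝ := BoundedContinuousFunction.toLp 2 (vol 0 B.ℓ) ℝ
  have he : ∀ f, e f =ᵐ[vol 0 B.ℓ] f := fun f => BoundedContinuousFunction.coeFn_toLp 2 _ ℝ f
  let Y' : ℝ → (ℝ →ᵇ ℝ) := fun t => K * Z t - N * Y t
  have hY'c : Continuous Y' := (continuous_const.mul hZ).sub (continuous_const.mul hYc)
  have heY' : Continuous fun t => e (Y' t) := e.continuous.comp hY'c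
  obtain ⟨W, hW⟩ := exists_toLp_of_continuous 0 B.T heY'
  have hJW : prim true W =ᵐ[vol 0 B.T] fun t => e (Y t) :=
    prim_true_eq_of_hasDerivAt (fun t => e.hasFDerivAt.comp_hasDerivAt t (hY t)) heY'
      (by rw [Function.comp_apply, hY0, map_zero]) hW
  have key : ∀ t, M.D.r (e (Y t)) + M.D.κ (e (Y' t)) = prim false (primFun 0 B.T z₁ t) := by
    intro t
    ext1
    filter_upwards [Lp.coeFn_add (M.D.r (e (Y t))) (M.D.κ (e (Y' t))), M.r_spec (e (Y t)),
      M.κ_spec (e (Y' t)), he (Y t), he (Y' t), coeFn_prim_false (primFun 0 B.T z₁ t),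
      ae_restrict_mem measurableSet_Ioo] with x h1 h2 h3 h4 h5 h6 hx
    have hx' := Ioo_subset_Icc_self hx
    rw [h1, Pi.add_apply, h2, h3, h4, h5, h6, ← primEnd_apply]
    change _ + B.κ x * (K x * Z t x - N x * Y t x) = Z t x
    rw [hK hx', hN hx']
    have := hκ0 x hx'
    simp only [Pi.inv_apply, Pi.div_apply]
    field_simp
    ring
  have hW' : lift M.D.r (prim true W) + lift M.D.κ W = lift (prim false) (prim true z₁) := by
    ext1
    filter_upwards [Lp.coeFn_add (lift M.D.r (prim true W)) (lift M.D.κ W),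
      coeFn_lift M.D.r (prim true W), coeFn_lift M.D.κ W, hJW, hW,
      coeFn_lift (prim false) (prim true z₁), coeFn_prim_true z₁] with t h1 h2 h3 h4 h5 h6 h7
    rw [h1, Pi.add_apply, h2, h3, h4, h5, h6, h7]
    exact key t
  -- Energy argument: pairing the difference of the equations with `P - W` leaves the `κ` term and a
  -- nonnegative `r` term.
  have hPW : P = W := by
    rw [← hW', hU] at h
    have h0 : lift M.D.r (prim true (P - W)) + lift M.D.κ (P - W) = 0 := by
      simp only [map_sub]
      rw [sub_add_sub_comm, h, sub_self]
    have h1 := congrArg (fun f => ⟪f, P - W⟫_ℝ) h0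
    simp only [inner_add_left, inner_zero_left] at h1
    have h2 := inner_lift_self_ge M.D.κ_ge (P - W)
    have h3 := inner_lift_prim_self true M.D.r_symm (P - W)
    rw [inner_lift_symm M.D.r_symm, real_inner_comm] at h3
    have h4 := M.D.r_nonneg (tot (P - W))
    have h5 := M.D.κ₀_pos
    have h6 : ‖P - W‖ ^ 2 ≤ 0 := by
      by_contra hc
      push Not at hc
      have := mul_pos h5 hc
      linarith
    exact sub_eq_zero.1 (norm_eq_zero.1 (pow_eq_zero_iff two_ne_zero |>.1
      (le_antisymm h6 (sq_nonneg _))))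
  subst hPW hU
  filter_upwards [hJW, hW, coeFn_prim_true z₁] with t h1 h2 h3
  rw [h1, h2, h3]
  refine ⟨Y t 0, Y' t 0, ⟨Y t, (Y t).continuous.continuousOn, (he _).symm, rfl⟩,
    ⟨Y' t, (Y' t).continuous.continuousOn, (he _).symm, rfl⟩, ?_⟩
  have h0 : (0 : ℝ) ∈ Icc 0 B.ℓ := left_mem_Icc.2 hℓ.le
  have hZ0 : Z t 0 = tot (primFun 0 B.T z₁ t) := by
    change primEnd 0 B.ℓ (primFun 0 B.T z₁ t) 0 = _
    rw [primEnd_apply, primFun_left, sub_zero]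
  rw [← hZ0]
  change _ + B.κ 0 * (K 0 * Z t 0 - N 0 * Y t 0) = _
  rw [hK h0, hN h0]
  have := hκ0 0 h0
  simp only [Pi.inv_apply, Pi.div_apply]
  field_simp
  ring

end Model

/-! ### The transposed problem -/

/-- The inner product with a fixed vector, for functions of time. -/
def pair {E : Type*} [NormedAddCommGroup E] [InnerProductSpace ℝ E] {a b : ℝ} (y : E) :
    L2 a b E →L[ℝ] L2 a b ℝ := lift (innerSL ℝ y)

theorem coeFn_pair {E : Type*} [NormedAddCommGroup E] [InnerProductSpace ℝ E] {a b : ℝ} (y : E)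
    (f : L2 a b E) : pair y f =ᵐ[vol a b] fun t => ⟪y, f t⟫_ℝ := coeFn_lift (innerSL ℝ y) f

namespace Evolution

variable {V H : Type*} [NormedAddCommGroup V] [InnerProductSpace ℝ V] [CompleteSpace V]
  [NormedAddCommGroup H] [InnerProductSpace ℝ H] [CompleteSpace H]
variable (D : Evolution V H) {a b : ℝ}

/-- `tot q` is the velocity at the far end of the time interval, controlled by the kinetic part of
the energy. The constant is not sharp: `s ≤ (1 + s) ^ 2` replaces a square root. -/
theorem norm_tot_le_of_op (d : Bool) {q : L2 a b H} {p : L2 a b V} (h : lift D.ι p = prim d q) :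
    ‖tot q‖ ≤ (1 + 2 / (D.ρ₀ * D.κ₀)) * ‖D.op d q p‖ := by
  have h1 := D.energy_le d h
  have h2 := D.ρ_ge (tot q)
  have h3 := real_inner_le_norm (D.op d q p) p
  have h4 := D.norm_le_of_op d h
  have hρ := D.ρ₀_pos
  have hκ := D.κ₀_pos
  set n := ‖D.op d q p‖ with hn
  have hn0 : 0 ≤ n := norm_nonneg _
  have h5 : D.ρ₀ * ‖tot q‖ ^ 2 ≤ 2 * (n * ‖p‖) := by nlinarith [sq_nonneg ‖p‖]
  have h6 : D.ρ₀ * D.κ₀ * ‖tot q‖ ^ 2 ≤ 2 * n ^ 2 := by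
    have := mul_le_mul_of_nonneg_left h5 hκ.le
    have := mul_le_mul_of_nonneg_left h4 hn0
    nlinarith
  have h7 : ‖tot q‖ ^ 2 ≤ 2 / (D.ρ₀ * D.κ₀) * n ^ 2 := by
    rw [div_mul_eq_mul_div, le_div_iff₀ (mul_pos hρ hκ)]
    linarith
  have h8 : 0 ≤ 2 / (D.ρ₀ * D.κ₀) := by positivity
  refine abs_le_of_sq_le_sq' ?_ (by positivity) |>.2
  rw [mul_pow]
  refine h7.trans (mul_le_mul_of_nonneg_right ?_ (sq_nonneg n))
  nlinarith [sq_nonneg (2 / (D.ρ₀ * D.κ₀))]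

/-- It suffices to bound the functional of `(q, p)` by `‖op true q p‖` and apply Riesz. The energy
estimate bounds `p` and `tot q` but not `q`, so one time derivative is moved onto `θ`; here `c` is
the value of `θ` at the final time. -/
theorem exists_transposed (y m : H) (c : ℝ) (θ θ' : L2 a b ℝ) (hθ : θ = cst c - prim false θ') :
    ∃ ψ : L2 a b V, ∀ (q : L2 a b H) (p : L2 a b V), lift D.ι p = prim true q →
      ⟪ψ, D.op true q p⟫_ℝ + ⟪θ, pair y q + pair m (lift D.ι p)⟫_ℝ = 0 := by
  let W : Submodule ℝ (L2 a b H × L2 a b V) :=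
    ((lift D.ι).comp (ContinuousLinearMap.snd ℝ _ _)
      - (prim true).comp (ContinuousLinearMap.fst ℝ _ _)).ker
  have hW : ∀ w : W, lift D.ι w.1.2 = prim true w.1.1 := fun w => sub_eq_zero.1 w.2
  let A : W →ₗ[ℝ] L2 a b V :=
    { toFun := fun w => D.op true w.1.1 w.1.2
      map_add' := fun w w' => D.op_add true _ _ _ _
      map_smul' := fun s w => D.op_smul true s _ _ }
  let L : W →ₗ[ℝ] ℝ :=
    { toFun := fun w => -⟪θ, pair y w.1.1 + pair m (lift D.ι w.1.2)⟫_ℝ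
      map_add' := fun w w' => by
        simp only [Submodule.coe_add, Prod.fst_add, Prod.snd_add, map_add, inner_add_right]
        ring
      map_smul' := fun s w => by
        simp only [Submodule.coe_smul, Prod.smul_fst, Prod.smul_snd, map_smul, inner_add_right,
          inner_smul_right, RingHom.id_apply, smul_eq_mul]
        ring }
  set C₁ := |c| * ‖y‖
  set Y : L2 a b V →L[ℝ] L2 a b ℝ := (pair y).comp (lift D.ι)
  set Z : L2 a b V →L[ℝ] L2 a b ℝ := (pair m).comp (lift D.ι)
  obtain ⟨ψ, hψ⟩ := exists_inner_eq_of_abs_le A L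
    (C₁ * (1 + 2 / (D.ρ₀ * D.κ₀)) + (‖θ'‖ * ‖Y‖ + ‖θ‖ * ‖Z‖) / D.κ₀) (fun w => by
      obtain ⟨⟨q, p⟩, hw⟩ := w
      have h : lift D.ι p = prim true q := hW ⟨⟨q, p⟩, hw⟩
      change |-⟪θ, pair y q + pair m (lift D.ι p)⟫_ℝ| ≤ _ * ‖D.op true q p‖
      -- The constant part of `θ` meets `tot q`, the rest meets `prim true q = ι p`.
      have e1 : ⟪θ, pair y q⟫_ℝ = c * ⟪y, tot q⟫_ℝ - ⟪θ', Y p⟫_ℝ := by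
        have : prim true (pair y q) = Y p := by
          change prim true (lift (innerSL ℝ y) q) = _
          rw [prim_lift, ← h]; rfl
        rw [← this, hθ, inner_sub_left, inner_cst, inner_prim_right, Bool.not_true, pair, tot_lift]
        simp [mul_comm]
      have b1 : |c * ⟪y, tot q⟫_ℝ| ≤ C₁ * ((1 + 2 / (D.ρ₀ * D.κ₀)) * ‖D.op true q p‖) := by
        rw [abs_mul, mul_assoc]
        refine mul_le_mul_of_nonneg_left ?_ (abs_nonneg c)
        exact (abs_real_inner_le_norm _ _).trans
          (mul_le_mul_of_nonneg_left (D.norm_tot_le_of_op true h) (norm_nonneg y))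
      have bp : ‖p‖ ≤ ‖D.op true q p‖ / D.κ₀ := by
        rw [le_div_iff₀ D.κ₀_pos, mul_comm]; exact D.norm_le_of_op true h
      have b2 : |⟪θ', Y p⟫_ℝ| ≤ ‖θ'‖ * ‖Y‖ * (‖D.op true q p‖ / D.κ₀) := by
        rw [mul_assoc]
        exact (abs_real_inner_le_norm _ _).trans (mul_le_mul_of_nonneg_left
          ((Y.le_opNorm p).trans (mul_le_mul_of_nonneg_left bp (norm_nonneg _))) (norm_nonneg _))
      have b3 : |⟪θ, Z p⟫_ℝ| ≤ ‖θ‖ * ‖Z‖ * (‖D.op true q p‖ / D.κ₀) := by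
        rw [mul_assoc]
        exact (abs_real_inner_le_norm _ _).trans (mul_le_mul_of_nonneg_left
          ((Z.le_opNorm p).trans (mul_le_mul_of_nonneg_left bp (norm_nonneg _))) (norm_nonneg _))
      have e2 : ⟪θ, pair m (lift D.ι p)⟫_ℝ = ⟪θ, Z p⟫_ℝ := rfl
      have e3 : (C₁ * (1 + 2 / (D.ρ₀ * D.κ₀)) + (‖θ'‖ * ‖Y‖ + ‖θ‖ * ‖Z‖) / D.κ₀)
          * ‖D.op true q p‖ = C₁ * ((1 + 2 / (D.ρ₀ * D.κ₀)) * ‖D.op true q p‖)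
            + ‖θ'‖ * ‖Y‖ * (‖D.op true q p‖ / D.κ₀) + ‖θ‖ * ‖Z‖ * (‖D.op true q p‖ / D.κ₀) := by
        ring
      rw [abs_neg, inner_add_right, e1, e2, e3]
      exact (abs_add_le _ _).trans (add_le_add ((abs_sub _ _).trans (add_le_add b1 b2)) b3))
  refine ⟨ψ, fun q p h => ?_⟩
  have := hψ ⟨⟨q, p⟩, sub_eq_zero.2 h⟩
  change ⟪ψ, D.op true q p⟫_ℝ = -_ at this
  rw [this, neg_add_cancel]

/-- The values of `op true` include `ιadj f` for every `f` in `L²(a, b; H)`. The choice `f = ι (ψ -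
ψ')` makes `ι (ψ - ψ')` orthogonal to itself, and `ι` is injective. -/
theorem transposed_unique {ψ ψ' : L2 a b V}
    (h : ∀ (q : L2 a b H) (p : L2 a b V), lift D.ι p = prim true q →
      ⟪ψ, D.op true q p⟫_ℝ = ⟪ψ', D.op true q p⟫_ℝ) : ψ = ψ' := by
  refine sub_eq_zero.1 (lift_injective D.ι_injective (inner_self_eq_zero (𝕜 := ℝ) |>.1 ?_))
  obtain ⟨q, p, h1, h2⟩ := D.exists_solution true (lift D.ι (ψ - ψ')) 0 0
  rw [map_zero, map_zero, add_zero, add_zero] at h2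
  have h3 := h q p h1
  rw [← sub_eq_zero, ← inner_sub_left, h2, real_inner_comm, D.inner_ιadj] at h3
  exact h3

end Evolution

/-! ### The reaction at the clamped end -/

namespace Model

variable {B : Beam} (M : Model B)

/-- The function `x`. -/
def arm (B : Beam) : L2 0 B.ℓ ℝ := prim true (cst 1)

/-- The moment at `x = 0` of the inertial and damping forces. -/
def moment (q p : L2 0 B.T (L2 0 B.ℓ ℝ)) : L2 0 B.T ℝ :=
  pair (M.D.ρ (arm B)) q + pair (M.D.μ (arm B)) (lift M.D.ι p)

/-- The adjoint of integrating twice from the left end is integrating twice from the right end. This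
makes it possible to read the weak form as a formula for the bending moment. -/
theorem ιadj_eq : M.D.ιadj = (prim false).comp (prim false) := by
  ext1 f
  refine ext_inner_right ℝ fun w => ?_
  rw [Evolution.ιadj, ContinuousLinearMap.adjoint_inner_left, M.ι_eq, dbl,
    ContinuousLinearMap.comp_apply, ContinuousLinearMap.comp_apply, inner_prim_right,
    inner_prim_right]
  rfl

theorem load_eq : load B = (prim false).comp cst := by
  ext1
  simp [load, tipFun]

theorem tot_prim_false (f : L2 0 B.ℓ ℝ) : tot (prim false f) = ⟪arm B, f⟫_ℝ := by
  have h := inner_cst (1 : ℝ) (prim false f)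
  rw [inner_prim_right] at h
  simpa [arm] using h.symm

/-- The coefficients do not depend on time, so integrating the input in time integrates the
solution. -/
theorem fwd_prim (g : L2 0 B.T ℝ) : M.fwd (prim true g) = prim true (M.fwd g) := by
  obtain ⟨q, h1, h2⟩ := M.fwd_spec g
  obtain ⟨q', h1', h2'⟩ := M.fwd_spec (prim true g)
  refine M.D.unique true (q' := prim true q) h1' (by rw [← prim_lift, h1]) ?_
  rw [h2', M.D.op_prim true true q _ rfl, h2, prim_lift]

/-- For an input with one more derivative, the acceleration is itself the velocity for the
differentiated input, hence lies in the range of `ι`. -/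
theorem fwd_prim_spec (g : L2 0 B.T ℝ) :
    lift M.D.ι (M.fwd (prim true g)) = prim true (lift M.D.ι (M.fwd g)) ∧
    M.D.op true (lift M.D.ι (M.fwd g)) (M.fwd (prim true g))
      = lift (load B) (prim true (prim true g)) := by
  obtain ⟨q', h1', h2'⟩ := M.fwd_spec (prim true g)
  have h : lift M.D.ι (M.fwd (prim true g)) = prim true (lift M.D.ι (M.fwd g)) := by
    rw [fwd_prim, prim_lift]
  have hq : q' = lift M.D.ι (M.fwd g) := prim_true_injective (h1'.symm.trans h)
  exact ⟨h, hq ▸ h2'⟩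

/-- The output operator `Ψ`, as a function of the second derivative of the input. -/
def outMoment : L2 0 B.T ℝ →L[ℝ] L2 0 B.T ℝ :=
  (pair (M.D.ρ (arm B))).comp ((lift M.D.ι).comp M.fwd)
    + (pair (M.D.μ (arm B))).comp ((lift M.D.ι).comp (M.fwd.comp (prim true)))
    - B.ℓ • (prim true).comp (prim true)

theorem outMoment_apply (g : L2 0 B.T ℝ) : M.outMoment g =
    M.moment (lift M.D.ι (M.fwd g)) (M.fwd (prim true g)) - B.ℓ • prim true (prim true g) := rfl

theorem moment_prim (q p : L2 0 B.T (L2 0 B.ℓ ℝ)) (d : Bool) :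
    M.moment (prim d q) (prim d p) = prim d (M.moment q p) := by
  simp only [moment, pair, map_add, prim_lift]

/-- Integration in space, from the right end. -/
abbrev primX (B : Beam) : L2 0 B.ℓ ℝ →L[ℝ] L2 0 B.ℓ ℝ := prim false

theorem ofVel_D_zero [Fact (0 < B.ℓ)] (p : L2 0 B.T (L2 0 B.ℓ ℝ)) :
    (ofVel p).D 0 =ᵐ[vol 0 B.T] fun t => ofCurv (prim true p t) := by
  have h : (ofVel p).comp 0 = liftOfCurv (prim true p) := prim_liftOfCurv true p
  rw [Sobolev.D, h]
  exact coeFn_liftOfCurv _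

theorem ofVel_D_one [Fact (0 < B.ℓ)] (p : L2 0 B.T (L2 0 B.ℓ ℝ)) :
    (ofVel p).D 1 =ᵐ[vol 0 B.T] fun t => ofCurv (p t) := coeFn_liftOfCurv p

theorem ofCurv_D_two {ℓ : ℝ} (w : L2 0 ℓ ℝ) : (ofCurv w).D 2 = w := rfl

/-- The balance of moments about the clamped end: the tip force has arm `ℓ`, the distributed forces
have arm `x`. -/
theorem lift_tot_bending {q p : L2 0 B.T (L2 0 B.ℓ ℝ)} {g : L2 0 B.T ℝ} (hℓ : 0 < B.ℓ) :
    lift tot (lift cst g - lift (primX B) (lift M.D.ρ q + lift M.D.μ (lift M.D.ι p)))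
      = B.ℓ • g - M.moment q p := by
  have e1 : (tot : L2 0 B.ℓ ℝ →L[ℝ] ℝ).comp cst = B.ℓ • ContinuousLinearMap.id ℝ ℝ := by
    ext
    simp [tot_cst hℓ.le]
  have e2 : ∀ S : L2 0 B.ℓ ℝ →L[ℝ] L2 0 B.ℓ ℝ, (∀ x y, ⟪S x, y⟫_ℝ = ⟪x, S y⟫_ℝ) →
      (tot : L2 0 B.ℓ ℝ →L[ℝ] ℝ).comp ((primX B).comp S) = innerSL ℝ (S (arm B)) := fun S hS => by
    ext1 f
    rw [ContinuousLinearMap.comp_apply, ContinuousLinearMap.comp_apply, tot_prim_false,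
      innerSL_apply_apply, hS]
  have e3 : ∀ (S : L2 0 B.ℓ ℝ →L[ℝ] L2 0 B.ℓ ℝ) (f : L2 0 B.T (L2 0 B.ℓ ℝ)),
      lift tot (lift (primX B) (lift S f))
        = lift ((tot : L2 0 B.ℓ ℝ →L[ℝ] ℝ).comp ((primX B).comp S)) f := fun S f => by
    rw [lift_comp tot (primX B), lift_comp]
    rfl
  rw [map_sub, map_add, map_add, e3, e3, lift_comp, e1, e2 _ M.D.ρ_symm, e2 _ M.D.μ_symm,
    lift_smul, lift_id]
  rfl

/-- `load` is one integration of a constant and `ιadj` two integrations, all from the free end. The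
inner bracket is, up to sign, the shear force. -/
theorem bending_eq {q p : L2 0 B.T (L2 0 B.ℓ ℝ)} {g : L2 0 B.T ℝ}
    (h : M.D.op true q p = lift (load B) g) :
    lift M.D.r (prim true p) + lift M.D.κ p = lift (primX B)
      (lift cst g - lift (primX B) (lift M.D.ρ q + lift M.D.μ (lift M.D.ι p))) := by
  have h1 : lift (primX B) (lift cst g) = lift (load B) g := by rw [lift_comp, load_eq]
  have h2 : lift (primX B) (lift (primX B) (lift M.D.ρ q + lift M.D.μ (lift M.D.ι p)))
      = lift M.D.mass q + lift M.D.damp p := by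
    rw [lift_comp, ← M.ιadj_eq, map_add, lift_comp, lift_comp, lift_comp]
    rfl
  rw [map_sub, h1, h2, ← h, Evolution.op]
  abel

/-- `exists_trace` needs the shear to be a time integral, which is where the second derivative of
the input is used; `lift_tot_bending` then evaluates the moment at `x = 0`. -/
theorem Ψ_ae [hℓ : Fact (0 < B.ℓ)] (hB : B.Basic) {g : ℝ → ℝ} {g'' : L2 0 B.T ℝ}
    (hg : g =ᵐ[vol 0 B.T] prim true (prim true g'')) :
    (∀ᵐ t ∂vol 0 B.T, (∃ c, HasValue 0 B.ℓ (((B.sol g).D 0 t).D 2) 0 c) ∧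
      (∃ c, HasValue 0 B.ℓ (((B.sol g).D 1 t).D 2) 0 c)) ∧
    B.Ψ g =ᵐ[vol 0 B.T] M.outMoment g'' := by
  set P := M.fwd (prim true g'') with hP
  obtain ⟨q₁, h1, h2⟩ := M.fwd_spec g''
  obtain ⟨h3, h4⟩ := M.fwd_prim_spec g''
  set z₁ := lift cst (prim true g'')
    - lift (primX B) (lift M.D.ρ q₁ + lift M.D.μ (lift M.D.ι (M.fwd g''))) with hz₁
  -- `z₁` is the time derivative of the shear expression: the load, the acceleration and the
  -- velocity are each replaced by their derivatives, and `prim` undoes this.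
  have hz : prim true z₁ = lift cst (prim true (prim true g'')) - lift (primX B)
      (lift M.D.ρ (lift M.D.ι (M.fwd g'')) + lift M.D.μ (lift M.D.ι P)) := by
    rw [hz₁, hP, fwd_prim, h1, ← h1]
    simp only [map_sub, map_add, prim_lift]
    rw [h1]
  have hbend := M.bending_eq h4
  rw [← hP, ← hz] at hbend
  have htot := M.lift_tot_bending hℓ.1 (q := lift M.D.ι (M.fwd g'')) (p := P)
    (g := prim true (prim true g''))
  rw [← hz] at htot
  have hsol : B.sol g = ofVel P := M.sol_eq hB.time_pos hg
  have key : ∀ᵐ t ∂vol 0 B.T, ∃ c d, HasValue 0 B.ℓ (((B.sol g).D 0 t).D 2) 0 c ∧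
      HasValue 0 B.ℓ (((B.sol g).D 1 t).D 2) 0 d ∧ -(B.r 0 * c + B.κ 0 * d) = M.outMoment g'' t := by
    have hout : M.outMoment g'' = - lift tot (prim true z₁) := by
      rw [htot, outMoment_apply]; abel
    rw [hsol, hout]
    filter_upwards [M.exists_trace hB rfl hbend, ofVel_D_zero P, ofVel_D_one P,
      Lp.coeFn_neg (lift tot (prim true z₁)), coeFn_lift tot (prim true z₁)]
      with t ⟨c, d, hc, hd, hcd⟩ k1 k2 k3 k4
    rw [k1, k2, ofCurv_D_two, ofCurv_D_two]
    refine ⟨c, d, hc, hd, ?_⟩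
    rw [k3, Pi.neg_apply, k4, hcd]
  have h0 : (0 : ℝ) ∈ Icc 0 B.ℓ := left_mem_Icc.2 hℓ.1.le
  refine ⟨?_, ?_⟩
  · filter_upwards [key] with t ⟨c, d, hc, hd, _⟩
    exact ⟨⟨c, hc⟩, ⟨d, hd⟩⟩
  · filter_upwards [key] with t ⟨c, d, hc, hd, hcd⟩
    rw [Beam.Ψ, hc.value_eq hℓ.1 h0, hd.value_eq hℓ.1 h0, hcd]

end Model

/-! ### The adjoint problem with prescribed slope at the clamped end -/

/-- The element of `V` with given second derivative, as an element of `H²`. -/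
def ofCurvH {ℓ : ℝ} : L2 0 ℓ ℝ →L[ℝ] H2 ℓ := (leftSubmodule 2 0 ℓ).subtypeL.comp ofCurv

/-- The multiples of the function `x`. -/
def slopeH {ℓ : ℝ} : ℝ →L[ℝ] H2 ℓ := ContinuousLinearMap.toSpanSingleton ℝ (linFun ℓ)

/-- The function of time with values in `H²` that vanishes at `x = 0`, with given slope at `x = 0`
and second derivative. -/
def assemble {a b ℓ : ℝ} (θ : L2 a b ℝ) (ψ : L2 a b (L2 0 ℓ ℝ)) : L2 a b (H2 ℓ) :=
  lift (slopeH (ℓ := ℓ)) θ + lift (ofCurvH (ℓ := ℓ)) ψ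

theorem coeFn_assemble {a b ℓ : ℝ} (θ : L2 a b ℝ) (ψ : L2 a b (L2 0 ℓ ℝ)) :
    assemble θ ψ =ᵐ[vol a b] fun t => θ t • linFun ℓ + (ofCurv (ψ t)).1 := by
  filter_upwards [Lp.coeFn_add (lift (slopeH (ℓ := ℓ)) θ) (lift (ofCurvH (ℓ := ℓ)) ψ),
    coeFn_lift (slopeH (ℓ := ℓ)) θ, coeFn_lift (ofCurvH (ℓ := ℓ)) ψ] with t h1 h2 h3
  rw [assemble, h1, Pi.add_apply, h2, h3]
  rfl

theorem prim_assemble {a b ℓ : ℝ} [Fact (0 < ℓ)] (d : Bool) (θ : L2 a b ℝ)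
    (ψ : L2 a b (L2 0 ℓ ℝ)) :
    prim d (assemble θ ψ) = assemble (prim d θ) (prim d ψ) := by
  rw [assemble, map_add, prim_lift, prim_lift]
  rfl

theorem comp_zero_add (ℓ c : ℝ) (w : L2 0 ℓ ℝ) :
    (c • linFun ℓ + (ofCurv w).1).comp 0 = c • prim true (cst 1) + dbl ℓ w := rfl

theorem comp_two_add (ℓ c : ℝ) (w : L2 0 ℓ ℝ) :
    (c • linFun ℓ + (ofCurv w).1).comp 2 = w := by
  change c • (0 : L2 0 ℓ ℝ) + w = w
  rw [smul_zero, zero_add]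

/-- The derivative of order `j` in space of a function of time with values in `H²`. -/
def liftComp {a b ℓ : ℝ} (j : Fin 3) : L2 a b (H2 ℓ) →L[ℝ] L2 a b (L2 0 ℓ ℝ) :=
  lift (compL (E := ℝ) (m := 2) (a := 0) (b := ℓ) j)

theorem coeFn_liftComp {a b ℓ : ℝ} (j : Fin 3) (φ : L2 a b (H2 ℓ)) :
    liftComp j φ =ᵐ[vol a b] fun t => (φ t).comp j :=
  coeFn_lift (compL (E := ℝ) (m := 2) (a := 0) (b := ℓ) j) φ

theorem liftComp_two_assemble {a b ℓ : ℝ} (θ : L2 a b ℝ) (ψ : L2 a b (L2 0 ℓ ℝ)) :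
    liftComp 2 (assemble θ ψ) = ψ := by
  ext1
  filter_upwards [coeFn_liftComp 2 (assemble θ ψ), coeFn_assemble θ ψ] with t h1 h2
  rw [h1, h2, comp_two_add]

theorem values_iff_eq_assemble {a b ℓ : ℝ} (hℓ : 0 < ℓ) {θ : ℝ → ℝ} {Θ : L2 a b ℝ}
    (hθ : θ =ᵐ[vol a b] Θ) (φ : L2 a b (H2 ℓ)) :
    (∀ᵐ t ∂vol a b, HasValue 0 ℓ ((φ t).D 0) 0 0 ∧ HasValue 0 ℓ ((φ t).D 1) 0 (θ t)) ↔
      φ = assemble Θ (liftComp 2 φ) := by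
  rw [Lp.ext_iff]
  have h : ∀ᵐ t ∂vol a b, (HasValue 0 ℓ ((φ t).D 0) 0 0 ∧ HasValue 0 ℓ ((φ t).D 1) 0 (θ t) ↔
      φ t = assemble Θ (liftComp 2 φ) t) := by
    filter_upwards [hθ, coeFn_assemble Θ (liftComp 2 φ), coeFn_liftComp 2 φ] with t h1 h2 h3
    rw [h2, h1, h3, Sobolev.values_iff hℓ]
  exact Filter.eventually_congr h

namespace Model

variable {B : Beam} (M : Model B)

/-- The function `x` has no second derivative, so the slope enters only through the inertial and
damping terms, as the moment about `x = 0`. -/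
theorem integral_add_eq (c : ℝ) (f₁ f₂ f₃ f₄ w : L2 0 B.ℓ ℝ) :
    ∫ x in Ioo 0 B.ℓ, (B.ρ x * (c • linFun B.ℓ + (ofCurv w).1).D 0 x * f₁ x
        + B.μ x * (c • linFun B.ℓ + (ofCurv w).1).D 0 x * f₂ x
        + B.r x * (c • linFun B.ℓ + (ofCurv w).1).D 2 x * f₃ x
        + B.κ x * (c • linFun B.ℓ + (ofCurv w).1).D 2 x * f₄ x)
      = ⟪w, M.D.mass f₁ + M.D.ιadj (M.D.μ f₂) + M.D.r f₃ + M.D.κ f₄⟫_ℝ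
        + c * (⟪M.D.ρ (arm B), f₁⟫_ℝ + ⟪M.D.μ (arm B), f₂⟫_ℝ) := by
  simp only [Sobolev.D]
  rw [comp_two_add, comp_zero_add]
  set y := c • prim true (cst 1) + dbl B.ℓ w with hy
  have i1 := integrable_mulOp_mul M.ρ_spec y f₁
  have i2 := integrable_mulOp_mul M.μ_spec y f₂
  have i3 := integrable_mulOp_mul M.r_spec w f₃
  have i4 := integrable_mulOp_mul M.κ_spec w f₄
  rw [integral_add ((i1.fun_add i2).fun_add i3) i4, integral_add (i1.fun_add i2) i3,
    integral_add i1 i2, ← inner_mulOp_left M.ρ_spec, ← inner_mulOp_left M.μ_spec,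
    ← inner_mulOp_left M.r_spec, ← inner_mulOp_left M.κ_spec, hy, ← M.ι_eq]
  simp only [inner_add_left, inner_add_right, Evolution.mass, Evolution.ιadj,
    ContinuousLinearMap.comp_apply, ContinuousLinearMap.adjoint_inner_right, map_add, map_smul,
    real_inner_smul_left, M.D.ρ_symm, M.D.μ_symm, M.D.r_symm, M.D.κ_symm, arm]
  ring

theorem coeFn_op (d : Bool) (q p : L2 0 B.T (L2 0 B.ℓ ℝ)) :
    M.D.op d q p =ᵐ[vol 0 B.T] fun t => M.D.mass (q t) + M.D.damp (p t) + M.D.r (prim d p t)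
      + M.D.κ (p t) := by
  filter_upwards [Lp.coeFn_add (lift M.D.mass q + lift M.D.damp p + lift M.D.r (prim d p))
      (lift M.D.κ p), Lp.coeFn_add (lift M.D.mass q + lift M.D.damp p) (lift M.D.r (prim d p)),
    Lp.coeFn_add (lift M.D.mass q) (lift M.D.damp p), coeFn_lift M.D.mass q,
    coeFn_lift M.D.damp p, coeFn_lift M.D.r (prim d p), coeFn_lift M.D.κ p]
    with t h1 h2 h3 h4 h5 h6 h7
  rw [Evolution.op, h1, Pi.add_apply, h2, Pi.add_apply, h3, Pi.add_apply, h4, h5, h6, h7]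

theorem coeFn_moment (q p : L2 0 B.T (L2 0 B.ℓ ℝ)) :
    M.moment q p =ᵐ[vol 0 B.T] fun t => ⟪M.D.ρ (arm B), q t⟫_ℝ
      + ⟪M.D.μ (arm B), M.D.ι (p t)⟫_ℝ := by
  filter_upwards [Lp.coeFn_add (pair (M.D.ρ (arm B)) q) (pair (M.D.μ (arm B)) (lift M.D.ι p)),
    coeFn_pair (M.D.ρ (arm B)) q, coeFn_pair (M.D.μ (arm B)) (lift M.D.ι p),
    coeFn_lift M.D.ι p] with t h1 h2 h3 h4
  rw [moment, h1, Pi.add_apply, h2, h3, h4]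

theorem integral_assemble (hℓ : 0 < B.ℓ) (Θ : L2 0 B.T ℝ) (ψ : L2 0 B.T (L2 0 B.ℓ ℝ))
    (η : Sobolev (V B.ℓ) 1 0 B.T) (q : L2 0 B.T (L2 0 B.ℓ ℝ))
    (hη : liftCurv (η.comp 0) = prim true (vel η)) :
    ∫ t in Ioo 0 B.T, ∫ x in Ioo 0 B.ℓ,
      (B.ρ x * (assemble Θ ψ t).D 0 x * q t x + B.μ x * (assemble Θ ψ t).D 0 x * (η.D 1 t).D 0 x
        + B.r x * (assemble Θ ψ t).D 2 x * (η.D 0 t).D 2 x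
        + B.κ x * (assemble Θ ψ t).D 2 x * (η.D 1 t).D 2 x)
      = ⟪ψ, M.D.op true q (vel η)⟫_ℝ + ⟪Θ, M.moment q (vel η)⟫_ℝ := by
  rw [L2.inner_def, L2.inner_def, ← integral_add (L2.integrable_inner _ _)
    (L2.integrable_inner _ _)]
  refine integral_congr_ae ?_
  filter_upwards [coeFn_assemble Θ ψ, M.coeFn_op true q (vel η), M.coeFn_moment q (vel η),
    coeFn_liftCurv (η.comp 0), coeFn_liftCurv (η.comp 1)] with t h1 h2 h3 h4 h5
  rw [h1, h2, h3, ← hη, h4]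
  have e := M.integral_add_eq (Θ t) (q t) ((η.comp 1 t).1.comp 0) ((η.comp 0 t).1.comp 2)
    ((η.comp 1 t).1.comp 2) (ψ t)
  refine Eq.trans e ?_
  have e1 : vel η t = (η.comp 1 t).1.comp 2 := h5
  have e2 : (η.comp 1 t).1.comp 0 = M.D.ι (vel η t) := by
    rw [V.comp_zero hℓ, M.ι_eq, e1]; rfl
  rw [e2, ← e1]
  simp only [RCLike.inner_apply, RCLike.conj_to_real]
  rw [mul_comm (Θ t)]
  rfl

theorem velocity_iff [hℓ : Fact (0 < B.ℓ)] (hT : 0 < B.T) (η : Sobolev (V B.ℓ) 1 0 B.T)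
    (q : L2 0 B.T (L2 0 B.ℓ ℝ)) :
    (HasWeakDeriv 0 B.T (fun t => (η.D 1 t).toL2) q ∧ HasValue 0 B.T (η.D 0) 0 0 ∧
      HasValue 0 B.T (fun t => (η.D 1 t).toL2) 0 0) ↔
    η.comp 0 = prim true (η.comp 1) ∧ lift M.D.ι (vel η) = prim true q := by
  have e0 : HasValue 0 B.T (η.D 0) 0 0 ↔ η.comp 0 = prim true (η.comp 1) := by
    rw [← hasWeakDeriv_and_hasValue_left_zero_iff hT (ae_eq_refl (η.comp 0))]
    exact ⟨fun h => ⟨η.2 0, h⟩, fun h => h.2⟩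
  have e1 := hasWeakDeriv_and_hasValue_left_zero_iff hT (f' := q) (M.toL2_ae hℓ.1 (η.comp 1))
  rw [← e0]
  refine ⟨fun ⟨h1, h2, h3⟩ => ⟨h2, e1.1 ⟨h1, h3⟩⟩, fun ⟨h2, h⟩ => ?_⟩
  obtain ⟨h1, h3⟩ := e1.2 h
  exact ⟨h1, h2, h3⟩

/-- The admissible test functions `η` are exactly the functions that start from rest, so they are
parametrized by the pairs `(q, p)` of the forward problem. -/
theorem isDirichletAdjoint_iff [hℓ : Fact (0 < B.ℓ)] (hT : 0 < B.T) {θ : ℝ → ℝ}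
    {Θ : L2 0 B.T ℝ} (hθ : θ =ᵐ[vol 0 B.T] Θ) (φ : L2 0 B.T (H2 B.ℓ)) :
    B.IsDirichletAdjoint θ φ ↔ φ = assemble Θ (liftComp 2 φ) ∧
      ∀ q p : L2 0 B.T (L2 0 B.ℓ ℝ), lift M.D.ι p = prim true q →
        ⟪liftComp 2 φ, M.D.op true q p⟫_ℝ + ⟪Θ, M.moment q p⟫_ℝ = 0 := by
  rw [Beam.IsDirichletAdjoint, values_iff_eq_assemble hℓ.1 hθ]
  refine and_congr_right fun hφ => ?_
  set ψ := liftComp 2 φ with hψ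
  clear_value ψ
  subst hφ
  constructor
  · intro h q p hqp
    obtain ⟨h1, h2, h3⟩ := (M.velocity_iff hT (ofVel p) q).2 ⟨rfl, by rw [vel_ofVel, hqp]⟩
    have h4 := h (ofVel p) q h1 h2 h3
    rw [M.integral_assemble hℓ.1 Θ ψ (ofVel p) q (prim_liftCurv true _).symm, vel_ofVel] at h4
    exact h4
  · intro h η q h1 h2 h3
    obtain ⟨h4, h5⟩ := (M.velocity_iff hT η q).1 ⟨h1, h2, h3⟩
    rw [M.integral_assemble hℓ.1 Θ ψ η q (by rw [h4, vel, prim_liftCurv])]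
    exact h q (vel η) h5

theorem isDirichletAdjoint_iff_eq [hℓ : Fact (0 < B.ℓ)] (hT : 0 < B.T) {θ : ℝ → ℝ}
    {Θ : L2 0 B.T ℝ} (hθ : θ =ᵐ[vol 0 B.T] Θ) {ψ : L2 0 B.T (L2 0 B.ℓ ℝ)}
    (hψ : ∀ q p : L2 0 B.T (L2 0 B.ℓ ℝ), lift M.D.ι p = prim true q →
        ⟪ψ, M.D.op true q p⟫_ℝ + ⟪Θ, M.moment q p⟫_ℝ = 0) (φ : L2 0 B.T (H2 B.ℓ)) :
    B.IsDirichletAdjoint θ φ ↔ φ = assemble Θ ψ := by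
  rw [M.isDirichletAdjoint_iff hT hθ]
  constructor
  · rintro ⟨h1, h2⟩
    rw [h1, M.D.transposed_unique (ψ := liftComp 2 φ) (ψ' := ψ) fun q p h => by
      linarith [h2 q p h, hψ q p h]]
  · rintro rfl
    rw [liftComp_two_assemble]
    exact ⟨rfl, hψ⟩

theorem exists_dirichletAdjoint (hT : 0 < B.T) (θ : Sobolev ℝ 2 0 B.T) :
    ∃ ψ : L2 0 B.T (L2 0 B.ℓ ℝ), ∀ q p : L2 0 B.T (L2 0 B.ℓ ℝ), lift M.D.ι p = prim true q →
      ⟪ψ, M.D.op true q p⟫_ℝ + ⟪θ.comp 0, M.moment q p⟫_ℝ = 0 := by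
  obtain ⟨c, hc⟩ := (hasWeakDeriv_iff hT).1 (θ.2 0)
  -- `c` is `θ(0)`, and adding the integral of `θ'` gives `θ(T)`.
  refine M.D.exists_transposed _ _ (c + tot (θ.comp 1)) (θ.comp 0) (θ.comp 1) ?_
  change θ.comp 0 = cst c + prim true (θ.comp 1) at hc
  rw [hc, prim_true_eq, map_add]
  abel

theorem tip_assemble (hℓ : 0 < B.ℓ) (Θ : L2 0 B.T ℝ) (ψ : L2 0 B.T (L2 0 B.ℓ ℝ)) :
    (fun t => tip (assemble Θ ψ t)) =ᵐ[vol 0 B.T]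
      (B.ℓ • Θ + lift (tipL B) ψ : L2 0 B.T ℝ) := by
  filter_upwards [coeFn_assemble Θ ψ, Lp.coeFn_add (B.ℓ • Θ) (lift (tipL B) ψ),
    Lp.coeFn_smul B.ℓ Θ, coeFn_lift (tipL B) ψ] with t h1 h2 h3 h4
  rw [h1, tip_eq hℓ, h2, Pi.add_apply, h3, h4, Pi.smul_apply, smul_eq_mul, mul_comm]
  rfl

/-- The transposed identity is tested with the solution of the direct problem. The term `ℓ g` in the
reaction matches the part `ℓ θ` of the tip value of `φ`. -/
theorem inner_outMoment {Θ : L2 0 B.T ℝ} {ψ : L2 0 B.T (L2 0 B.ℓ ℝ)}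
    (hψ : ∀ q p : L2 0 B.T (L2 0 B.ℓ ℝ), lift M.D.ι p = prim true q →
        ⟪ψ, M.D.op true q p⟫_ℝ + ⟪Θ, M.moment q p⟫_ℝ = 0) (h : L2 0 B.T ℝ) :
    ⟪-Θ, M.outMoment h⟫_ℝ = ⟪B.ℓ • Θ + lift (tipL B) ψ, prim true (prim true h)⟫_ℝ := by
  obtain ⟨h1, h2⟩ := M.fwd_prim_spec h
  have h3 := hψ _ _ h1
  rw [h2, real_inner_comm, inner_load, real_inner_comm] at h3
  rw [outMoment_apply, inner_neg_left, inner_sub_right, inner_add_left, inner_smul_left,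
    inner_smul_right]
  simp only [RCLike.conj_to_real]
  linarith

end Model

/-! ### Regular solutions for a slope compatible with the terminal conditions. -/

theorem assemble_neg {a b ℓ : ℝ} (θ : L2 a b ℝ) (ψ : L2 a b (L2 0 ℓ ℝ)) :
    assemble (-θ) (-ψ) = -assemble θ ψ := by
  rw [assemble, assemble, map_neg, map_neg]
  abel

/-- The functions of time with values in a line. -/
def span {E : Type*} [NormedAddCommGroup E] [InnerProductSpace ℝ E] {a b : ℝ} (x : E) :
    L2 a b ℝ →L[ℝ] L2 a b E := lift (ContinuousLinearMap.toSpanSingleton ℝ x)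

theorem coeFn_span {E : Type*} [NormedAddCommGroup E] [InnerProductSpace ℝ E] {a b : ℝ} (x : E)
    (f : L2 a b ℝ) : span x f =ᵐ[vol a b] fun t => f t • x :=
  coeFn_lift (ContinuousLinearMap.toSpanSingleton ℝ x) f

theorem inner_span {E : Type*} [NormedAddCommGroup E] [InnerProductSpace ℝ E] {a b : ℝ} (x : E)
    (h : L2 a b ℝ) (f : L2 a b E) : ⟪span x h, f⟫_ℝ = ⟪h, pair x f⟫_ℝ :=
  inner_lift_toSpanSingleton x f h

namespace Model

variable {B : Beam} (M : Model B)

/-- The third derivative of the input pays for two time derivatives of the reaction, which puts `θ`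
in `H²(0, T)`. -/
theorem exists_outMoment_prim (g : L2 0 B.T ℝ) :
    ∃ k, M.outMoment (prim true g) = prim true (prim true k) := by
  obtain ⟨q, h1, -⟩ := M.fwd_spec g
  refine ⟨M.moment q (M.fwd g) - B.ℓ • prim true g, ?_⟩
  rw [outMoment_apply, fwd_prim, fwd_prim, fwd_prim, ← prim_lift, h1, moment_prim, moment_prim]
  simp only [map_sub, map_smul]

/-- After subtracting `θ x`, the remainder solves a backward problem in `V` with a force in `L²`. By
`duality` it satisfies the transposed identity, so it is the very weak solution. -/
theorem exists_regularDirichletAdjoint [hℓ : Fact (0 < B.ℓ)] (hT : 0 < B.T)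
    (θ : Sobolev ℝ 2 0 B.T) (h0 : HasValue 0 B.T (θ.D 0) B.T 0)
    (h1 : HasValue 0 B.T (θ.D 1) B.T 0) :
    ∃ (Φ : Sobolev (H2 B.ℓ) 1 0 B.T) (ψ : L2 0 B.T (L2 0 B.ℓ ℝ)),
      Φ.comp 0 = assemble (θ.comp 0) ψ ∧
      (∀ q p : L2 0 B.T (L2 0 B.ℓ ℝ), lift M.D.ι p = prim true q →
        ⟪ψ, M.D.op true q p⟫_ℝ + ⟪θ.comp 0, M.moment q p⟫_ℝ = 0) ∧
      B.IsRegularDirichletAdjoint (θ.D 0) Φ := by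
  have t0 : θ.comp 0 = - prim false (θ.comp 1) :=
    (hasWeakDeriv_and_hasValue_right_zero_iff hT (ae_eq_refl _)).1 ⟨θ.2 0, h0⟩
  have t1 : θ.comp 1 = - prim false (θ.comp 2) :=
    (hasWeakDeriv_and_hasValue_right_zero_iff hT (ae_eq_refl _)).1 ⟨θ.2 1, h1⟩
  -- The force left by `θ x` in the adjoint equation, `-(ρ θ'' - μ θ') x`; the elastic terms vanish
  -- because the second derivative of `x` does.
  set f : L2 0 B.T (L2 0 B.ℓ ℝ) := span (M.D.μ (arm B)) (θ.comp 1)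
    - span (M.D.ρ (arm B)) (θ.comp 2) with hf
  obtain ⟨q', p', e1, e2⟩ := M.D.exists_solution false f 0 0
  rw [map_zero, map_zero, add_zero, add_zero] at e2
  have hφ : assemble (θ.comp 0) (prim false p') = - prim false (assemble (θ.comp 1) (-p')) := by
    rw [prim_assemble, ← assemble_neg, map_neg, neg_neg, ← t0]
  obtain ⟨hd, hv⟩ := (hasWeakDeriv_and_hasValue_right_zero_iff hT (ae_eq_refl _)).2 hφ
  set utt : L2 0 B.T (L2 0 B.ℓ ℝ) := span (arm B) (θ.comp 2) + q' with hutt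
  have hvel : (fun t => (assemble (θ.comp 1) (-p') t).comp 0) =ᵐ[vol 0 B.T]
      (span (arm B) (θ.comp 1) - lift M.D.ι p' : L2 0 B.T (L2 0 B.ℓ ℝ)) := by
    filter_upwards [coeFn_assemble (θ.comp 1) (-p'), Lp.coeFn_neg p',
      Lp.coeFn_sub (span (arm B) (θ.comp 1)) (lift M.D.ι p'), coeFn_span (arm B) (θ.comp 1),
      coeFn_lift M.D.ι p'] with t k1 k2 k3 k4 k5
    rw [k1, k2, k3, Pi.sub_apply, k4, k5, comp_zero_add, Pi.neg_apply, map_neg, M.ι_eq, arm,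
      sub_eq_add_neg]
  have hvel' : (span (arm B) (θ.comp 1) - lift M.D.ι p' : L2 0 B.T (L2 0 B.ℓ ℝ))
      = - prim false utt := by
    rw [hutt, e1, map_add, t1, span, map_neg, prim_lift]
    abel
  obtain ⟨hd2, hv2⟩ := (hasWeakDeriv_and_hasValue_right_zero_iff hT hvel).2 hvel'
  refine ⟨mkH1 _ _ hd, prim false p', rfl, fun q p hqp => ?_, utt, hd2, ?_, fun v => ?_, hv, hv2⟩
  · have k1 := M.D.duality true hqp e1
    -- The terminal conditions `θ(T) = θ'(T) = 0` are used here: the time derivatives of `θ` move to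
    -- the other factor without boundary terms.
    have s1 : ⟪span (M.D.μ (arm B)) (θ.comp 1), prim true (lift M.D.ι p)⟫_ℝ
        = -⟪θ.comp 0, pair (M.D.μ (arm B)) (lift M.D.ι p)⟫_ℝ := by
      rw [inner_span, pair, ← prim_lift, inner_prim_right, t0, inner_neg_left, neg_neg]
      rfl
    have s2 : ⟪span (M.D.ρ (arm B)) (θ.comp 2), prim true (lift M.D.ι p)⟫_ℝ
        = ⟪θ.comp 0, pair (M.D.ρ (arm B)) q⟫_ℝ := by
      rw [hqp, inner_span, pair, ← prim_lift, ← prim_lift, inner_prim_right, inner_prim_right, t0,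
        t1, map_neg, neg_neg]
      rfl
    rw [Bool.not_true, e2, real_inner_comm, ← real_inner_comm (prim true p), M.D.inner_ιadj,
      ← prim_lift, hf, inner_sub_left, s1, s2] at k1
    rw [k1, moment, inner_add_right]
    ring
  · refine (values_iff_eq_assemble hℓ.1 (Filter.EventuallyEq.refl _ _) _).2 ?_
    rw [mkH1_comp_zero, liftComp_two_assemble]
  · filter_upwards [coeFn_assemble (θ.comp 0) (prim false p'),
      coeFn_assemble (θ.comp 1) (-p'), Lp.coeFn_neg p', M.coeFn_op false q' p',
      coeFn_lift M.D.ιadj f, Lp.coeFn_sub (span (M.D.μ (arm B)) (θ.comp 1))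
        (span (M.D.ρ (arm B)) (θ.comp 2)), coeFn_span (M.D.μ (arm B)) (θ.comp 1),
      coeFn_span (M.D.ρ (arm B)) (θ.comp 2), coeFn_span (arm B) (θ.comp 2),
      Lp.coeFn_add (span (arm B) (θ.comp 2)) q'] with t k1 k2 k3 k4 k5 k6 k7 k8 k9 k10
    have e := M.integral_eq (-1) (utt t) ((assemble (θ.comp 1) (-p') t).comp 0)
      ((assemble (θ.comp 0) (prim false p') t).comp 2) ((assemble (θ.comp 1) (-p') t).comp 2)
      (curv v)
    simp only [neg_one_mul, ← sub_eq_add_neg, neg_one_smul] at e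
    rw [← V.comp_zero hℓ.1 v] at e
    refine Eq.trans e ?_
    have key : M.D.mass (utt t) - M.D.ιadj (M.D.μ ((assemble (θ.comp 1) (-p') t).comp 0))
        + M.D.r ((assemble (θ.comp 0) (prim false p') t).comp 2)
        - M.D.κ ((assemble (θ.comp 1) (-p') t).comp 2) = 0 := by
      have k11 : M.D.mass (q' t) + M.D.damp (p' t) + M.D.r (prim false p' t) + M.D.κ (p' t)
          = M.D.ιadj (θ.comp 1 t • M.D.μ (arm B) - θ.comp 2 t • M.D.ρ (arm B)) := by
        rw [← k4, e2, k5, k6, Pi.sub_apply, k7, k8]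
      have k12 : M.D.damp (p' t) = M.D.ιadj (M.D.μ (dbl B.ℓ (p' t))) := by rw [← M.ι_eq]; rfl
      have k13 : ∀ x, M.D.mass x = M.D.ιadj (M.D.ρ x) := fun x => rfl
      rw [k1, k2, comp_two_add, comp_two_add, comp_zero_add, hutt, k10, Pi.add_apply, k9, k3,
        Pi.neg_apply]
      rw [k12, k13, map_sub, map_smul, map_smul] at k11
      rw [k13]
      change M.D.ιadj (M.D.ρ (θ.comp 2 t • arm B + q' t))
        - M.D.ιadj (M.D.μ (θ.comp 1 t • arm B + dbl B.ℓ (- p' t))) + _ - _ = 0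
      simp only [map_add, map_neg, map_smul]
      rw [← sub_eq_zero] at k11
      rw [← k11]
      abel
    rw [key, inner_zero_left]

/-! ### The gradient of the reaction functional. -/

theorem secondFunctional {B : Beam} (M : Model B) [hℓ : Fact (0 < B.ℓ)] (hB : B.Basic) :
    (∀ g : SobolevLeft 3 0 B.T,
        (∃! u, B.IsDirectSolution (g.D 0) u) ∧
          (∀ᵐ t ∂vol 0 B.T,
            (∃ c, HasValue 0 B.ℓ (((B.sol (g.D 0)).D 0 t).D 2) 0 c) ∧
            (∃ c, HasValue 0 B.ℓ (((B.sol (g.D 0)).D 1 t).D 2) 0 c)) ∧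
          MemLp (B.Ψ (g.D 0)) 2 (vol 0 B.T)) ∧
      ∀ (ω : Sobolev ℝ 2 0 B.T) (g : SobolevLeft 3 0 B.T),
        ∃ θ : Sobolev ℝ 2 0 B.T,
          (θ.D 0 =ᵐ[vol 0 B.T] fun t => - B.Ψ (g.D 0) t + ω.D 0 t) ∧
          ∃ φ : L2 0 B.T (H2 B.ℓ),
            (∀ φ' : L2 0 B.T (H2 B.ℓ), B.IsDirichletAdjoint (θ.D 0) φ' ↔ φ' = φ) ∧
            B.HasGradient (B.J₂ (ω.D 0)) g (fun t => tip (φ t)) ∧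
            (HasValue 0 B.T (θ.D 0) B.T 0 → HasValue 0 B.T (θ.D 1) B.T 0 →
              ∃ Φ : Sobolev (H2 B.ℓ) 1 0 B.T,
                Φ.comp 0 = φ ∧ B.IsRegularDirichletAdjoint (θ.D 0) Φ) := by
  have hT := hB.time_pos
  have c0 : ∀ g : SobolevLeft 3 0 B.T, g.1.comp 0 = prim true (g.1.comp 1) := fun g =>
    left_comp hT g 0
  have c1 : ∀ g : SobolevLeft 3 0 B.T, g.1.comp 1 = prim true (g.1.comp 2) := fun g =>
    left_comp hT g 1
  have c2 : ∀ g : SobolevLeft 3 0 B.T, g.1.comp 2 = prim true (g.1.comp 3) := fun g =>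
    left_comp hT g 2
  have hg : ∀ g : SobolevLeft 3 0 B.T, g.D 0 =ᵐ[vol 0 B.T] prim true (prim true (g.1.comp 2)) :=
    fun g => Filter.EventuallyEq.of_eq (congrArg (fun f : L2 0 B.T ℝ => (f : ℝ → ℝ))
      ((c0 g).trans (congrArg _ (c1 g))))
  have hΨ := fun g => M.Ψ_ae hB (hg g)
  refine ⟨fun g => ⟨⟨_, (M.isDirectSolution_iff_eq hT (hg g) _).2 rfl, fun u hu =>
    (M.isDirectSolution_iff_eq hT (hg g) _).1 hu⟩, (hΨ g).1,
    (memLp_congr_ae (hΨ g).2).2 (Lp.memLp _)⟩, fun ω g => ?_⟩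
  obtain ⟨k, hk⟩ := M.exists_outMoment_prim (g.1.comp 3)
  rw [← c2] at hk
  -- `θ` is `ω - Ψ g`, that is, minus the residual; this sign is matched by `-Θ` in
  -- `inner_outMoment`.
  let θ : Sobolev ℝ 2 0 B.T := ω - mkH2 (prim true (prim true k)) (prim true k) k
    (hasWeakDeriv_prim _) (hasWeakDeriv_prim _)
  have hθ : θ.comp 0 = -(M.outMoment (g.1.comp 2) - ω.comp 0) := by
    rw [neg_sub, hk]; rfl
  have hae : ∀ g : SobolevLeft 3 0 B.T, (fun t => B.Ψ (g.D 0) t - ω.D 0 t) =ᵐ[vol 0 B.T]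
      (M.outMoment (g.1.comp 2) - ω.comp 0 : L2 0 B.T ℝ) := fun g => by
    filter_upwards [(hΨ g).2, Lp.coeFn_sub (M.outMoment (g.1.comp 2)) (ω.comp 0)] with t h1 h2
    rw [h1, h2]; rfl
  obtain ⟨ψ, hψ⟩ := M.exists_dirichletAdjoint hT θ
  refine ⟨θ, ?_, assemble (θ.comp 0) ψ,
    M.isDirichletAdjoint_iff_eq hT (Filter.EventuallyEq.refl _ _) hψ, ?_, fun h0 h1 => ?_⟩
  · rw [Sobolev.D, hθ]
    filter_upwards [hae g, Lp.coeFn_neg (M.outMoment (g.1.comp 2) - ω.comp 0)] with t h1 h2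
    rw [h2, Pi.neg_apply, ← h1]
    ring
  · refine B.hasGradient_of_norm_sq
      (M.outMoment.comp ((compL 2).comp (leftSubmodule 3 0 B.T).subtypeL)) (ω.comp 0)
      (fun k => ?_) g _ (tip_assemble hℓ.1 (θ.comp 0) ψ) (fun k => ?_)
    · rw [Beam.J₂, ← norm_sq_eq_integral (hae k)]; rfl
    · have h := M.inner_outMoment hψ (k.1.comp 2)
      rw [hθ, neg_neg, ← hθ, ← c1, ← c0] at h
      exact h
  · obtain ⟨Φ, ψ', e1, e2, e3⟩ := M.exists_regularDirichletAdjoint hT θ h0 h1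
    refine ⟨Φ, ?_, e3⟩
    rw [e1, ← M.isDirichletAdjoint_iff_eq hT (Filter.EventuallyEq.refl _ _) hψ,
      M.isDirichletAdjoint_iff_eq hT (Filter.EventuallyEq.refl _ _) e2]

end Model

end KVBeam

end

theorem theorem4p1 (B : KVBeam.Beam) (hB : B.Basic) :
    -- the first functional
    ( -- the functional is well defined: the direct problem has exactly one weak solution,
      -- and its tip deflection is in `L²(0, T)`
      (∀ g : KVBeam.SobolevLeft 1 0 B.T,
        (∃! u, B.IsDirectSolution (g.D 0) u) ∧
          MeasureTheory.MemLp (B.Φ (g.D 0)) 2 (KVBeam.vol 0 B.T)) ∧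
      ∀ (ν : KVBeam.Sobolev ℝ 1 0 B.T) (C : ℝ), 0 < C → ∀ g ∈ B.Admissible 1 C,
        ∃ φ : KVBeam.Sobolev (KVBeam.V B.ℓ) 1 0 B.T,
          (∀ φ' : KVBeam.Sobolev (KVBeam.V B.ℓ) 1 0 B.T,
            B.IsNeumannAdjoint (fun t => B.Φ (g.D 0) t - ν.D 0 t) φ' ↔ φ' = φ) ∧
          B.HasGradient (B.J₁ (ν.D 0)) g (fun t => KVBeam.tip (φ.D 0 t).1)) ∧
    -- the second functional
    (B.Regular →
      -- the functional is well defined: the direct problem has exactly one weak solution,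
      -- the traces of `u_xx` and `u_xxt` at `x = 0` exist, and `Ψ g` is in `L²(0, T)`
      (∀ g : KVBeam.SobolevLeft 3 0 B.T,
        (∃! u, B.IsDirectSolution (g.D 0) u) ∧
          (∀ᵐ t ∂KVBeam.vol 0 B.T,
            (∃ c, KVBeam.HasValue 0 B.ℓ (((B.sol (g.D 0)).D 0 t).D 2) 0 c) ∧
            (∃ c, KVBeam.HasValue 0 B.ℓ (((B.sol (g.D 0)).D 1 t).D 2) 0 c)) ∧
          MeasureTheory.MemLp (B.Ψ (g.D 0)) 2 (KVBeam.vol 0 B.T)) ∧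
      ∀ (ω : KVBeam.Sobolev ℝ 2 0 B.T) (C : ℝ), 0 < C → ∀ g ∈ B.Admissible 3 C,
        -- the input `θ = r(0) u_xx(0, ·) + κ(0) u_xxt(0, ·) + ω` of the adjoint problem is in `H²`
        ∃ θ : KVBeam.Sobolev ℝ 2 0 B.T,
          (θ.D 0 =ᵐ[KVBeam.vol 0 B.T] fun t => - B.Ψ (g.D 0) t + ω.D 0 t) ∧
          ∃ φ : KVBeam.L2 0 B.T (KVBeam.H2 B.ℓ),
            (∀ φ' : KVBeam.L2 0 B.T (KVBeam.H2 B.ℓ),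
              B.IsDirichletAdjoint (θ.D 0) φ' ↔ φ' = φ) ∧
            B.HasGradient (B.J₂ (ω.D 0)) g (fun t => KVBeam.tip (φ t)) ∧
            -- if `θ(T) = θ'(T) = 0`, then `φ` is a solution in the same sense as above
            (KVBeam.HasValue 0 B.T (θ.D 0) B.T 0 → KVBeam.HasValue 0 B.T (θ.D 1) B.T 0 →
              ∃ Φ : KVBeam.Sobolev (KVBeam.H2 B.ℓ) 1 0 B.T,
                Φ.comp 0 = φ ∧ B.IsRegularDirichletAdjoint (θ.D 0) Φ)) := by
  have : Fact (0 < B.ℓ) := ⟨hB.length_pos⟩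
  obtain ⟨M⟩ := hB.exists_model
  obtain ⟨h1, h2⟩ := M.firstFunctional hB.time_pos
  obtain ⟨h3, h4⟩ := M.secondFunctional hB
  exact ⟨⟨h1, fun ν _ _ g _ => h2 ν g⟩, fun _ => ⟨h3, fun ω _ _ g _ => h4 ω g⟩⟩
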